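/- Trees are finite, rooted and non-plane (the subtrees of a vertex are unordered); a tree is regarded as a poset on its vertices whose maximum is the root. A binary tree is a tree in which every vertex has $0$ or $2$ children, and $\mathcal V_n$ is the set of (isomorphism classes of) binary trees with $n$ vertices. An embedding of a tree $S$ into a tree $T$ is a subposet of $T$ isomorphic to $S$, where two subposets that are mapped onto each other by an automorphism of $T$ count as the same embedding; it is good if it contains the root of $T$. Let $a_T(S)$ and $g_T(S)$ be the numbers of embeddings and of good embeddings of $S$ into $T$, and put $a_{\mathcal V_n}(S)=\sum_{T\in\mathcal V_n}a_T(S)$ and $g_{\mathcal V_n}(S)=\sum_{T\in\mathcal V_n}g_T(S)$. For a tree $S$ let $\mathcal M_S$ be the set of (isomorphism classes of) non-plane unary-binary trees obtained from $S$ by replacing each vertex with $d\ge 3$ children by a non-plane binary tree with $d$ leaves, at which the $d$ subtrees are attached; the root of this binary tree is the original vertex, and its $d-2$ other internal vertices are marked as auxiliary (isomorphisms preserve the marks). A symmetry vertex of $t\in\mathcal M_S$ is a vertex with two children whose subtrees are isomorphic. Put $$C_S=\sum_{t\in\mathcal M_S}\left(\tfrac12\right)^{s(t)},\qquad s(t)=\text{number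 of symmetry vertices of }t .$$ Let $V(z)=\sum_{n}|\mathcal V_n|z^n$, let $\rho$ be its radius of convergence, and let $b$ be the constant with $$V(z)=\frac1\rho-b\sqrt{1-\frac z\rho}+o\!\left(\sqrt{1-\frac z\rho}\right)\qquad(z\to\rho^-).$$ **Theorem.** These constants exist, and $\rho\approx 0.6346$, $b\approx 2.5184$ (correct to four decimals). For every tree $S$ with $m$ vertices and $l$ leaves, as $n\to\infty$ through the odd integers, $$a_{\mathcal V_n}(S)\sim\frac{2C_S\,b^{-m-l+1}\rho^{-m-l}}{\Gamma\left(\frac{m+l-1}{2}\right)}\,\rho^{-n}\,n^{\frac{m+l-3}{2}},$$ $$g_{\mathcal V_n}(S)\sim\begin{cases}\dfrac{2C_S\,b^{-m-l+2}\rho^{-m-l+1}}{\Gamma\left(\frac{m+l-2}{2}\right)}\,\rho^{-n}\,n^{\frac{m+l-4}{2}}&\text{if }m+l-2>0,\\[2ex]\dfrac{b}{\sqrt\pi}\,\rho^{-n}\,n^{-3/2}&\text{if }m+l-2=0,\end{cases}$$ and $a_{\mathcal V_n}(S)=g_{\mathcal V_n}(S)=0$ for every even $n$. -/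

import Mathlib

open Filter Topology Asymptotics

/-- Rooted trees: a root together with a finite family of subtrees. A term is a plane
representative; all notions below see it only up to reordering of the subtrees. -/
inductive RTree : Type
  | node (d : ℕ) (c : Fin d → RTree) : RTree

namespace RTree

/-- The vertices of a rooted tree: the root (`⊤`) and the vertices of the subtrees. -/
def Vertex : RTree → Type
  | node _ c => WithTop (Σ i, Vertex (c i))

/-- The tree as a poset whose maximum is the root: `v ≤ w` iff `w` lies on the path from the
root to `v`. (Vertices of different subtrees are incomparable.) -/
@[reducible]
def vertexOrder : (t : RTree) → PartialOrder t.Vertex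
  | node _ c =>
    letI : ∀ i, PartialOrder (c i).Vertex := fun i => vertexOrder (c i)
    inferInstanceAs (PartialOrder (WithTop (Σ i, (c i).Vertex)))

instance (t : RTree) : PartialOrder t.Vertex := vertexOrder t

/-- The root of a tree, as a vertex. -/
def root : (t : RTree) → t.Vertex
  | node _ c => (⊤ : WithTop (Σ i, Vertex (c i)))

/-- The number of vertices. -/
def size : RTree → ℕ
  | node _ c => 1 + ∑ i, size (c i)

/-- The number of leaves (vertices of out-degree `0`). -/
def leaves : RTree → ℕ
  | node d c => if d = 0 then 1 else ∑ i, leaves (c i)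

/-- Every vertex has out-degree `0` or `2`. -/
def IsBinary : RTree → Prop
  | node d c => (d = 0 ∨ d = 2) ∧ ∀ i, IsBinary (c i)

/-- Isomorphism of non-plane rooted trees: isomorphism of the associated posets. -/
def Iso (s t : RTree) : Prop := Nonempty (s.Vertex ≃o t.Vertex)

theorem le_root : ∀ (t : RTree) (v : t.Vertex), v ≤ t.root
  | node _ c => fun v =>
    letI : ∀ i, PartialOrder (c i).Vertex := fun i => vertexOrder (c i)
    (le_top : (show WithTop (Σ i, (c i).Vertex) from v) ≤ ⊤)

theorem map_root {s t : RTree} (f : s.Vertex ≃o t.Vertex) : f s.root = t.root := by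
  apply le_antisymm (le_root t _)
  exact (f.symm_apply_le).1 (le_root s _)

theorem finite_vertex : ∀ t : RTree, Finite t.Vertex
  | node _ c => by
    have : ∀ i, Finite (c i).Vertex := fun i => finite_vertex (c i)
    exact inferInstanceAs (Finite (Option (Σ i, (c i).Vertex)))

theorem card_vertex : ∀ t : RTree, Nat.card t.Vertex = t.size
  | node _ c => by
    have : ∀ i, Finite (c i).Vertex := fun i => finite_vertex (c i)
    have h : Nat.card (Option (Σ i, (c i).Vertex)) = 1 + ∑ i, (c i).size := by
      rw [Finite.card_option, Nat.card_sigma, add_comm]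
      simp only [card_vertex]
    exact h

theorem Iso.size_eq {s t : RTree} (h : s.Iso t) : s.size = t.size := by
  obtain ⟨f⟩ := h
  rw [← card_vertex, ← card_vertex]
  exact Nat.card_congr f.toEquiv

theorem finite_size_le (n : ℕ) : {t : RTree | t.size ≤ n}.Finite := by
  induction n with
  | zero =>
    apply Set.Finite.subset Set.finite_empty
    rintro ⟨d, c⟩ h
    simp [size] at h
  | succ n ih =>
    have hfin : (⋃ d ∈ Finset.range (n + 1),
        (fun c : Fin d → RTree => node d c) '' Set.pi Set.univ
          (fun _ => {t : RTree | t.size ≤ n})).Finite := by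
      apply Set.Finite.biUnion (Finset.finite_toSet _)
      intro d _
      exact (Set.Finite.pi (fun _ => ih)).image _
    refine hfin.subset ?_
    rintro ⟨d, c⟩ h
    have h' : ∑ i, (c i).size ≤ n := by
      have : 1 + ∑ i, (c i).size ≤ n + 1 := h
      omega
    have hpos : ∀ t : RTree, 1 ≤ t.size := by
      rintro ⟨d, c⟩
      simp [size]
    have hd : d ≤ n := by
      calc d = ∑ _i : Fin d, 1 := by simp
        _ ≤ ∑ i, (c i).size := Finset.sum_le_sum (fun i _ => hpos _)
        _ ≤ n := h'
    simp only [Set.mem_iUnion]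
    refine ⟨d, by simp; omega, c, ?_, rfl⟩
    intro i _
    exact (Finset.single_le_sum (f := fun i => (c i).size) (fun _ _ => Nat.zero_le _)
      (Finset.mem_univ i)).trans h'

/-- The subposets of `T` (given by their vertex sets) that are isomorphic to `S`. -/
def Copy (S T : RTree) : Type := {E : Set T.Vertex // Nonempty (S.Vertex ≃o E)}

/-- Two copies of `S` in the non-plane tree `T` are the same embedding if an automorphism of `T`
maps one onto the other. -/
def copySetoid (S T : RTree) : Setoid (Copy S T) where
  r E F := ∃ f : T.Vertex ≃o T.Vertex, f '' E.1 = F.1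
  iseqv :=
    { refl := fun E => ⟨OrderIso.refl _, by simp⟩
      symm := by
        rintro E F ⟨f, hf⟩
        refine ⟨f.symm, ?_⟩
        rw [← hf, ← Set.image_comp]
        simp
      trans := by
        rintro E F G ⟨f, hf⟩ ⟨g, hg⟩
        refine ⟨f.trans g, ?_⟩
        rw [← hg, ← hf, ← Set.image_comp]
        rfl }

/-- Embeddings of the non-plane tree `S` into the non-plane tree `T`. -/
def Embedding (S T : RTree) : Type := Quotient (copySetoid S T)

/-- An embedding is good if it contains the root of `T`. -/
def Embedding.IsGood {S T : RTree} (e : Embedding S T) : Prop :=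
  Quotient.liftOn e (fun E => T.root ∈ E.1) (by
    rintro E F ⟨f, hf⟩
    apply propext
    rw [← hf]
    constructor
    · intro h
      exact ⟨_, h, map_root f⟩
    · rintro ⟨x, hx, hfx⟩
      rw [← map_root f] at hfx
      rwa [← f.injective hfx])

/-- `a_T(S)`: the number of embeddings of `S` into `T`. -/
noncomputable def numEmb (S T : RTree) : ℕ := Nat.card (Embedding S T)

/-- `g_T(S)`: the number of good embeddings of `S` into `T`. -/
noncomputable def numGoodEmb (S T : RTree) : ℕ := Nat.card {e : Embedding S T // e.IsGood}

/-- Transport of copies along an isomorphism of the host trees. -/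
def copyCongr (S : RTree) {T T' : RTree} (f : T.Vertex ≃o T'.Vertex) : Copy S T ≃ Copy S T' where
  toFun E := ⟨f '' E.1, E.2.map fun φ => φ.trans
    { toEquiv := f.toEquiv.image E.1, map_rel_iff' := fun {a b} => f.le_iff_le (x := a.1) }⟩
  invFun E := ⟨f.symm '' E.1, E.2.map fun φ => φ.trans
    { toEquiv := f.symm.toEquiv.image E.1, map_rel_iff' := fun {a b} => f.symm.le_iff_le (x := a.1) }⟩
  left_inv E := by
    apply Subtype.ext
    simp [← Set.image_comp]
  right_inv E := by
    apply Subtype.ext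
    simp [← Set.image_comp]

/-- Transport of embeddings along an isomorphism of the host trees. -/
def embCongr (S : RTree) {T T' : RTree} (f : T.Vertex ≃o T'.Vertex) :
    Embedding S T ≃ Embedding S T' :=
  Quotient.congr (copyCongr S f) (by
    intro E F
    constructor
    · rintro ⟨g, hg⟩
      refine ⟨(f.symm.trans g).trans f, ?_⟩
      change _ '' (f '' E.1) = f '' F.1
      rw [← hg, ← Set.image_comp, ← Set.image_comp]
      apply Set.image_congr
      intro x _
      simp
    · rintro ⟨g, hg⟩
      refine ⟨(f.trans g).trans f.symm, ?_⟩
      change g '' (f '' E.1) = f '' F.1 at hg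
      have h2 : f.symm '' (g '' (f '' E.1)) = F.1 := by
        rw [hg, ← Set.image_comp]
        simp
      rw [← h2, ← Set.image_comp, ← Set.image_comp]
      rfl)

theorem embCongr_isGood (S : RTree) {T T' : RTree} (f : T.Vertex ≃o T'.Vertex)
    (e : Embedding S T) : e.IsGood ↔ (embCongr S f e).IsGood := by
  induction e using Quotient.inductionOn with
  | h E =>
    change T.root ∈ E.1 ↔ T'.root ∈ f '' E.1
    rw [← map_root f]
    exact (f.injective.mem_set_image).symm

theorem numEmb_congr (S : RTree) {T T' : RTree} (h : T.Iso T') : numEmb S T = numEmb S T' := by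
  obtain ⟨f⟩ := h
  exact Nat.card_congr (embCongr S f)

theorem numGoodEmb_congr (S : RTree) {T T' : RTree} (h : T.Iso T') :
    numGoodEmb S T = numGoodEmb S T' := by
  obtain ⟨f⟩ := h
  exact Nat.card_congr ((embCongr S f).subtypeEquiv (embCongr_isGood S f))

/-- Isomorphism on the binary trees with `n` vertices. -/
def binarySetoid (n : ℕ) : Setoid {T : RTree // T.IsBinary ∧ T.size = n} where
  r T T' := T.1.Iso T'.1
  iseqv :=
    { refl := fun _ => ⟨OrderIso.refl _⟩
      symm := fun ⟨f⟩ => ⟨f.symm⟩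
      trans := fun ⟨f⟩ ⟨g⟩ => ⟨f.trans g⟩ }

/-- `𝒱ₙ`: the non-plane binary trees with `n` vertices. -/
def NonPlaneBinary (n : ℕ) : Type := Quotient (binarySetoid n)

instance (n : ℕ) : Finite (NonPlaneBinary n) := by
  have : Finite {T : RTree // T.IsBinary ∧ T.size = n} :=
    ((finite_size_le n).subset (fun _ h => h.2.le) : {T : RTree | T.IsBinary ∧ T.size = n}.Finite)
  exact Quotient.finite _

noncomputable instance (n : ℕ) : Fintype (NonPlaneBinary n) := Fintype.ofFinite _

/-- `a_{𝒱ₙ}(S)`: the number of embeddings of `S` into all members of `𝒱ₙ`. -/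
noncomputable def totalEmb (n : ℕ) (S : RTree) : ℕ :=
  ∑ T : NonPlaneBinary n,
    Quotient.liftOn T (fun T => numEmb S T.1) (fun _ _ h => numEmb_congr S h)

/-- `g_{𝒱ₙ}(S)`: the number of good embeddings of `S` into all members of `𝒱ₙ`. -/
noncomputable def totalGoodEmb (n : ℕ) (S : RTree) : ℕ :=
  ∑ T : NonPlaneBinary n,
    Quotient.liftOn T (fun T => numGoodEmb S T.1) (fun _ _ h => numGoodEmb_congr S h)

/-- `|𝒱ₙ|`. -/
noncomputable def numBinary (n : ℕ) : ℕ := Fintype.card (NonPlaneBinary n)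

/-- The tree whose root has the given list of subtrees. -/
def ofList (F : List RTree) : RTree := node F.length F.get

end RTree

/-- Unary-binary trees (plane representatives) in which some of the binary vertices are
distinguished as auxiliary vertices (`aux = true`). -/
inductive UBTree : Type
  | leaf : UBTree
  | unary (t : UBTree) : UBTree
  | binary (aux : Bool) (l r : UBTree) : UBTree

namespace UBTree

/-- Isomorphism of non-plane unary-binary trees with auxiliary vertices. -/
inductive Iso : UBTree → UBTree → Prop
  | leaf : Iso leaf leaf
  | unary {s t : UBTree} : Iso s t → Iso (unary s) (unary t)
  | binary {x : Bool} {l r l' r' : UBTree} :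
      Iso l l' → Iso r r' → Iso (binary x l r) (binary x l' r')
  | swap {x : Bool} {l r l' r' : UBTree} :
      Iso l r' → Iso r l' → Iso (binary x l r) (binary x l' r')

theorem Iso.refl : ∀ t : UBTree, Iso t t
  | .leaf => .leaf
  | .unary t => .unary (Iso.refl t)
  | .binary _ l r => .binary (Iso.refl l) (Iso.refl r)

theorem Iso.symm {s t : UBTree} (h : Iso s t) : Iso t s := by
  induction h with
  | leaf => exact .leaf
  | unary _ ih => exact .unary ih
  | binary _ _ ih1 ih2 => exact .binary ih1 ih2
  | swap _ _ ih1 ih2 => exact .swap ih2 ih1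

theorem Iso.trans {s t u : UBTree} (h : Iso s t) (h' : Iso t u) : Iso s u := by
  induction h generalizing u with
  | leaf => exact h'
  | unary _ ih => cases h' with | unary h => exact .unary (ih h)
  | binary _ _ ih1 ih2 =>
    cases h' with
    | binary a b => exact .binary (ih1 a) (ih2 b)
    | swap a b => exact .swap (ih1 a) (ih2 b)
  | swap _ _ ih1 ih2 =>
    cases h' with
    | binary a b => exact .swap (ih1 b) (ih2 a)
    | swap a b => exact .binary (ih1 b) (ih2 a)

open Classical in
/-- The number of symmetry vertices, i.e. parents of two isomorphic subtrees. -/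
noncomputable def sym : UBTree → ℕ
  | leaf => 0
  | unary t => sym t
  | binary _ l r => sym l + sym r + if Iso l r then 1 else 0

theorem sym_congr {s t : UBTree} (h : Iso s t) : sym s = sym t := by
  induction h with
  | leaf => rfl
  | unary _ ih => exact ih
  | binary h1 h2 ih1 ih2 =>
    simp only [sym, ih1, ih2]
    congr 2
    exact propext ⟨fun h => (h1.symm.trans h).trans h2, fun h => (h1.trans h).trans h2.symm⟩
  | swap h1 h2 ih1 ih2 =>
    simp only [sym, ih1, ih2]
    rw [add_comm (sym _) (sym _)]
    congr 2
    exact propext ⟨fun h => (h2.symm.trans h.symm).trans h1,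
      fun h => (h1.trans h.symm).trans h2.symm⟩

/-- `Refines t F`: contracting every auxiliary vertex of `t` that lies below a non-auxiliary vertex
into its nearest non-auxiliary ancestor, and deleting the auxiliary vertices with no such ancestor,
leaves the list of rooted trees `F`. The only child of a unary vertex is never auxiliary, because
below an auxiliary vertex there are at least two trees. -/
inductive Refines : UBTree → List RTree → Prop
  | leaf : Refines leaf [RTree.ofList []]
  | unary {t : UBTree} {S : RTree} : Refines t [S] → Refines (unary t) [RTree.ofList [S]]
  | binary {l r : UBTree} {F G : List RTree} :
      Refines l F → Refines r G → Refines (binary false l r) [RTree.ofList (F ++ G)]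
  | aux {l r : UBTree} {F G : List RTree} :
      Refines l F → Refines r G → Refines (binary true l r) (F ++ G)

/-- `t` arises from the non-plane tree `S` by replacing every vertex of out-degree `d ≥ 3` by a
binary tree with `d` leaves, at which the `d` subtrees are attached; the root of this binary tree
is the original vertex and its `d - 2` other internal vertices are auxiliary. -/
def IsReplacement (S : RTree) (t : UBTree) : Prop := ∃ S', S'.Iso S ∧ Refines t [S']

/-- Isomorphism on the trees that arise from `S` by replacement. -/
def replacementSetoid (S : RTree) : Setoid {t : UBTree // IsReplacement S t} where
  r t t' := Iso t.1 t'.1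
  iseqv := ⟨fun _ => Iso.refl _, fun h => h.symm, fun h h' => h.trans h'⟩

/-- `ℳ_S`: the non-plane unary-binary trees that arise from `S` by replacement. -/
def Replacements (S : RTree) : Type := Quotient (replacementSetoid S)

/-- The number of vertices. -/
def size : UBTree → ℕ
  | leaf => 1
  | unary t => 1 + size t
  | binary _ l r => 1 + size l + size r

theorem Refines.size_le {t : UBTree} {F : List RTree} (h : Refines t F) :
    t.size + 1 ≤ 2 * (F.map RTree.size).sum := by
  have key : ∀ F : List RTree, (RTree.ofList F).size = 1 + (F.map RTree.size).sum := by
    intro F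
    simp only [RTree.ofList, RTree.size, List.get_eq_getElem]
    congr 1
    rw [← Fin.sum_univ_fun_getElem]
  induction h with
  | leaf => simp [size, key]
  | unary _ ih => simp [size, key] at *; omega
  | binary _ _ ih1 ih2 => simp [size, key] at *; omega
  | aux _ _ ih1 ih2 => simp [size] at *; omega

theorem finite_size_le (n : ℕ) : {t : UBTree | t.size ≤ n}.Finite := by
  induction n with
  | zero =>
    apply Set.Finite.subset Set.finite_empty
    rintro (_ | _ | _) h <;> simp [size] at h
  | succ n ih =>
    have hfin : ({leaf} ∪ unary '' {t | t.size ≤ n} ∪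
        (fun p : Bool × UBTree × UBTree => binary p.1 p.2.1 p.2.2) ''
          (Set.univ ×ˢ ({t | t.size ≤ n} ×ˢ {t | t.size ≤ n}))).Finite :=
      ((Set.finite_singleton _).union (ih.image _)).union
        ((Set.finite_univ.prod (ih.prod ih)).image _)
    refine hfin.subset ?_
    rintro (_ | t | ⟨x, l, r⟩) h
    · simp
    · refine Or.inl (Or.inr ⟨t, ?_, rfl⟩)
      simp [size] at h ⊢
      omega
    · refine Or.inr ⟨(x, l, r), ?_, rfl⟩
      simp [size] at h ⊢
      omega

instance (S : RTree) : Finite (Replacements S) := by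
  have : Finite {t : UBTree // IsReplacement S t} := by
    have : {t : UBTree | IsReplacement S t}.Finite := by
      refine (finite_size_le (2 * S.size)).subset ?_
      rintro t ⟨S', hS, ht⟩
      have h1 := ht.size_le
      have h2 := hS.size_eq
      simp at h1 ⊢
      omega
    exact this
  exact Quotient.finite _

noncomputable instance (S : RTree) : Fintype (Replacements S) := Fintype.ofFinite _

end UBTree

/-- `C_S`: the sum of `(1/2)^s` over the trees in `ℳ_S`, where `s` is the number of symmetry
vertices. -/
noncomputable def RTree.symmetryConstant (S : RTree) : ℝ :=
  ∑ t : UBTree.Replacements S,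
    Quotient.liftOn t (fun t => (1 / 2 : ℝ) ^ t.1.sym)
      (fun _ _ h => congrArg (fun k => (1 / 2 : ℝ) ^ k) (UBTree.sym_congr h))

namespace RTree

/-- `V(z) = ∑ₙ |𝒱ₙ| zⁿ` as a formal power series over `ℝ`. -/
noncomputable def binarySeries : FormalMultilinearSeries ℝ ℝ ℝ :=
  FormalMultilinearSeries.ofScalars ℝ (fun n => (numBinary n : ℝ))

end RTree

/-!
A pair of a binary tree `T` and an embedding of `S` is a binary tree with marked vertices, taken up
to isomorphism. Let `V`, `A_S`, `G_S` count the binary trees, their embeddings and their good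
embeddings of `S` by the number of leaves, and let `A_F` do so for the embeddings of a forest `F`.
Splitting a tree at its root gives `2 V(x) = 2 x + V(x)² + V(x²)` and, for `S` with root subtrees
`F`, expresses `A_F` through the products `A_G A_H` over the splittings `F = G + H` and a term in
`x²`. With `R = 1 - V` this reads `2 R A_F = ∑ A_G A_H + …`, summed over proper splittings, and
`R A_S = G_S`.

Hence `R² = 1 - 2 x - V(x²)`. The right-hand side converges beyond the smallest zero `α = ρ²` of
`R²`, so `R = √(1 - x / α) · U` with `U` invertible in the ring of series converging beyond `α`.
By induction on `F`, `A_F` is a polynomial in `R` and `R⁻¹` over that ring, with leading term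
`C_F R^(-(m + l - 1))`, and the constants `C_F` satisfy the recursion of the trees `ℳ_S`: a
replacement binary tree records the successive splittings of a forest, and a splitting into two
equal halves contributes the factor `1 / 2` of a symmetry vertex. Transfer from the expansion in
half-integer powers of `1 - x / α` to the coefficients gives the asymptotics.
-/
/-! ### Disjoint unions of posets and finite families -/

theorem sum_singleton_eq_iff {ι κ α : Type*} [Fintype ι] [Fintype κ] {f : ι → α} {g : κ → α} :
    ∑ i, ({f i} : Multiset α) = ∑ j, {g j} ↔ ∃ σ : ι ≃ κ, ∀ i, f i = g (σ i) := by
  classical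
  refine ⟨fun h => ?_, fun ⟨σ, hσ⟩ => Fintype.sum_equiv σ _ _ fun i => by rw [hσ]⟩
  have fiberEquiv (a : α) : Nonempty ({i // f i = a} ≃ {j // g j = a}) := by
    have hcount := congrArg (Multiset.count a) h
    simp only [Multiset.count_sum', Multiset.count_singleton, Finset.sum_boole] at hcount
    refine ⟨Fintype.equivOfCardEq ?_⟩
    rw [Fintype.card_subtype, Fintype.card_subtype]
    simpa [eq_comm] using hcount
  exact ⟨Equiv.ofFiberEquiv fun a => (fiberEquiv a).some,
    fun i => (Equiv.ofFiberEquiv_map (fun a => (fiberEquiv a).some) i).symm⟩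

theorem sum_singleton_get {α : Type*} (l : List α) :
    ∑ i, ({l.get i} : Multiset α) = (l : Multiset α) := by
  rw [← List.sum_ofFn]
  induction l with
  | nil => rfl
  | cons a l ih =>
    rw [List.ofFn_succ, List.sum_cons]
    change {a} + (List.ofFn fun i => ({l.get i} : Multiset α)).sum = _
    rw [ih, Multiset.singleton_add, Multiset.cons_coe]

section SigmaOrder

variable {ι κ : Type*} {P : ι → Type*} {Q : κ → Type*}

section Components

variable [∀ i, PartialOrder (P i)] [∀ i, OrderTop (P i)] [∀ j, PartialOrder (Q j)]
  (f : (Σ i, P i) ≃o Σ j, Q j)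

theorem fst_apply_mk (i : ι) (x : P i) : (f ⟨i, x⟩).1 = (f ⟨i, ⊤⟩).1 :=
  (Sigma.le_def.1 (f.monotone (Sigma.mk_le_mk_iff.2 le_top))).1

variable [∀ j, OrderTop (Q j)]

/-- The bijection between the index types induced by an isomorphism between disjoint unions of
posets with maxima: the components are permuted, because elements of different components are
incomparable. -/
def componentEquiv : ι ≃ κ where
  toFun i := (f ⟨i, ⊤⟩).1
  invFun j := (f.symm ⟨j, ⊤⟩).1
  left_inv i := by
    change (f.symm ⟨(f ⟨i, ⊤⟩).1, ⊤⟩).1 = i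
    rw [← fst_apply_mk f.symm _ (f ⟨i, ⊤⟩).2]
    simp only [Sigma.eta, OrderIso.symm_apply_apply]
  right_inv j := by
    change (f ⟨(f.symm ⟨j, ⊤⟩).1, ⊤⟩).1 = j
    rw [← fst_apply_mk f _ (f.symm ⟨j, ⊤⟩).2]
    simp only [Sigma.eta, OrderIso.apply_symm_apply]

theorem exists_apply_mk_eq (i : ι) (x : P i) : ∃ y, f ⟨i, x⟩ = ⟨componentEquiv f i, y⟩ := by
  have h : (f ⟨i, x⟩).1 = componentEquiv f i := fst_apply_mk f i x
  rw [← h]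
  exact ⟨_, rfl⟩

theorem exists_componentIso :
    ∃ g : ∀ i, P i ≃o Q (componentEquiv f i), ∀ i x, f ⟨i, x⟩ = ⟨componentEquiv f i, g i x⟩ := by
  choose g hg using exists_apply_mk_eq f
  have hle (i : ι) (x x' : P i) : g i x ≤ g i x' ↔ x ≤ x' := by
    rw [← Sigma.mk_le_mk_iff (i := componentEquiv f i) (α := Q), ← hg, ← hg, f.le_iff_le,
      Sigma.mk_le_mk_iff]
  have hsurj (i : ι) : Function.Surjective (g i) := by
    intro y
    obtain ⟨⟨i', x⟩, hx⟩ := f.surjective ⟨componentEquiv f i, y⟩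
    rw [hg] at hx
    have hfst : componentEquiv f i' = componentEquiv f i := (Sigma.mk.inj_iff.1 hx).1
    obtain rfl := (componentEquiv f).injective hfst
    exact ⟨x, eq_of_heq (Sigma.mk.inj hx).2⟩
  exact ⟨fun i => RelIso.ofSurjective (OrderEmbedding.ofMapLEIff (g i) (hle i)) (hsurj i), hg⟩

end Components

/-- The isomorphism between disjoint unions of posets given by isomorphisms of the components. -/
def sigmaOrderIso [∀ i, Preorder (P i)] [∀ j, Preorder (Q j)] (σ : ι ≃ κ)
    (g : ∀ i, P i ≃o Q (σ i)) : (Σ i, P i) ≃o Σ j, Q j where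
  toEquiv := Equiv.sigmaCongr σ fun i => (g i).toEquiv
  map_rel_iff' := by
    rintro ⟨i, x⟩ ⟨i', x'⟩
    rw [Sigma.le_def, Sigma.le_def]
    constructor
    · rintro ⟨h, h'⟩
      obtain rfl : i = i' := σ.injective h
      exact ⟨rfl, (g i).le_iff_le.1 h'⟩
    · rintro ⟨h, h'⟩
      obtain rfl : i = i' := h
      exact ⟨rfl, (g i).le_iff_le.2 h'⟩

/-- Associativity of disjoint unions of posets. -/
def sigmaAssocIso {κ : ι → Type*} {R : ∀ i, κ i → Type*} [∀ i j, Preorder (R i j)] :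
    (Σ i, Σ j, R i j) ≃o Σ x : Σ i, κ i, R x.1 x.2 where
  toEquiv := (Equiv.sigmaAssoc R).symm
  map_rel_iff' := by
    rintro ⟨i, j, x⟩ ⟨i', j', x'⟩
    change (⟨⟨i, j⟩, x⟩ : Σ x : Σ i, κ i, R x.1 x.2) ≤ ⟨⟨i', j'⟩, x'⟩ ↔ _
    constructor
    · intro h
      obtain ⟨hij, hx⟩ := Sigma.le_def.1 h
      cases hij
      exact Sigma.mk_le_mk_iff.2 (Sigma.mk_le_mk_iff.2 hx)
    · intro h
      obtain ⟨hi, hjx⟩ := Sigma.le_def.1 h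
      cases hi
      obtain ⟨hj, hx⟩ := Sigma.le_def.1 hjx
      cases hj
      exact Sigma.mk_le_mk_iff.2 hx

/-- A disjoint union with a single component is isomorphic to that component. -/
def uniqueSigmaIso [Unique ι] [∀ i, Preorder (P i)] : (Σ i, P i) ≃o P default where
  toEquiv := Equiv.uniqueSigma P
  map_rel_iff' := by
    rintro ⟨i, x⟩ ⟨i', x'⟩
    obtain rfl := Unique.eq_default i
    obtain rfl := Unique.eq_default i'
    exact Sigma.mk_le_mk_iff.symm

end SigmaOrder

theorem exists_iso_of_withTop_iso {P Q : Type*} [PartialOrder P] [PartialOrder Q]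
    (f : WithTop P ≃o WithTop Q) : ∃ g : P ≃o Q, ∀ x : P, f x = (g x : WithTop Q) := by
  have exists_coe (x : P) : ∃ y : Q, f x = y := by
    have hx : f x ≠ ⊤ := fun h => WithTop.coe_ne_top (f.injective (h.trans f.map_top.symm))
    exact ⟨_, (WithTop.coe_untop _ hx).symm⟩
  choose g hg using exists_coe
  have hle (x x' : P) : g x ≤ g x' ↔ x ≤ x' := by
    rw [← WithTop.coe_le_coe, ← hg, ← hg, f.le_iff_le, WithTop.coe_le_coe]
  have hsurj : Function.Surjective g := by
    intro y
    obtain ⟨x, hx⟩ := f.surjective y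
    have hx' : x ≠ ⊤ := by
      rintro rfl
      exact WithTop.top_ne_coe (f.map_top.symm.trans hx)
    lift x to P using hx'
    exact ⟨x, WithTop.coe_injective ((hg x).symm.trans hx)⟩
  exact ⟨RelIso.ofSurjective (OrderEmbedding.ofMapLEIff g hle) hsurj, hg⟩

section Subposets

variable {ι P : Type*} {R : ι → Type*}

/-- A subset of a disjoint union of posets is the disjoint union of its traces. -/
def sigmaSubtypeIso [∀ i, Preorder (R i)] (E : Set (Σ i, R i)) :
    (Σ i, (Sigma.mk i ⁻¹' E : Set (R i))) ≃o E where
  toFun x := ⟨⟨x.1, x.2.1⟩, x.2.2⟩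
  invFun x := ⟨x.1.1, x.1.2, x.2⟩
  map_rel_iff' := by
    rintro ⟨i, x, hx⟩ ⟨j, y, hy⟩
    constructor
    · intro h
      obtain ⟨hij, hxy⟩ := Sigma.le_def.1 (Subtype.mk_le_mk.1 h)
      cases hij
      exact Sigma.mk_le_mk_iff.2 hxy
    · intro h
      obtain ⟨hij, hxy⟩ := Sigma.le_def.1 h
      cases hij
      exact Subtype.mk_le_mk.2 (Sigma.mk_le_mk_iff.2 hxy)

variable [PartialOrder P] {E : Set (WithTop P)}

/-- A subset of `WithTop P` that avoids `⊤` is its trace on `P`. -/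
noncomputable def preimageCoeIso (hE : ⊤ ∉ E) : ((↑) ⁻¹' E : Set P) ≃o E :=
  RelIso.ofSurjective
    (OrderEmbedding.ofMapLEIff (fun x => ⟨x.1, x.2⟩) fun _ _ => WithTop.coe_le_coe) <| by
    rintro ⟨x, hx⟩
    lift x to P using fun h => hE (h ▸ hx)
    exact ⟨⟨x, hx⟩, rfl⟩

/-- A subset of `WithTop P` that contains `⊤` is its trace on `P` with a maximum added. -/
noncomputable def withTopPreimageCoeIso (hE : ⊤ ∈ E) : WithTop ((↑) ⁻¹' E : Set P) ≃o E :=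
  RelIso.ofSurjective
    (OrderEmbedding.ofMapLEIff
      (fun x : WithTop ((↑) ⁻¹' E : Set P) => x.recTopCoe ⟨⊤, hE⟩ fun y => ⟨y.1, y.2⟩) <| by
      intro x y
      induction x <;> induction y
      all_goals simp [← Subtype.coe_le_coe]) <| by
    rintro ⟨x, hx⟩
    induction x with
    | top => exact ⟨⊤, rfl⟩
    | coe x => exact ⟨(⟨x, hx⟩ : ((↑) ⁻¹' E : Set P)), rfl⟩

end Subposets

/-! ### Sums over unordered pairs of given degree -/

open Finset.HasAntidiagonal (antidiagonal mem_antidiagonal)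

noncomputable instance {α : Type*} : Finset.HasAntidiagonal (Multiset α) where
  antidiagonal F := open Classical in (Multiset.antidiagonal F).toFinset
  mem_antidiagonal := by simp

instance {A B : Type*} [AddMonoid A] [AddMonoid B] [Finset.HasAntidiagonal A]
    [Finset.HasAntidiagonal B] : Finset.HasAntidiagonal (A × B) where
  antidiagonal x := (antidiagonal x.1 ×ˢ antidiagonal x.2).map
    (Equiv.prodProdProdComm A A B B).toEmbedding
  mem_antidiagonal := by
    rintro ⟨a, b⟩ ⟨⟨a₁, b₁⟩, a₂, b₂⟩
    simp [Prod.ext_iff]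

section SymmetricPairs

variable {X Γ R : Type*} [AddCommMonoid Γ] [Finset.HasAntidiagonal Γ] {deg : X → Γ}
  (hfin : ∀ γ, {x | deg x = γ}.Finite) (γ : Γ)

include hfin

theorem finite_pairs_deg_eq : {x : X × X | deg x.1 + deg x.2 = γ}.Finite := by
  have hunion : (⋃ d ∈ antidiagonal γ,
      {x : X | deg x = d.1} ×ˢ {x : X | deg x = d.2}).Finite :=
    Set.Finite.biUnion (Finset.finite_toSet _) fun d _ => (hfin _).prod (hfin _)
  refine hunion.subset fun x hx => ?_
  simp only [Set.mem_iUnion]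
  exact ⟨(deg x.1, deg x.2), mem_antidiagonal.2 hx, rfl, rfl⟩

theorem finite_sym2_deg_eq : {p : Sym2 X | (p.map deg).add = γ}.Finite := by
  refine ((finite_pairs_deg_eq hfin γ).image fun x => s(x.1, x.2)).subset fun p hp => ?_
  induction p with | _ a b
  exact ⟨(a, b), hp, rfl⟩

theorem sum_pairs_deg_eq [CommSemiring R] (w : X → R) :
    ∑ x ∈ (finite_pairs_deg_eq hfin γ).toFinset, w x.1 * w x.2 =
      ∑ d ∈ antidiagonal γ,
        (∑ a ∈ (hfin d.1).toFinset, w a) * ∑ b ∈ (hfin d.2).toFinset, w b := by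
  classical
  rw [← Finset.sum_fiberwise_of_maps_to (g := fun x : X × X => (deg x.1, deg x.2))
    (t := antidiagonal γ) fun x hx =>
      mem_antidiagonal.2 ((finite_pairs_deg_eq hfin γ).mem_toFinset.1 hx)]
  refine Finset.sum_congr rfl fun d hd => ?_
  rw [Finset.sum_mul_sum, ← Finset.sum_product']
  refine Finset.sum_congr ?_ fun _ _ => rfl
  ext x
  simp only [Finset.mem_product, Set.Finite.mem_toFinset, Set.mem_ofPred_eq, Finset.mem_filter,
    Prod.ext_iff, and_iff_right_iff_imp]
  rintro ⟨h, h'⟩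
  rw [h, h']
  exact mem_antidiagonal.1 hd

theorem filter_pairs_eq_mk [DecidableEq X] {a b : X} (hab : deg a + deg b = γ) :
    {x ∈ (finite_pairs_deg_eq hfin γ).toFinset | s(x.1, x.2) = s(a, b)} = {(a, b), (b, a)} := by
  ext ⟨x, y⟩
  simp only [Finset.mem_filter, Set.Finite.mem_toFinset, Set.mem_ofPred_eq, Sym2.eq_iff,
    Finset.mem_insert, Finset.mem_singleton, Prod.mk.injEq, and_iff_right_iff_imp]
  rintro (⟨rfl, rfl⟩ | ⟨rfl, rfl⟩)
  · exact hab
  · rwa [add_comm]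

open Classical in
theorem sum_sym2_deg_eq [CommSemiring R] (w : X → R) :
    ∑ p ∈ (finite_sym2_deg_eq hfin γ).toFinset, (p.map w).mul * (if p.IsDiag then 1 else 2) =
      ∑ d ∈ antidiagonal γ,
        (∑ a ∈ (hfin d.1).toFinset, w a) * ∑ b ∈ (hfin d.2).toFinset, w b := by
  rw [← sum_pairs_deg_eq, ← Finset.sum_fiberwise_of_maps_to (g := fun x : X × X => s(x.1, x.2))
    (t := (finite_sym2_deg_eq hfin γ).toFinset) fun x hx =>
      (finite_sym2_deg_eq hfin γ).mem_toFinset.2 ((finite_pairs_deg_eq hfin γ).mem_toFinset.1 hx)]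
  refine Finset.sum_congr rfl fun p hp => ?_
  induction p with | _ a b
  rw [filter_pairs_eq_mk hfin γ ((finite_sym2_deg_eq hfin γ).mem_toFinset.1 hp)]
  simp only [Sym2.map_mk, Sym2.mul_mk, Sym2.mk_isDiag_iff]
  split_ifs with h
  · subst h
    simp
  · rw [Finset.sum_pair (by simp [h])]
    ring

omit [Finset.HasAntidiagonal Γ] hfin in
open Classical in
theorem ncard_double_deg_eq (hpairs : {p : Sym2 X | (p.map deg).add = γ}.Finite) :
    {x : X | deg x + deg x = γ}.ncard = (hpairs.toFinset.filter Sym2.IsDiag).card := by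
  rw [← Set.ncard_image_of_injective _ (Sym2.diag_injective (α := X)), ← Set.ncard_coe_finset]
  congr 1
  ext p
  induction p with | _ a b
  simp only [Set.mem_image, Set.mem_ofPred_eq, Finset.coe_filter, Set.Finite.mem_toFinset,
    Sym2.mk_isDiag_iff]
  constructor
  · rintro ⟨x, hx, hx'⟩
    obtain ⟨rfl, rfl⟩ | ⟨rfl, rfl⟩ := Sym2.eq_iff.1 hx' <;> exact ⟨hx, rfl⟩
  · rintro ⟨h, rfl⟩
    exact ⟨a, h, rfl⟩

theorem two_mul_ncard_sym2_deg_eq :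
    2 * {p : Sym2 X | (p.map deg).add = γ}.ncard =
      ∑ d ∈ antidiagonal γ, {x | deg x = d.1}.ncard * {x | deg x = d.2}.ncard +
        {x : X | deg x + deg x = γ}.ncard := by
  classical
  have weighted := sum_sym2_deg_eq hfin γ fun _ => 1
  have mul_map_one (p : Sym2 X) : (p.map fun _ => 1).mul = 1 := by
    induction p with | _ a b
    rfl
  simp only [mul_map_one, one_mul, Finset.sum_const, smul_eq_mul, mul_one] at weighted
  rw [ncard_double_deg_eq γ (finite_sym2_deg_eq hfin γ),
    Set.ncard_eq_toFinset_card _ (finite_sym2_deg_eq hfin γ)]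
  simp_rw [fun γ => Set.ncard_eq_toFinset_card _ (hfin γ)]
  rw [← weighted, Finset.card_filter, ← Finset.sum_add_distrib, mul_comm, ← smul_eq_mul,
    ← Finset.sum_const]
  exact Finset.sum_congr rfl fun p _ => by split_ifs <;> rfl

end SymmetricPairs

/-! ### Absolutely convergent power series -/

section AbsConv

open PowerSeries
open Finset.HasAntidiagonal (antidiagonal mem_antidiagonal)

theorem sum_range_antidiagonal_le {a b : ℕ → ℝ} (ha : ∀ n, 0 ≤ a n) (hb : ∀ n, 0 ≤ b n) {M N : ℕ}
    (hsupp : ∀ i j, i + j < M → a i ≠ 0 → b j ≠ 0 → i < N ∧ j < N) :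
    ∑ n ∈ Finset.range M, ∑ p ∈ antidiagonal n, a p.1 * b p.2 ≤
      (∑ n ∈ Finset.range N, a n) * ∑ n ∈ Finset.range N, b n := by
  set Q := (Finset.range N ×ˢ Finset.range N).filter fun p => p.1 + p.2 < M
  have hsum : ∑ n ∈ Finset.range M, ∑ p ∈ antidiagonal n, a p.1 * b p.2 =
      ∑ p ∈ Q, a p.1 * b p.2 := by
    rw [← Finset.sum_fiberwise_of_maps_to (g := fun p : ℕ × ℕ => p.1 + p.2)
      (t := Finset.range M) fun p hp => Finset.mem_range.2 (Finset.mem_filter.1 hp).2]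
    refine Finset.sum_congr rfl fun n hn => (Finset.sum_subset (fun p hp => ?_) ?_).symm
    · exact mem_antidiagonal.2 (Finset.mem_filter.1 hp).2
    · intro p hp hpQ
      by_contra hne
      rw [mem_antidiagonal] at hp
      rw [Finset.mem_range] at hn
      obtain ⟨hN, hN'⟩ := hsupp p.1 p.2 (hp.trans_lt hn) (left_ne_zero_of_mul hne)
        (right_ne_zero_of_mul hne)
      exact hpQ (by simp [hN, hN', hp, hn])
  rw [hsum, Finset.sum_mul_sum, ← Finset.sum_product']
  exact Finset.sum_le_sum_of_subset_of_nonneg (Finset.filter_subset _ _) fun p _ _ =>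
    mul_nonneg (ha _) (hb _)

variable {𝕜 : Type*} [NormedField 𝕜]

/-- Absolute convergence of a power series at radius `r`. -/
def AbsConv (r : ℝ) (f : 𝕜⟦X⟧) : Prop := Summable fun n => ‖coeff n f‖ * r ^ n

/-- The value of a power series at a point, meaningful where the series converges. -/
noncomputable def evalAt (x : 𝕜) (f : 𝕜⟦X⟧) : 𝕜 := ∑' n, coeff n f * x ^ n

theorem norm_coeff_mul_mul_pow_le {r : ℝ} (hr : 0 ≤ r) (f g : 𝕜⟦X⟧) (n : ℕ) :
    ‖coeff n (f * g)‖ * r ^ n ≤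
      ∑ p ∈ antidiagonal n, (‖coeff p.1 f‖ * r ^ p.1) * (‖coeff p.2 g‖ * r ^ p.2) := by
  calc
    _ ≤ (∑ p ∈ antidiagonal n, ‖coeff p.1 f * coeff p.2 g‖) * r ^ n := by
      rw [coeff_mul]
      exact mul_le_mul_of_nonneg_right (norm_sum_le _ _) (by positivity)
    _ = _ := by
      rw [Finset.sum_mul]
      refine Finset.sum_congr rfl fun p hp => ?_
      rw [norm_mul, ← mem_antidiagonal.1 hp, pow_add]
      ring

namespace AbsConv

variable {r r' : ℝ} {f g : 𝕜⟦X⟧}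

theorem mono (h : AbsConv r f) (hr' : 0 ≤ r') (hr : r' ≤ r) : AbsConv r' f :=
  Summable.of_nonneg_of_le (fun _ => by positivity)
    (fun n => mul_le_mul_of_nonneg_left (pow_le_pow_left₀ hr' hr n) (norm_nonneg _)) h

theorem of_coeff_eq_zero {N : ℕ} (h : ∀ n, N ≤ n → coeff n f = 0) : AbsConv r f :=
  summable_of_ne_finset_zero (s := Finset.range N) fun n hn => by
    rw [h n (by simpa using hn), norm_zero, zero_mul]

theorem const (c : 𝕜) : AbsConv r (C c) :=
  of_coeff_eq_zero (N := 1) fun n hn => by rw [coeff_C, if_neg (by omega)]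

theorem one : AbsConv r (1 : 𝕜⟦X⟧) := by
  simpa using const (r := r) (1 : 𝕜)

theorem var : AbsConv r (X : 𝕜⟦X⟧) :=
  of_coeff_eq_zero (N := 2) fun n hn => by rw [coeff_X, if_neg (by omega)]

theorem neg (hf : AbsConv r f) : AbsConv r (-f) := by
  simpa [AbsConv] using hf

theorem add (hr : 0 ≤ r) (hf : AbsConv r f) (hg : AbsConv r g) : AbsConv r (f + g) :=
  Summable.of_nonneg_of_le (fun _ => by positivity)
    (fun n => by
      rw [map_add, ← add_mul]
      exact mul_le_mul_of_nonneg_right (norm_add_le _ _) (by positivity)) (Summable.add hf hg)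

theorem sub (hr : 0 ≤ r) (hf : AbsConv r f) (hg : AbsConv r g) : AbsConv r (f - g) := by
  rw [sub_eq_add_neg]
  exact hf.add hr hg.neg

theorem mul (hr : 0 ≤ r) (hf : AbsConv r f) (hg : AbsConv r g) : AbsConv r (f * g) := by
  have hf' : Summable fun n => ‖‖coeff n f‖ * r ^ n‖ := Summable.norm hf
  have hg' : Summable fun n => ‖‖coeff n g‖ * r ^ n‖ := Summable.norm hg
  refine Summable.of_nonneg_of_le (fun _ => by positivity) (fun n => ?_)
    (summable_norm_sum_mul_antidiagonal_of_summable_norm hf' hg')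
  exact (norm_coeff_mul_mul_pow_le hr f g n).trans (le_abs_self _)

theorem one_sub_C_mul_X (hr : 0 ≤ r) (a : 𝕜) : AbsConv r (1 - C a * X) :=
  one.sub hr ((const a).mul hr var)

theorem pow (hr : 0 ≤ r) (hf : AbsConv r f) (k : ℕ) : AbsConv r (f ^ k) := by
  induction k with
  | zero => rw [pow_zero]; exact .one
  | succ k ih => rw [pow_succ]; exact ih.mul hr hf

theorem derivative (hr' : 0 ≤ r') (hr : r' < r) (hf : AbsConv r f) :
    AbsConv r' (PowerSeries.derivative 𝕜 f) := by
  have hr₀ : 0 < r := hr'.trans_lt hr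
  obtain ⟨M, hM⟩ := (tendsto_pow_const_mul_const_pow_of_abs_lt_one 1
    (show |r' / r| < 1 by rwa [abs_of_nonneg (by positivity), div_lt_one hr₀])).bddAbove_range
  have hbound (n : ℕ) : ((n : ℝ) + 1) * r' ^ n ≤ (M + 1) / r * r ^ (n + 1) := by
    have hn : n * r' ^ n ≤ M * r ^ n := by
      have : (n : ℝ) ^ 1 * (r' / r) ^ n ≤ M := hM ⟨n, rfl⟩
      rwa [pow_one, div_pow, ← mul_div_assoc, div_le_iff₀ (by positivity)] at this
    calc ((n : ℝ) + 1) * r' ^ n = n * r' ^ n + r' ^ n := by ring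
      _ ≤ M * r ^ n + r ^ n := add_le_add hn (pow_le_pow_left₀ hr' hr.le n)
      _ = (M + 1) / r * r ^ (n + 1) := by field_simp; ring
  refine Summable.of_nonneg_of_le (fun n => by positivity) (fun n => ?_)
    (((summable_nat_add_iff 1).2 hf).mul_left ((M + 1) / r))
  have hcast : ‖(n : 𝕜) + 1‖ ≤ (n : ℝ) + 1 := by
    simpa using Nat.norm_cast_le (α := 𝕜) (n + 1)
  calc ‖coeff n (PowerSeries.derivative 𝕜 f)‖ * r' ^ n
      ≤ ‖coeff (n + 1) f‖ * ((n : ℝ) + 1) * r' ^ n := by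
        rw [coeff_derivative, norm_mul]
        gcongr
    _ ≤ ‖coeff (n + 1) f‖ * ((M + 1) / r * r ^ (n + 1)) := by
        rw [mul_assoc]
        exact mul_le_mul_of_nonneg_left (hbound n) (norm_nonneg _)
    _ = (M + 1) / r * (‖coeff (n + 1) f‖ * r ^ (n + 1)) := by ring

theorem expand {p : ℕ} (hp : p ≠ 0) (hf : AbsConv (r ^ p) f) :
    AbsConv r (PowerSeries.expand p hp f) := by
  refine ((mul_right_injective₀ hp).summable_iff fun n hn => ?_).1 ?_
  · have hdvd : ¬ p ∣ n := fun ⟨k, hk⟩ => hn ⟨k, hk.symm⟩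
    rw [coeff_expand_of_not_dvd _ _ _ hdvd, norm_zero, zero_mul]
  · refine hf.congr fun n => ?_
    rw [Function.comp_apply, coeff_expand_mul, pow_mul]

theorem summable (hf : AbsConv r f) {x : 𝕜} (hx : ‖x‖ ≤ r) :
    Summable fun n => ‖coeff n f * x ^ n‖ :=
  (hf.mono (norm_nonneg x) hx).congr fun n => by rw [norm_mul, norm_pow]

theorem hasSum [CompleteSpace 𝕜] (hf : AbsConv r f) {x : 𝕜} (hx : ‖x‖ ≤ r) :
    HasSum (fun n => coeff n f * x ^ n) (evalAt x f) :=
  (hf.summable hx).of_norm.hasSum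

/-- The recursion `g = 1 + f g` for `g = (1 - f)⁻¹` bounds the partial sums `T` of the majorant of
`g` by `T ≤ 1 + q T`, where `q < 1` is the majorant of `f`. -/
theorem inv_one_sub (hr : 0 ≤ r) (hf₀ : constantCoeff f = 0)
    (hf : AbsConv r f) (hlt : ∑' n, ‖coeff n f‖ * r ^ n < 1) : AbsConv r (1 - f)⁻¹ := by
  set g := (1 - f)⁻¹
  set q := ∑' n, ‖coeff n f‖ * r ^ n
  have hg : g = 1 + f * g := by
    have hmul : (1 - f) * g = 1 := PowerSeries.mul_inv_cancel _ (by simp [hf₀])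
    linear_combination hmul
  have hcoeff (n : ℕ) : ‖coeff n g‖ * r ^ n ≤ (if n = 0 then 1 else 0) +
      ∑ p ∈ antidiagonal n, (‖coeff p.1 f‖ * r ^ p.1) * (‖coeff p.2 g‖ * r ^ p.2) := by
    conv_lhs => rw [hg, map_add, coeff_one]
    refine (mul_le_mul_of_nonneg_right (norm_add_le _ _) (by positivity)).trans ?_
    rw [add_mul]
    refine add_le_add ?_ (norm_coeff_mul_mul_pow_le hr f g n)
    split_ifs with h <;> simp [h]
  refine summable_of_sum_range_le (c := 1 / (1 - q)) (fun n => by positivity) fun N => ?_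
  rw [le_div_iff₀ (by linarith)]
  set T := ∑ n ∈ Finset.range N, ‖coeff n g‖ * r ^ n
  have hT : T ≤ 1 + q * T := by
    refine (Finset.sum_le_sum fun n _ => hcoeff n).trans ?_
    rw [Finset.sum_add_distrib, Finset.sum_ite_eq']
    refine add_le_add (by split_ifs <;> norm_num) ?_
    refine (sum_range_antidiagonal_le (a := fun n => ‖coeff n f‖ * r ^ n)
      (b := fun n => ‖coeff n g‖ * r ^ n) (fun _ => by positivity) (fun _ => by positivity)
      (N := N) fun i j hij _ _ => by omega).trans ?_
    exact mul_le_mul_of_nonneg_right (Summable.sum_le_tsum _ (fun _ _ => by positivity) hf)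
      (Finset.sum_nonneg fun _ _ => by positivity)
  linarith

end AbsConv

section evalAt

variable {x : 𝕜} {f : 𝕜⟦X⟧}

theorem evalAt_neg : evalAt x (-f) = -evalAt x f := by
  rw [evalAt, evalAt, ← tsum_neg]
  exact tsum_congr fun n => by rw [map_neg, neg_mul]

theorem evalAt_C (c : 𝕜) : evalAt x (C c) = c := by
  rw [evalAt, tsum_eq_single 0 fun n hn => by simp [coeff_C, hn]]
  simp

theorem evalAt_one : evalAt x (1 : 𝕜⟦X⟧) = 1 := by
  simpa using evalAt_C (x := x) (1 : 𝕜)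

theorem evalAt_X : evalAt x (X : 𝕜⟦X⟧) = x := by
  rw [evalAt, tsum_eq_single 1 fun n hn => by simp [coeff_X, hn]]
  simp

theorem evalAt_zero : evalAt 0 f = constantCoeff f := by
  rw [evalAt, tsum_eq_single 0 fun n hn => by simp [hn]]
  simp

theorem evalAt_expand {p : ℕ} (hp : p ≠ 0) : evalAt x (expand p hp f) = evalAt (x ^ p) f := by
  rw [evalAt, evalAt, ← (mul_right_injective₀ hp).tsum_eq
    (f := fun n => coeff n (expand p hp f) * x ^ n)]
  · exact tsum_congr fun n => by rw [coeff_expand_mul, pow_mul]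
  · intro n hn
    by_contra hmem
    have hdvd : ¬ p ∣ n := fun ⟨k, hk⟩ => hmem ⟨k, hk.symm⟩
    rw [Function.mem_support, coeff_expand_of_not_dvd _ _ _ hdvd, zero_mul] at hn
    exact hn rfl

variable [CompleteSpace 𝕜] {r : ℝ} {g : 𝕜⟦X⟧}

theorem evalAt_add (hf : AbsConv r f) (hg : AbsConv r g) (hx : ‖x‖ ≤ r) :
    evalAt x (f + g) = evalAt x f + evalAt x g := by
  rw [evalAt, evalAt, evalAt,
    ← Summable.tsum_add (hf.summable hx).of_norm (hg.summable hx).of_norm]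
  exact tsum_congr fun n => by rw [map_add, add_mul]

theorem evalAt_sub (hf : AbsConv r f) (hg : AbsConv r g) (hx : ‖x‖ ≤ r) :
    evalAt x (f - g) = evalAt x f - evalAt x g := by
  rw [sub_eq_add_neg, evalAt_add hf hg.neg hx, evalAt_neg, ← sub_eq_add_neg]

theorem evalAt_mul (hf : AbsConv r f) (hg : AbsConv r g) (hx : ‖x‖ ≤ r) :
    evalAt x (f * g) = evalAt x f * evalAt x g := by
  rw [evalAt, evalAt, evalAt, tsum_mul_tsum_eq_tsum_sum_antidiagonal_of_summable_norm
    (hf.summable hx) (hg.summable hx)]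
  refine tsum_congr fun n => ?_
  rw [coeff_mul, Finset.sum_mul]
  refine Finset.sum_congr rfl fun p hp => ?_
  rw [← mem_antidiagonal.1 hp, pow_add]
  ring

theorem evalAt_one_sub_C_mul_X (a x : 𝕜) : evalAt x (1 - C a * X) = 1 - a * x := by
  have hX : AbsConv ‖x‖ (C a * X : 𝕜⟦X⟧) := (AbsConv.const a).mul (norm_nonneg x) .var
  rw [evalAt_sub .one hX le_rfl, evalAt_mul (.const a) .var le_rfl, evalAt_one, evalAt_C, evalAt_X]

theorem evalAt_pow (hf : AbsConv r f) (hx : ‖x‖ ≤ r) (k : ℕ) :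
    evalAt x (f ^ k) = evalAt x f ^ k := by
  induction k with
  | zero => rw [pow_zero, pow_zero, evalAt_one]
  | succ k ih =>
    rw [pow_succ, pow_succ, evalAt_mul (hf.pow ((norm_nonneg x).trans hx) k) hf hx, ih]

end evalAt

/-- The power series that converge absolutely at some radius greater than `α`. -/
def overconvergent (𝕜 : Type*) [NormedField 𝕜] {α : ℝ} (hα : 0 ≤ α) : Subring 𝕜⟦X⟧ where
  carrier := {f | ∃ r, α < r ∧ AbsConv r f}
  mul_mem' := by
    rintro f g ⟨r, hr, hf⟩ ⟨s, hs, hg⟩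
    have hmin : 0 ≤ min r s := hα.trans (lt_min hr hs).le
    exact ⟨min r s, lt_min hr hs, (hf.mono hmin (min_le_left _ _)).mul hmin
      (hg.mono hmin (min_le_right _ _))⟩
  add_mem' := by
    rintro f g ⟨r, hr, hf⟩ ⟨s, hs, hg⟩
    have hmin : 0 ≤ min r s := hα.trans (lt_min hr hs).le
    exact ⟨min r s, lt_min hr hs, (hf.mono hmin (min_le_left _ _)).add hmin
      (hg.mono hmin (min_le_right _ _))⟩
  neg_mem' := fun ⟨r, hr, hf⟩ => ⟨r, hr, hf.neg⟩
  one_mem' := ⟨α + 1, lt_add_one α, .one⟩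
  zero_mem' := ⟨α + 1, lt_add_one α, .of_coeff_eq_zero (N := 0) fun n _ => map_zero _⟩

section overconvergent

variable {α : ℝ} {hα : 0 ≤ α}

theorem C_mem_overconvergent (c : 𝕜) : C c ∈ overconvergent 𝕜 hα :=
  ⟨α + 1, lt_add_one α, .const c⟩

theorem X_mem_overconvergent : X ∈ overconvergent 𝕜 hα := ⟨α + 1, lt_add_one α, .var⟩

theorem one_sub_C_mul_X_mem_overconvergent (a : 𝕜) : 1 - C a * X ∈ overconvergent 𝕜 hα :=
  ⟨α + 1, lt_add_one α, .one_sub_C_mul_X (by positivity) a⟩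

theorem absConv_of_mem_overconvergent {f : 𝕜⟦X⟧} (hf : f ∈ overconvergent 𝕜 hα) : AbsConv α f := by
  obtain ⟨r, hr, hf⟩ := hf
  exact hf.mono hα hr.le

theorem expand_mem_overconvergent {p : ℕ} (hp : 1 < p) (hα₀ : 0 < α) (hα₁ : α < 1) {f : 𝕜⟦X⟧}
    (hf : ∀ r, 0 ≤ r → r < α → AbsConv r f) :
    expand p (by omega) f ∈ overconvergent 𝕜 hα := by
  have hroot : α < α ^ (p⁻¹ : ℝ) := by
    conv_lhs => rw [← Real.rpow_one α]
    exact Real.rpow_lt_rpow_of_exponent_gt hα₀ hα₁ (inv_lt_one_of_one_lt₀ (by exact_mod_cast hp))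
  obtain ⟨r, hr, hr'⟩ := exists_between hroot
  have hr₀ : 0 ≤ r := (hα₀.trans hr).le
  refine ⟨r, hr, (hf _ (pow_nonneg hr₀ p) ?_).expand _⟩
  calc r ^ p < (α ^ (p⁻¹ : ℝ)) ^ p := pow_lt_pow_left₀ hr' hr₀ (by omega)
    _ = α := Real.rpow_inv_natCast_pow hα₀.le (by omega)

end overconvergent

end AbsConv

/-- The subring `R + R y` for an element `y` with `y ^ 2 ∈ R`. -/
def adjoinSqrt {A : Type*} [CommRing A] (R : Subring A) {y : A} (hy : y ^ 2 ∈ R) :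
    Subring A where
  carrier := {f | ∃ p ∈ R, ∃ q ∈ R, f = p + q * y}
  mul_mem' := by
    rintro _ _ ⟨p, hp, q, hq, rfl⟩ ⟨p', hp', q', hq', rfl⟩
    exact ⟨p * p' + q * q' * y ^ 2, R.add_mem (R.mul_mem hp hp') (R.mul_mem (R.mul_mem hq hq') hy),
      p * q' + q * p', R.add_mem (R.mul_mem hp hq') (R.mul_mem hq hp'), by ring⟩
  add_mem' := by
    rintro _ _ ⟨p, hp, q, hq, rfl⟩ ⟨p', hp', q', hq', rfl⟩
    exact ⟨p + p', R.add_mem hp hp', q + q', R.add_mem hq hq', by ring⟩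
  neg_mem' := by
    rintro _ ⟨p, hp, q, hq, rfl⟩
    exact ⟨-p, R.neg_mem hp, -q, R.neg_mem hq, by ring⟩
  one_mem' := ⟨1, R.one_mem, 0, R.zero_mem, by ring⟩
  zero_mem' := ⟨0, R.zero_mem, 0, R.zero_mem, by ring⟩

theorem le_adjoinSqrt {A : Type*} [CommRing A] (R : Subring A) {y : A} (hy : y ^ 2 ∈ R) :
    R ≤ adjoinSqrt R hy := fun p hp => ⟨p, hp, 0, R.zero_mem, by ring⟩

theorem self_mem_adjoinSqrt {A : Type*} [CommRing A] (R : Subring A) {y : A}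
    (hy : y ^ 2 ∈ R) : y ∈ adjoinSqrt R hy := ⟨0, R.zero_mem, 1, R.one_mem, by ring⟩

/-! ### Square roots and expansions of holomorphic functions -/

section Holomorphic

open PowerSeries

theorem exists_sq_eq_of_differentiableOn {K : ℂ → ℂ} {R : ℝ} (hR : 0 < R)
    (hK : DifferentiableOn ℂ K (Metric.ball 0 R)) (hK₀ : ∀ x ∈ Metric.ball (0 : ℂ) R, K x ≠ 0) :
    ∃ w : ℂ → ℂ, DifferentiableOn ℂ w (Metric.ball 0 R) ∧
      ∀ x ∈ Metric.ball (0 : ℂ) R, w x ^ 2 = K x := by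
  obtain ⟨g, hg⟩ := ((hK.deriv Metric.isOpen_ball).div hK hK₀).isExactOn_ball
  have hderiv : ∀ x ∈ Metric.ball (0 : ℂ) R,
      HasDerivAt (fun x => K x * Complex.exp (-g x)) 0 x := by
    intro x hx
    have hKx := (hK.differentiableAt (Metric.isOpen_ball.mem_nhds hx)).hasDerivAt
    refine (hKx.mul (hg x hx).neg.cexp).congr_deriv ?_
    have hne : K x ≠ 0 := hK₀ x hx
    rw [Pi.div_apply]
    field_simp
    ring
  have hconst : ∀ x ∈ Metric.ball (0 : ℂ) R,
      K x * Complex.exp (-g x) = K 0 * Complex.exp (-g 0) := fun x hx =>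
    Metric.isOpen_ball.is_const_of_deriv_eq_zero (convex_ball _ _).isPreconnected
      (fun x hx => (hderiv x hx).differentiableAt.differentiableWithinAt)
      (fun x hx => (hderiv x hx).deriv) hx (Metric.mem_ball_self hR)
  obtain ⟨c, hc⟩ := IsAlgClosed.exists_pow_nat_eq (K 0 * Complex.exp (-g 0)) two_pos
  refine ⟨fun x => c * Complex.exp (g x / 2), fun x hx => ?_, fun x hx => ?_⟩
  · exact (((hg x hx).div_const 2).cexp.const_mul c).differentiableAt.differentiableWithinAt
  · rw [mul_pow, hc, ← hconst x hx, ← Complex.exp_nat_mul, mul_assoc, ← Complex.exp_add,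
      Nat.cast_two, mul_div_cancel₀ _ two_ne_zero, neg_add_cancel, Complex.exp_zero, mul_one]

theorem exists_absConv_evalAt_eq {w : ℂ → ℂ} {R : ℝ} (hR : 0 < R)
    (hw : DifferentiableOn ℂ w (Metric.closedBall 0 R)) :
    ∃ W : ℂ⟦X⟧, (∀ r, 0 ≤ r → r < R → AbsConv r W) ∧
      ∀ x : ℂ, ‖x‖ < R → evalAt x W = w x := by
  lift R to NNReal using hR.le
  have hseries := hw.hasFPowerSeriesOnBall (NNReal.coe_pos.1 hR)
  set p := cauchyPowerSeries w 0 R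
  refine ⟨mk fun n => p.coeff n, fun r hr₀ hr => ?_, fun x hx => ?_⟩
  · lift r to NNReal using hr₀
    refine (p.summable_norm_mul_pow
      (lt_of_lt_of_le (ENNReal.coe_lt_coe.2 (NNReal.coe_lt_coe.1 hr)) hseries.r_le)).congr
      fun n => ?_
    rw [coeff_mk, FormalMultilinearSeries.norm_apply_eq_norm_coef]
  · have hx' : x ∈ Metric.eball (0 : ℂ) R := by
      rw [mem_eball_zero_iff, enorm_eq_nnnorm, ENNReal.coe_lt_coe]
      exact hx
    have hsum := hseries.hasSum hx'
    rw [zero_add] at hsum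
    rw [← hsum.tsum_eq, evalAt]
    refine tsum_congr fun n => ?_
    rw [FormalMultilinearSeries.apply_eq_pow_smul_coeff, coeff_mk, smul_eq_mul, mul_comm]

theorem hasFPowerSeriesAt_evalAt {r : ℝ} (hr : 0 < r) {f : ℂ⟦X⟧} (hf : AbsConv r f) :
    HasFPowerSeriesAt (fun x => evalAt x f)
      (FormalMultilinearSeries.ofScalars ℂ fun n => coeff n f) 0 := by
  lift r to NNReal using hr.le
  refine ⟨r, ?_, ENNReal.coe_pos.2 (NNReal.coe_pos.1 hr), fun {y} hy => ?_⟩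
  · refine FormalMultilinearSeries.le_radius_of_summable _ (hf.congr fun n => ?_)
    rw [FormalMultilinearSeries.ofScalars_norm]
  · have hy' : ‖y‖ ≤ r := by
      rw [mem_eball_zero_iff, enorm_eq_nnnorm, ENNReal.coe_lt_coe] at hy
      exact hy.le
    rw [zero_add]
    refine (hf.hasSum hy').congr_fun fun n => ?_
    rw [FormalMultilinearSeries.ofScalars_apply_eq, smul_eq_mul]

theorem hasDerivAt_evalAt {𝕜 : Type*} [RCLike 𝕜] {r : ℝ} {f : 𝕜⟦X⟧} (hf : AbsConv r f) {x : 𝕜}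
    (hx : ‖x‖ < r) : HasDerivAt (fun x => evalAt x f) (evalAt x (derivative 𝕜 f)) x := by
  obtain ⟨s, hxs, hsr⟩ := exists_between hx
  have hs₀ : 0 ≤ s := (norm_nonneg x).trans hxs.le
  have hbound : Summable fun n : ℕ => ‖coeff n f * n‖ * s ^ (n - 1) := by
    rw [← summable_nat_add_iff 1]
    refine (hf.derivative hs₀ hsr).congr fun n => ?_
    rw [coeff_derivative, Nat.cast_succ, Nat.add_sub_cancel]
  have hderiv := hasDerivAt_tsum_of_isPreconnected hbound Metric.isOpen_ball
    (convex_ball (0 : 𝕜) s).isPreconnected (g := fun n x => coeff n f * x ^ n)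
    (g' := fun n x => coeff n f * n * x ^ (n - 1))
    (fun n y _ => by simpa only [mul_assoc] using (hasDerivAt_pow n y).const_mul (coeff n f))
    (fun n y hy => ?_) (mem_ball_zero_iff.2 hxs) (hf.summable hx.le).of_norm
    (mem_ball_zero_iff.2 hxs)
  · refine hderiv.congr_deriv ?_
    rw [evalAt, tsum_eq_zero_add' (f := fun n : ℕ => coeff n f * n * x ^ (n - 1))]
    · simp [coeff_derivative]
    · refine (((hf.derivative hs₀ hsr).hasSum hxs.le).summable).congr fun n => ?_
      rw [coeff_derivative, Nat.cast_succ, Nat.add_sub_cancel]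
  · rw [norm_mul, norm_pow]
    exact mul_le_mul_of_nonneg_left
      (pow_le_pow_left₀ (norm_nonneg y) (mem_ball_zero_iff.1 hy).le _) (norm_nonneg _)

theorem differentiableOn_evalAt {r : ℝ} {f : ℂ⟦X⟧} (hf : AbsConv r f) :
    DifferentiableOn ℂ (fun x => evalAt x f) (Metric.ball 0 r) := fun _ hx =>
  (hasDerivAt_evalAt hf (mem_ball_zero_iff.1 hx)).differentiableAt.differentiableWithinAt

theorem exists_ball_ne_zero {K : ℂ → ℂ} {α r : ℝ} (hα : 0 ≤ α) (hr : α < r)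
    (hK : ContinuousOn K (Metric.ball 0 r)) (hK₀ : ∀ x, ‖x‖ ≤ α → K x ≠ 0) :
    ∃ R, α < R ∧ R ≤ r ∧ ∀ x ∈ Metric.ball (0 : ℂ) R, K x ≠ 0 := by
  obtain ⟨δ, hδ, hsub⟩ := (isCompact_closedBall (0 : ℂ) α).exists_thickening_subset_open
    (hK.isOpen_inter_preimage Metric.isOpen_ball isOpen_compl_singleton) fun x hx =>
      ⟨Metric.closedBall_subset_ball hr hx, hK₀ x (mem_closedBall_zero_iff.1 hx)⟩
  rw [thickening_closedBall hδ hα] at hsub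
  exact ⟨min (δ + α) r, lt_min (lt_add_of_pos_left α hδ) hr, min_le_right _ _, fun x hx =>
    (hsub (Metric.ball_subset_ball (min_le_left _ _) hx)).2⟩

section overconvergent

variable {α : ℝ} {hα : 0 ≤ α}

theorem exists_mem_overconvergent_evalAt_eq {w : ℂ → ℂ} {R : ℝ} (hR : α < R)
    (hw : DifferentiableOn ℂ w (Metric.ball 0 R)) :
    ∃ W ∈ overconvergent ℂ hα, ∀ᶠ x in 𝓝 0, evalAt x W = w x := by
  obtain ⟨s, hαs, hsR⟩ := exists_between hR
  obtain ⟨t, hαt, hts⟩ := exists_between hαs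
  have hs : 0 < s := hα.trans_lt hαs
  obtain ⟨W, hW, heval⟩ :=
    exists_absConv_evalAt_eq hs (hw.mono (Metric.closedBall_subset_ball hsR))
  refine ⟨W, ⟨t, hαt, hW t (hα.trans hαt.le) hts⟩, ?_⟩
  filter_upwards [Metric.ball_mem_nhds (0 : ℂ) hs] with x hx
  exact heval x (mem_ball_zero_iff.1 hx)

theorem eq_of_eventually_evalAt_eq {f g : ℂ⟦X⟧} (hf : f ∈ overconvergent ℂ hα)
    (hg : g ∈ overconvergent ℂ hα) (h : ∀ᶠ x in 𝓝 0, evalAt x f = evalAt x g) : f = g := by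
  obtain ⟨r, hr, hf⟩ := hf
  obtain ⟨s, hs, hg⟩ := hg
  have hcoeff := FormalMultilinearSeries.ofScalars_series_injective ℂ ℂ
    (((hasFPowerSeriesAt_evalAt (hα.trans_lt hr) hf).congr h).eq_formalMultilinearSeries
      (hasFPowerSeriesAt_evalAt (hα.trans_lt hs) hg))
  ext n
  exact congrFun hcoeff n

theorem eventually_evalAt_mul {f g : ℂ⟦X⟧} (hf : f ∈ overconvergent ℂ hα)
    (hg : g ∈ overconvergent ℂ hα) :
    ∀ᶠ x in 𝓝 0, evalAt x (f * g) = evalAt x f * evalAt x g := by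
  obtain ⟨r, hr, hf⟩ := hf
  obtain ⟨s, hs, hg⟩ := hg
  have hmin : 0 < min r s := hα.trans_lt (lt_min hr hs)
  filter_upwards [Metric.ball_mem_nhds (0 : ℂ) hmin] with x hx
  exact evalAt_mul (hf.mono hmin.le (min_le_left _ _)) (hg.mono hmin.le (min_le_right _ _))
    (mem_ball_zero_iff.1 hx).le

theorem mem_overconvergent_of_one_sub_mul {f g : ℂ⟦X⟧} {a : ℂ} (ha₀ : a ≠ 0) (ha : ‖a‖ ≤ α)
    (hf : f ∈ overconvergent ℂ hα) (hfa : evalAt a f = 0) (hfg : f = (1 - C a⁻¹ * X) * g) :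
    g ∈ overconvergent ℂ hα := by
  obtain ⟨r, hr, hfr⟩ := hf
  have har : a ∈ Metric.ball (0 : ℂ) r := mem_ball_zero_iff.2 (ha.trans_lt hr)
  obtain ⟨W, hW, hWeval⟩ := exists_mem_overconvergent_evalAt_eq (hα := hα) hr
    (((Complex.differentiableOn_dslope (Metric.isOpen_ball.mem_nhds har)).2
      (differentiableOn_evalAt hfr)).const_mul (-a))
  have hlinear : 1 - C a⁻¹ * X ∈ overconvergent ℂ hα := one_sub_C_mul_X_mem_overconvergent _
  have hfW : f = (1 - C a⁻¹ * X) * W := by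
    refine eq_of_eventually_evalAt_eq ⟨r, hr, hfr⟩ (mul_mem hlinear hW) ?_
    filter_upwards [hWeval, eventually_evalAt_mul hlinear hW] with x hx hmul
    have hdslope := sub_smul_dslope (fun x => evalAt x f) a x
    rw [hfa, sub_zero, smul_eq_mul] at hdslope
    rw [hmul, hx, evalAt_one_sub_C_mul_X, ← hdslope]
    field_simp
    ring
  have hne : (1 - C a⁻¹ * X : ℂ⟦X⟧) ≠ 0 := fun h => by
    simpa using congrArg constantCoeff h
  rwa [mul_left_cancel₀ hne (hfg.symm.trans hfW)]

theorem exists_sq_eq_of_evalAt_ne_zero {f : ℂ⟦X⟧} (hf : f ∈ overconvergent ℂ hα)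
    (hne : ∀ x, ‖x‖ ≤ α → evalAt x f ≠ 0) :
    ∃ W ∈ overconvergent ℂ hα, ∃ V ∈ overconvergent ℂ hα, W ^ 2 = f ∧ W * V = 1 := by
  obtain ⟨r, hr, hfr⟩ := hf
  have hdiff := differentiableOn_evalAt hfr
  obtain ⟨R, hR, hRr, hR₀⟩ := exists_ball_ne_zero hα hr hdiff.continuousOn hne
  obtain ⟨w, hw, hsq⟩ := exists_sq_eq_of_differentiableOn (hα.trans_lt hR)
    (hdiff.mono (Metric.ball_subset_ball hRr)) hR₀
  have hw₀ : ∀ x ∈ Metric.ball (0 : ℂ) R, w x ≠ 0 := fun x hx h =>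
    hR₀ x hx (by rw [← hsq x hx, h, zero_pow two_ne_zero])
  obtain ⟨W, hW, hWeval⟩ := exists_mem_overconvergent_evalAt_eq (hα := hα) hR hw
  obtain ⟨V, hV, hVeval⟩ := exists_mem_overconvergent_evalAt_eq (hα := hα) hR (hw.inv hw₀)
  have hball : Metric.ball (0 : ℂ) R ∈ 𝓝 0 := Metric.ball_mem_nhds _ (hα.trans_lt hR)
  refine ⟨W, hW, V, hV, ?_, ?_⟩
  · rw [sq]
    refine eq_of_eventually_evalAt_eq (mul_mem hW hW) ⟨r, hr, hfr⟩ ?_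
    filter_upwards [hWeval, eventually_evalAt_mul hW hW, hball] with x hx hmul hxR
    rw [hmul, hx, ← sq, hsq x hxR]
  · refine eq_of_eventually_evalAt_eq (mul_mem hW hV) (one_mem _) ?_
    filter_upwards [hWeval, hVeval, eventually_evalAt_mul hW hV, hball] with x hx hx' hmul hxR
    rw [hmul, hx, hx', Pi.inv_apply, mul_inv_cancel₀ (hw₀ x hxR), evalAt_one]

end overconvergent

/-- The inclusion of real into complex power series. -/
noncomputable abbrev toComplex : ℝ⟦X⟧ →+* ℂ⟦X⟧ := PowerSeries.map Complex.ofRealHom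

theorem absConv_toComplex {r : ℝ} {f : ℝ⟦X⟧} : AbsConv r (toComplex f) ↔ AbsConv r f := by
  simp [AbsConv]

theorem evalAt_toComplex (x : ℝ) (f : ℝ⟦X⟧) : evalAt (x : ℂ) (toComplex f) = (evalAt x f : ℝ) := by
  rw [evalAt, evalAt, Complex.ofReal_tsum]
  exact tsum_congr fun n => by simp

theorem norm_evalAt_toComplex_le {r : ℝ} {f : ℝ⟦X⟧} (hf : AbsConv r f)
    (hf₀ : ∀ n, 0 ≤ coeff n f) {x : ℂ} (hx : ‖x‖ ≤ r) :
    ‖evalAt x (toComplex f)‖ ≤ evalAt r f := by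
  have hr : 0 ≤ r := (norm_nonneg x).trans hx
  refine tsum_of_norm_bounded (hf.hasSum (Real.norm_of_nonneg hr).le) fun n => ?_
  rw [norm_mul, norm_pow, PowerSeries.coeff_map, Complex.ofRealHom_eq_coe, Complex.norm_real,
    Real.norm_of_nonneg (hf₀ n)]
  exact mul_le_mul_of_nonneg_left (pow_le_pow_left₀ (norm_nonneg x) hx n) (hf₀ n)

section overconvergent

variable {α : ℝ} {hα : 0 ≤ α}

theorem toComplex_mem_overconvergent {f : ℝ⟦X⟧} :
    toComplex f ∈ overconvergent ℂ hα ↔ f ∈ overconvergent ℝ hα :=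
  exists_congr fun _ => and_congr_right fun _ => absConv_toComplex

/-- A holomorphic square root of `f ^ 2` beyond the disc agrees with `f` up to sign. -/
theorem mem_overconvergent_of_sq {f : ℝ⟦X⟧} (hf : f ^ 2 ∈ overconvergent ℝ hα)
    (hne : ∀ x, ‖x‖ ≤ α → evalAt x (toComplex (f ^ 2)) ≠ 0) :
    f ∈ overconvergent ℝ hα ∧ f⁻¹ ∈ overconvergent ℝ hα := by
  obtain ⟨W, hW, V, hV, hsq, hWV⟩ :=
    exists_sq_eq_of_evalAt_ne_zero (toComplex_mem_overconvergent.2 hf) hne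
  have hf₀ : constantCoeff f ≠ 0 := fun h => hne 0 (norm_zero.trans_le hα) <| by
    rw [evalAt_zero, map_pow, map_pow, ← coeff_zero_eq_constantCoeff_apply, coeff_map,
      coeff_zero_eq_constantCoeff_apply, h, map_zero, zero_pow two_ne_zero]
  have hinv : toComplex f * toComplex f⁻¹ = 1 := by
    rw [← map_mul, PowerSeries.mul_inv_cancel _ hf₀, map_one]
  rw [map_pow] at hsq
  rw [← toComplex_mem_overconvergent, ← toComplex_mem_overconvergent]
  rcases sq_eq_sq_iff_eq_or_eq_neg.1 hsq with h | h
  · have hV_eq : toComplex f⁻¹ = V := by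
      linear_combination V * hinv - toComplex f⁻¹ * hWV + toComplex f⁻¹ * V * h
    rw [hV_eq, ← h]
    exact ⟨hW, hV⟩
  · have hV_eq : toComplex f⁻¹ = -V := by
      linear_combination -V * hinv - toComplex f⁻¹ * hWV + toComplex f⁻¹ * V * h
    rw [hV_eq, ← neg_eq_iff_eq_neg.2 h]
    exact ⟨neg_mem hW, neg_mem hV⟩

end overconvergent

end Holomorphic

/-! ### Singularity analysis -/

section SingularityAnalysis

open PowerSeries
open Finset.HasAntidiagonal (antidiagonal mem_antidiagonal)

theorem multichoose_eq_prod_div_factorial (s : ℝ) (n : ℕ) :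
    Ring.multichoose s n = (∏ j ∈ Finset.range n, (s + j)) / n.factorial := by
  rw [eq_div_iff (by positivity), mul_comm, ← nsmul_eq_mul,
    Ring.factorial_nsmul_multichoose_eq_ascPochhammer, Polynomial.ascPochhammer_smeval_eq_eval]
  induction n with
  | zero => simp
  | succ n ih => rw [Finset.prod_range_succ, ← ih, ascPochhammer_succ_eval]

theorem tendsto_natCast_div_const_add (s : ℝ) :
    Tendsto (fun n : ℕ => (n : ℝ) / (s + n)) atTop (𝓝 1) := by
  simpa only [add_comm] using tendsto_natCast_div_add_atTop s

theorem tendsto_multichoose_mul_rpow (s : ℝ) :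
    Tendsto (fun n : ℕ => Ring.multichoose s n * (n : ℝ) ^ (1 - s)) atTop
      (𝓝 (Real.Gamma s)⁻¹) := by
  simp only [multichoose_eq_prod_div_factorial]
  by_cases hs : Real.Gamma s = 0
  · obtain ⟨m, hm⟩ := (Real.Gamma_eq_zero_iff s).1 hs
    rw [hs, inv_zero]
    refine tendsto_const_nhds.congr' ?_
    filter_upwards [eventually_gt_atTop m] with n hn
    rw [Finset.prod_eq_zero (Finset.mem_range.2 hn) (by rw [hm, neg_add_cancel]), zero_div,
      zero_mul]
  · have hlim := ((Real.GammaSeq_tendsto_Gamma s).inv₀ hs).mul (tendsto_natCast_div_const_add s)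
    rw [mul_one] at hlim
    refine hlim.congr' ?_
    filter_upwards [(tendsto_natCast_atTop_atTop (R := ℝ)).eventually_gt_atTop (-s),
      eventually_gt_atTop 0] with n hns hn
    have hn' : (0 : ℝ) < n := Nat.cast_pos.2 hn
    have hpow : (n : ℝ) ^ s ≠ 0 := (Real.rpow_pos_of_pos hn' s).ne'
    have hfact : (n.factorial : ℝ) ≠ 0 := by positivity
    have hsn : s + n ≠ 0 := by linarith
    rw [Real.GammaSeq, Finset.prod_range_succ, Real.rpow_sub hn', Real.rpow_one, inv_div]
    field_simp

/-- The expansion of `(1 - x / α) ^ s` at the origin. -/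
noncomputable def oneSubPow (α s : ℝ) : ℝ⟦X⟧ :=
  rescale (-α⁻¹) (binomialSeries ℝ s)

theorem oneSubPow_add (α s t : ℝ) : oneSubPow α (s + t) = oneSubPow α s * oneSubPow α t := by
  rw [oneSubPow, binomialSeries_add, map_mul, oneSubPow, oneSubPow]

theorem oneSubPow_zero (α : ℝ) : oneSubPow α 0 = 1 := by
  rw [oneSubPow, binomialSeries_zero, map_one]

theorem oneSubPow_one (α : ℝ) : oneSubPow α 1 = 1 - C α⁻¹ * X := by
  have hbinom : PowerSeries.binomialSeries ℝ (1 : ℝ) = 1 + X := by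
    simpa using binomialSeries_nat (R := ℝ) (A := ℝ) 1
  rw [oneSubPow, hbinom, map_add, map_one, rescale_X, map_neg]
  ring

theorem oneSubPow_natCast_mul (α s : ℝ) (j : ℕ) : oneSubPow α (j * s) = oneSubPow α s ^ j := by
  induction j with
  | zero => simp [oneSubPow_zero]
  | succ j ih => rw [pow_succ, ← ih, ← oneSubPow_add, Nat.cast_succ, add_one_mul]

theorem coeff_oneSubPow_neg (α s : ℝ) (n : ℕ) :
    coeff n (oneSubPow α (-s)) = α⁻¹ ^ n * Ring.multichoose s n := by
  rw [oneSubPow, coeff_rescale, binomialSeries_coeff, smul_eq_mul, mul_one, Ring.choose_neg',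
    Int.negOnePow_def, zpow_natCast, Units.smul_def, zsmul_eq_mul, ← mul_assoc, neg_pow]
  push_cast
  rw [mul_right_comm ((-1) ^ n), ← mul_pow, neg_one_mul, neg_neg, one_pow, one_mul]

theorem tendsto_coeff_oneSubPow {α : ℝ} (hα : α ≠ 0) (s : ℝ) :
    Tendsto (fun n : ℕ => coeff n (oneSubPow α (-s)) * α ^ n * ((n : ℝ) + 1) ^ (1 - s)) atTop
      (𝓝 (Real.Gamma s)⁻¹) := by
  have hlim := (tendsto_multichoose_mul_rpow s).mul
    (((tendsto_natCast_div_const_add 1).inv₀ one_ne_zero).rpow_const (p := 1 - s)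
      (Or.inl (inv_ne_zero one_ne_zero)))
  rw [inv_one, Real.one_rpow, mul_one] at hlim
  refine hlim.congr' ?_
  filter_upwards [eventually_gt_atTop 0] with n hn
  have hn' : (0 : ℝ) < n := Nat.cast_pos.2 hn
  have hpow : (n : ℝ) ^ (1 - s) ≠ 0 := (Real.rpow_pos_of_pos hn' _).ne'
  rw [inv_div, Real.div_rpow (by positivity) hn'.le, coeff_oneSubPow_neg, add_comm (1 : ℝ), inv_pow]
  field_simp

theorem tendsto_natCast_add_div (k : ℕ) :
    Tendsto (fun n : ℕ => ((n : ℝ) + k + 1) / (n + 1)) atTop (𝓝 1) := by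
  have hlim : Tendsto (fun n : ℕ => 1 + (k : ℝ) / ((n : ℝ) + 1)) atTop (𝓝 (1 + 0)) :=
    (tendsto_const_nhds.div_atTop
      (tendsto_atTop_add_const_right _ _ tendsto_natCast_atTop_atTop)).const_add 1
  rw [add_zero] at hlim
  refine hlim.congr fun n => ?_
  field_simp
  ring

theorem natCast_add_div_rpow_le (m k : ℕ) (t : ℝ) :
    (((m : ℝ) + k + 1) / (m + 1)) ^ t ≤ ((k : ℝ) + 1) ^ |t| := by
  have hone : (1 : ℝ) ≤ ((m : ℝ) + k + 1) / (m + 1) := by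
    rw [le_div_iff₀ (by positivity)]
    linarith [k.cast_nonneg (α := ℝ)]
  have hle : ((m : ℝ) + k + 1) / (m + 1) ≤ k + 1 := by
    rw [div_le_iff₀ (by positivity)]
    nlinarith [mul_nonneg (k.cast_nonneg (α := ℝ)) (m.cast_nonneg (α := ℝ))]
  exact (Real.rpow_le_rpow_of_exponent_le hone (le_abs_self t)).trans
    (Real.rpow_le_rpow (by positivity) hle (abs_nonneg t))

theorem summable_rpow_mul_abs {a : ℕ → ℝ} {q : ℝ} (hq : 1 < q)
    (ha : Summable fun k => |a k| * q ^ k) (p : ℝ) :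
    Summable fun k : ℕ => ((k : ℝ) + 1) ^ p * |a k| := by
  obtain ⟨P, hP⟩ := exists_nat_ge p
  obtain ⟨M, hM⟩ := ((tendsto_pow_const_div_const_pow_of_one_lt P hq).comp
    (tendsto_add_atTop_nat 1)).bddAbove_range
  have : 0 < q := one_pos.trans hq
  refine Summable.of_nonneg_of_le (fun k => by positivity) (fun k => ?_) (ha.mul_left (M * q))
  have hPM : ((k : ℝ) + 1) ^ P ≤ M * q ^ (k + 1) := by
    rw [← div_le_iff₀ (by positivity)]
    simpa using hM ⟨k, rfl⟩
  have hpP : ((k : ℝ) + 1) ^ p ≤ ((k : ℝ) + 1) ^ P := by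
    rw [← Real.rpow_natCast]
    exact Real.rpow_le_rpow_of_exponent_le (by linarith [Nat.cast_nonneg (α := ℝ) k]) hP
  calc ((k : ℝ) + 1) ^ p * |a k| ≤ (M * q ^ (k + 1)) * |a k| :=
        mul_le_mul_of_nonneg_right (hpP.trans hPM) (abs_nonneg _)
    _ = _ := by ring

theorem sum_antidiagonal_eq_tsum_ite {M : Type*} [AddCommMonoid M] [TopologicalSpace M]
    (f : ℕ → ℕ → M) (n : ℕ) :
    ∑ p ∈ antidiagonal n, f p.1 p.2 = ∑' k, if k ≤ n then f (n - k) k else 0 := by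
  rw [tsum_eq_sum (s := Finset.range (n + 1)) fun k hk => if_neg (by simpa using hk),
    Finset.Nat.sum_antidiagonal_eq_sum_range_succ f, ← Finset.sum_range_reflect]
  refine Finset.sum_congr rfl fun k hk => ?_
  have hkn : k ≤ n := Finset.mem_range_succ_iff.1 hk
  rw [if_pos hkn, Nat.succ_sub_one, Nat.sub_sub_self hkn]

/-- Dominated convergence, after writing `((m + k + 1) / (m + 1)) ^ t` for the factor by which the
weight at `m + k` differs from the one at `m`. -/
theorem tendsto_antidiagonal_mul_rpow {c a : ℕ → ℝ} {t L q : ℝ} (hq : 1 < q)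
    (ha : Summable fun k => |a k| * q ^ k)
    (hc : Tendsto (fun n : ℕ => c n * ((n : ℝ) + 1) ^ t) atTop (𝓝 L)) :
    Tendsto (fun n : ℕ => (∑ p ∈ antidiagonal n, c p.1 * a p.2) * ((n : ℝ) + 1) ^ t) atTop
      (𝓝 (L * ∑' k, a k)) := by
  obtain ⟨M, hM⟩ := hc.abs.bddAbove_range
  replace hM : ∀ n : ℕ, |c n * ((n : ℝ) + 1) ^ t| ≤ M := fun n => hM ⟨n, rfl⟩
  have hfactor (m k : ℕ) : c m * a k * (((m + k : ℕ) : ℝ) + 1) ^ t =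
      c m * ((m : ℝ) + 1) ^ t * (((m : ℝ) + k + 1) / (m + 1)) ^ t * a k := by
    have hne : ((m : ℝ) + 1) ^ t ≠ 0 := (Real.rpow_pos_of_pos (by positivity) t).ne'
    rw [Real.div_rpow (by positivity) (by positivity)]
    push_cast
    field_simp
  have hsum (n : ℕ) : (∑ p ∈ antidiagonal n, c p.1 * a p.2) * ((n : ℝ) + 1) ^ t =
      ∑' k, if k ≤ n then c (n - k) * a k * ((n : ℝ) + 1) ^ t else 0 := by
    rw [Finset.sum_mul]
    exact sum_antidiagonal_eq_tsum_ite (fun i j => c i * a j * ((n : ℝ) + 1) ^ t) n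
  simp_rw [hsum]
  rw [← tsum_mul_left]
  refine tendsto_tsum_of_dominated_convergence
    (bound := fun k => M * (((k : ℝ) + 1) ^ |t| * |a k|))
    ((summable_rpow_mul_abs hq ha |t|).mul_left M) (fun k => ?_)
    (Eventually.of_forall fun n k => ?_)
  · rw [← tendsto_add_atTop_iff_nat k]
    have hlim := (hc.mul ((tendsto_natCast_add_div k).rpow_const (p := t)
      (Or.inl one_ne_zero))).mul_const (a k)
    rw [Real.one_rpow, mul_one] at hlim
    refine hlim.congr fun m => ?_
    rw [if_pos (Nat.le_add_left k m), Nat.add_sub_cancel, hfactor]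
  · have hM₀ : 0 ≤ M := (abs_nonneg _).trans (hM 0)
    split_ifs with hk
    · obtain ⟨m, rfl⟩ := Nat.exists_eq_add_of_le' hk
      rw [Nat.add_sub_cancel, hfactor, norm_mul, norm_mul, Real.norm_eq_abs, Real.norm_eq_abs,
        Real.norm_eq_abs, mul_assoc]
      refine mul_le_mul (hM m) (mul_le_mul_of_nonneg_right ?_ (abs_nonneg _)) (by positivity) hM₀
      rw [abs_of_nonneg (by positivity)]
      exact natCast_add_div_rpow_le m k t
    · rw [norm_zero]
      positivity

theorem tendsto_coeff_oneSubPow_mul {α s : ℝ} (hα : 0 < α) {g : ℝ⟦X⟧}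
    (hg : g ∈ overconvergent ℝ hα.le) :
    Tendsto (fun n : ℕ => coeff n (oneSubPow α (-s) * g) * α ^ n * ((n : ℝ) + 1) ^ (1 - s)) atTop
      (𝓝 ((Real.Gamma s)⁻¹ * evalAt α g)) := by
  obtain ⟨r, hr, hg⟩ := hg
  have hsum : Summable fun k => |coeff k g * α ^ k| * (r / α) ^ k := by
    refine hg.congr fun k => ?_
    rw [abs_mul, abs_of_nonneg (pow_nonneg hα.le k), div_pow, Real.norm_eq_abs]
    field_simp
  refine (tendsto_antidiagonal_mul_rpow ((one_lt_div hα).2 hr) hsum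
    (tendsto_coeff_oneSubPow hα.ne' s)).congr fun n => ?_
  rw [coeff_mul, Finset.sum_mul _ _ (α ^ n)]
  congr 1
  refine Finset.sum_congr rfl fun p hp => ?_
  rw [← mem_antidiagonal.1 hp, pow_add]
  ring

theorem tendsto_coeff_oneSubPow_mul_zero {α s t : ℝ} (hα : 0 < α) (hst : s < t) {g : ℝ⟦X⟧}
    (hg : g ∈ overconvergent ℝ hα.le) :
    Tendsto (fun n : ℕ => coeff n (oneSubPow α (-s) * g) * α ^ n * ((n : ℝ) + 1) ^ (1 - t)) atTop
      (𝓝 0) := by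
  have hpow : Tendsto (fun n : ℕ => ((n : ℝ) + 1) ^ (-(t - s))) atTop (𝓝 0) :=
    (tendsto_rpow_neg_atTop (sub_pos.2 hst)).comp
      (tendsto_atTop_add_const_right _ _ tendsto_natCast_atTop_atTop)
  have hlim := (tendsto_coeff_oneSubPow_mul (s := s) hα hg).mul hpow
  rw [mul_zero] at hlim
  refine hlim.congr fun n => ?_
  rw [mul_assoc, ← Real.rpow_add (by positivity)]
  congr 2
  ring

theorem isEquivalent_odd_of_tendsto {A f : ℕ → ℝ} {ρ t L : ℝ} (hρ : 0 < ρ) (hL : L ≠ 0)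
    (hA : Tendsto (fun k : ℕ => A k * (ρ ^ 2) ^ k * ((k : ℝ) + 1) ^ t) atTop (𝓝 L))
    (hf : ∀ n, Odd n → f n = A ((n + 1) / 2)) :
    f ~[atTop ⊓ 𝓟 {n | Odd n}]
      fun n : ℕ => L * ρ⁻¹ * 2 ^ t * ρ ^ (-(n : ℤ)) * (n : ℝ) ^ (-t) := by
  have hodd : ∀ᶠ n : ℕ in atTop ⊓ 𝓟 {n | Odd n}, Odd n :=
    mem_inf_of_right (mem_principal_self _)
  have htwo : (2 : ℝ) ^ t ≠ 0 := (Real.rpow_pos_of_pos two_pos t).ne'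
  refine (isEquivalent_iff_tendsto_one ?_).2 ?_
  · filter_upwards [hodd] with n hn
    have hpow := (Real.rpow_pos_of_pos (Nat.cast_pos.2 hn.pos : (0 : ℝ) < n) (-t)).ne'
    positivity
  · have hhalf : Tendsto (fun n : ℕ => (n + 1) / 2) atTop atTop :=
      tendsto_atTop_atTop.2 fun b => ⟨2 * b, fun n hn => by omega⟩
    have hlim := ((hA.comp hhalf).div_const L).mul
      ((tendsto_natCast_div_const_add 3).rpow_const (p := t) (Or.inl one_ne_zero))
    rw [div_self hL, Real.one_rpow, mul_one] at hlim
    refine (hlim.mono_left inf_le_left).congr' ?_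
    filter_upwards [hodd] with n ⟨k, hk⟩
    have hn : (0 : ℝ) < n := Nat.cast_pos.2 (by omega)
    have hadd : (3 + n : ℝ) = 2 * (((k + 1 : ℕ) : ℝ) + 1) := by
      rw [hk]
      push_cast
      ring
    have hρpow : (ρ ^ 2) ^ (k + 1) = ρ ^ n * ρ := by
      rw [hk]
      ring
    have hkpow : (((k + 1 : ℕ) : ℝ) + 1) ^ t ≠ 0 := (Real.rpow_pos_of_pos (by positivity) t).ne'
    have hnpow : (n : ℝ) ^ t ≠ 0 := (Real.rpow_pos_of_pos hn t).ne'
    simp only [Function.comp_apply, Pi.div_apply]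
    rw [hf n ⟨k, hk⟩, show (n + 1) / 2 = k + 1 by omega, hadd, hρpow,
      Real.div_rpow hn.le (by positivity), Real.mul_rpow two_pos.le (by positivity),
      Real.rpow_neg hn.le, zpow_neg, zpow_natCast]
    field_simp

end SingularityAnalysis
/-! ### Non-plane trees and forests -/

namespace RTree

instance (T : RTree) : OrderTop T.Vertex where
  top := T.root
  le_top := T.le_root

/-- The vertices of a tree are its root `⊤` and the vertices of the subtrees at the root; this
identification hides the recursive definition of `Vertex`. -/
def nodeIso (d : ℕ) (c : Fin d → RTree) :
    (node d c).Vertex ≃o WithTop (Σ i, (c i).Vertex) :=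
  OrderIso.refl _

end RTree

/-- A rooted tree with a set of marked vertices: the data of a copy of some tree in its host. -/
abbrev MarkedTree : Type := Σ T : RTree, Set T.Vertex

namespace MarkedTree

open RTree

/-- Isomorphism of rooted trees with marked vertices. -/
def Iso (x y : MarkedTree) : Prop := ∃ f : x.1.Vertex ≃o y.1.Vertex, ∀ v, v ∈ x.2 ↔ f v ∈ y.2

theorem Iso.refl (x : MarkedTree) : x.Iso x := ⟨OrderIso.refl _, fun _ => Iff.rfl⟩

theorem Iso.symm {x y : MarkedTree} : x.Iso y → y.Iso x := fun ⟨f, hf⟩ =>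
  ⟨f.symm, fun v => by rw [hf, f.apply_symm_apply]⟩

theorem Iso.trans {x y z : MarkedTree} : x.Iso y → y.Iso z → x.Iso z := fun ⟨f, hf⟩ ⟨g, hg⟩ =>
  ⟨f.trans g, fun v => by rw [hf, hg]; rfl⟩

/-- The marked tree with given subtrees whose root is marked iff `m`. -/
def node {d : ℕ} (m : Prop) (c : Fin d → MarkedTree) : MarkedTree :=
  ⟨RTree.node d fun i => (c i).1, {v | match nodeIso d (fun i => (c i).1) v with
    | none => m
    | some ⟨i, w⟩ => w ∈ (c i).2}⟩

theorem mk_node_eq {d : ℕ} (c : Fin d → RTree) (E : Set (RTree.node d c).Vertex) :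
    (⟨RTree.node d c, E⟩ : MarkedTree) = node ((nodeIso d c).symm ⊤ ∈ E)
      fun i => ⟨c i, {v | (nodeIso d c).symm (some ⟨i, v⟩) ∈ E}⟩ := by
  unfold node
  congr 1
  ext v
  obtain ⟨w, rfl⟩ := (nodeIso d c).symm.surjective v
  rcases w with _ | ⟨i, w⟩ <;> rfl

theorem induction {p : MarkedTree → Prop}
    (h : ∀ (d : ℕ) (m : Prop) (c : Fin d → MarkedTree), (∀ i, p (c i)) → p (node m c))
    (x : MarkedTree) : p x := by
  obtain ⟨T, E⟩ := x
  induction T with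
  | node d c ih =>
    rw [mk_node_eq]
    exact h d _ _ fun i => ih i _

theorem node_iso_iff {d d' : ℕ} {m m' : Prop} {c : Fin d → MarkedTree}
    {c' : Fin d' → MarkedTree} :
    (node m c).Iso (node m' c') ↔
      (m ↔ m') ∧ ∃ σ : Fin d ≃ Fin d', ∀ i, (c i).Iso (c' (σ i)) := by
  constructor
  · rintro ⟨f, hf⟩
    let F : WithTop (Σ i, (c i).1.Vertex) ≃o WithTop (Σ i, (c' i).1.Vertex) := f
    obtain ⟨g, hg⟩ := exists_iso_of_withTop_iso F
    obtain ⟨k, hk⟩ := exists_componentIso g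
    refine ⟨?_, componentEquiv g, fun i => ⟨k i, fun v => ?_⟩⟩
    · have hroot : m ↔ F ⊤ ∈ (node m' c').2 := hf (⊤ : WithTop (Σ i, (c i).1.Vertex))
      rw [F.map_top] at hroot
      exact hroot
    · have hmem : v ∈ (c i).2 ↔ F (⟨i, v⟩ : Σ i, (c i).1.Vertex) ∈ (node m' c').2 :=
        hf ((⟨i, v⟩ : Σ i, (c i).1.Vertex) : WithTop (Σ i, (c i).1.Vertex))
      rw [hg, hk] at hmem
      exact hmem
  · rintro ⟨hm, σ, h⟩
    choose k hk using h
    refine ⟨(sigmaOrderIso σ k).withTopCongr, fun v => ?_⟩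
    obtain ⟨w, rfl⟩ := (nodeIso _ _).symm.surjective v
    rcases w with _ | ⟨i, w⟩
    · exact hm
    · exact hk i w

end MarkedTree

namespace RTree

theorem iso_iff_markedTree_iso {s t : RTree} : s.Iso t ↔ MarkedTree.Iso ⟨s, ∅⟩ ⟨t, ∅⟩ :=
  ⟨fun ⟨f⟩ => ⟨f, fun _ => Iff.rfl⟩, fun ⟨f, _⟩ => ⟨f⟩⟩

theorem node_iso_iff {d d' : ℕ} {c : Fin d → RTree} {c' : Fin d' → RTree} :
    (node d c).Iso (node d' c') ↔ ∃ σ : Fin d ≃ Fin d', ∀ i, (c i).Iso (c' (σ i)) := by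
  rw [iso_iff_markedTree_iso, MarkedTree.mk_node_eq, MarkedTree.mk_node_eq,
    MarkedTree.node_iso_iff]
  simp only [Set.mem_empty_iff_false, Set.ofPred_false, true_and, iso_iff_markedTree_iso]

theorem Iso.refl (s : RTree) : s.Iso s := ⟨OrderIso.refl _⟩

theorem Iso.symm {s t : RTree} : s.Iso t → t.Iso s := fun ⟨f⟩ => ⟨f.symm⟩

theorem Iso.trans {s t u : RTree} : s.Iso t → t.Iso u → s.Iso u := fun ⟨f⟩ ⟨g⟩ => ⟨f.trans g⟩

theorem Iso.leaves_eq {s t : RTree} (h : s.Iso t) : s.leaves = t.leaves := by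
  induction s generalizing t with
  | node d c ih =>
    obtain ⟨d', c'⟩ := t
    obtain ⟨σ, hσ⟩ := node_iso_iff.1 h
    obtain rfl : d = d' := by simpa only [Fintype.card_fin] using Fintype.card_congr σ
    simp only [leaves]
    congr 1
    exact Fintype.sum_equiv σ _ _ fun i => ih i (hσ i)

/-- The isomorphism relation on rooted trees. -/
def isoSetoid : Setoid RTree := ⟨Iso, Iso.refl, Iso.symm, Iso.trans⟩

end RTree

/-- Non-plane rooted trees: isomorphism classes of rooted trees. -/
def TreeClass : Type := Quotient RTree.isoSetoid

/-- The isomorphism class of a tree. -/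
def RTree.cls (T : RTree) : TreeClass := Quotient.mk RTree.isoSetoid T

namespace TreeClass

open RTree

theorem cls_eq_iff {s t : RTree} : s.cls = t.cls ↔ s.Iso t := Quotient.eq (r := isoSetoid)

/-- A representative of a non-plane tree. -/
noncomputable def out (t : TreeClass) : RTree := Quotient.out (s := isoSetoid) t

theorem cls_out (t : TreeClass) : t.out.cls = t := Quotient.out_eq (s := isoSetoid) t

theorem map_cls_map_out (l : List TreeClass) : (l.map out).map cls = l := by
  rw [List.map_map, show cls ∘ out = id from funext cls_out, List.map_id]

/-- The non-plane tree with given multiset of subtrees at the root. -/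
noncomputable def mk (F : Multiset TreeClass) : TreeClass :=
  (ofList (F.toList.map out)).cls

theorem cls_node_eq_iff {d d' : ℕ} {c : Fin d → RTree} {c' : Fin d' → RTree} :
    (node d c).cls = (node d' c').cls ↔
      ∑ i, ({(c i).cls} : Multiset TreeClass) = ∑ i, {(c' i).cls} := by
  simp only [cls_eq_iff, node_iso_iff, sum_singleton_eq_iff]

theorem sum_cls_get (l : List RTree) :
    ∑ i, ({(l.get i).cls} : Multiset TreeClass) = (l.map cls : Multiset TreeClass) := by
  rw [← sum_singleton_get, sum_singleton_eq_iff]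
  exact ⟨finCongr (List.length_map cls).symm, fun i => by simp⟩

theorem cls_node {d : ℕ} (c : Fin d → RTree) : (node d c).cls = mk (∑ i, {(c i).cls}) := by
  rw [mk, ofList, cls_node_eq_iff, sum_cls_get, map_cls_map_out, Multiset.coe_toList]

theorem cls_ofList (l : List RTree) : (ofList l).cls = mk (l.map cls : Multiset TreeClass) := by
  rw [ofList, cls_node, sum_cls_get]

theorem mk_injective : Function.Injective mk := by
  intro F G h
  rwa [mk, mk, ofList, ofList, cls_node_eq_iff, sum_cls_get, sum_cls_get,
    map_cls_map_out, map_cls_map_out, Multiset.coe_toList, Multiset.coe_toList] at h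

theorem exists_eq_mk (t : TreeClass) : ∃ F, t = mk F := by
  obtain ⟨⟨d, c⟩, rfl⟩ := Quotient.exists_rep t
  exact ⟨_, cls_node c⟩

/-- The number of vertices. -/
def size : TreeClass → ℕ := Quotient.lift RTree.size fun _ _ h => Iso.size_eq h

/-- The number of leaves. -/
def leaves : TreeClass → ℕ := Quotient.lift RTree.leaves fun _ _ h => Iso.leaves_eq h

@[simp] theorem size_cls (T : RTree) : T.cls.size = T.size := rfl

@[simp] theorem leaves_cls (T : RTree) : T.cls.leaves = T.leaves := rfl

theorem exists_eq_sum_cls (F : Multiset TreeClass) :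
    ∃ (d : ℕ) (c : Fin d → RTree), F = ∑ i, {(c i).cls} :=
  ⟨_, (F.toList.map out).get, by rw [sum_cls_get, map_cls_map_out, Multiset.coe_toList]⟩

theorem size_mk (F : Multiset TreeClass) : (mk F).size = 1 + (F.map size).sum := by
  obtain ⟨d, c, rfl⟩ := exists_eq_sum_cls F
  rw [← cls_node, size_cls, RTree.size, ← Multiset.coe_mapAddMonoidHom, map_sum, Multiset.sum_sum]
  simp

theorem leaves_mk_zero : (mk 0).leaves = 1 := by
  have hnode := cls_node (d := 0) Fin.elim0
  simp only [Finset.univ_eq_empty, Finset.sum_empty] at hnode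
  rw [← hnode, leaves_cls, RTree.leaves, if_pos rfl]

theorem leaves_mk {F : Multiset TreeClass} (hF : F ≠ 0) :
    (mk F).leaves = (F.map leaves).sum := by
  obtain ⟨d, c, rfl⟩ := exists_eq_sum_cls F
  have hd : d ≠ 0 := by
    rintro rfl
    simp at hF
  rw [← cls_node, leaves_cls, RTree.leaves, if_neg hd, ← Multiset.coe_mapAddMonoidHom, map_sum,
    Multiset.sum_sum]
  simp

end TreeClass

/-- The poset `P` is the disjoint union of the trees in the multiset `F`. -/
def IsForest (P : Type) [PartialOrder P] (F : Multiset TreeClass) : Prop :=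
  ∃ (ι : Type) (_ : Fintype ι) (t : ι → RTree),
    Nonempty (P ≃o Σ i, (t i).Vertex) ∧ F = ∑ i, {(t i).cls}

namespace IsForest

open RTree TreeClass

variable {P Q : Type} [PartialOrder P] [PartialOrder Q] {F G : Multiset TreeClass}

theorem congr (e : P ≃o Q) : IsForest P F → IsForest Q F := fun ⟨ι, h, t, ⟨f⟩, hF⟩ =>
  ⟨ι, h, t, ⟨e.symm.trans f⟩, hF⟩

theorem sigma {ι : Type} [Fintype ι] {P : ι → Type} [∀ i, PartialOrder (P i)]
    {F : ι → Multiset TreeClass} (h : ∀ i, IsForest (P i) (F i)) :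
    IsForest (Σ i, P i) (∑ i, F i) := by
  choose κ hκ t e hF using h
  refine ⟨Σ i, κ i, inferInstance, fun x => t x.1 x.2, ⟨?_⟩, ?_⟩
  · have components : (Σ i, P i) ≃o Σ i, Σ j, (t i j).Vertex :=
      sigmaOrderIso (Equiv.refl ι) fun i => (e i).some
    exact components.trans (sigmaAssocIso (R := fun i j => (t i j).Vertex))
  · rw [Fintype.sum_sigma]
    exact Finset.sum_congr rfl fun i _ => hF i

theorem exists_iso (h : IsForest P F) :
    ∃ T : RTree, T.cls = mk F ∧ Nonempty (WithTop P ≃o T.Vertex) := by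
  obtain ⟨ι, _, t, ⟨f⟩, rfl⟩ := h
  let e := Fintype.equivFin ι
  refine ⟨RTree.node _ (t ∘ e.symm), ?_, ⟨?_⟩⟩
  · rw [cls_node]
    congr 1
    exact sum_singleton_eq_iff.2 ⟨e.symm, fun _ => rfl⟩
  · have reindex : (Σ j, (t (e.symm j)).Vertex) ≃o Σ i, (t i).Vertex :=
      sigmaOrderIso e.symm fun j => OrderIso.refl _
    exact (f.trans reindex.symm).withTopCongr

theorem vertex (T : RTree) : IsForest T.Vertex {T.cls} :=
  ⟨Unit, inferInstance, fun _ => T, ⟨(uniqueSigmaIso (P := fun _ : Unit => T.Vertex)).symm⟩,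
    by simp⟩

theorem withTop (h : IsForest P F) : IsForest (WithTop P) {mk F} := by
  obtain ⟨T, hT, ⟨e⟩⟩ := h.exists_iso
  rw [← hT]
  exact (vertex T).congr e.symm

theorem unique (hF : IsForest P F) (hG : IsForest P G) : F = G := by
  obtain ⟨T, hT, ⟨e⟩⟩ := hF.exists_iso
  obtain ⟨T', hT', ⟨e'⟩⟩ := hG.exists_iso
  apply mk_injective
  rw [← hT, ← hT', cls_eq_iff]
  exact ⟨e.symm.trans e'⟩

theorem singleton_iff (S : RTree) : IsForest P {S.cls} ↔ Nonempty (S.Vertex ≃o P) := by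
  refine ⟨fun ⟨ι, _, t, ⟨f⟩, h⟩ => ?_, fun ⟨e⟩ => (vertex S).congr e⟩
  have hcard : Fintype.card ι = 1 := by simpa using (congrArg Multiset.card h).symm
  obtain ⟨i, hi⟩ := Fintype.card_eq_one_iff.1 hcard
  let _ : Unique ι := ⟨⟨i⟩, hi⟩
  rw [Fintype.sum_unique, Multiset.singleton_inj, cls_eq_iff] at h
  obtain ⟨g⟩ := h
  exact ⟨g.trans (uniqueSigmaIso.symm.trans f.symm)⟩

theorem zero_iff : IsForest P 0 ↔ IsEmpty P := by
  constructor
  · rintro ⟨ι, _, t, ⟨f⟩, h⟩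
    have hcard : Fintype.card ι = 0 := by simpa using (congrArg Multiset.card h).symm
    have := Fintype.card_eq_zero_iff.1 hcard
    exact f.toEquiv.isEmpty
  · intro h
    exact ⟨Empty, inferInstance, Empty.elim,
      ⟨⟨Equiv.equivOfIsEmpty _ _, fun {a} => h.elim a⟩⟩, by simp⟩

end IsForest
namespace MarkedTree

open RTree TreeClass

theorem isForest_node_of_marked {d : ℕ} {m : Prop} (hm : m) {c : Fin d → MarkedTree}
    {F : Fin d → Multiset TreeClass} (h : ∀ i, IsForest ((c i).2 : Set _) (F i)) :
    IsForest ((node m c).2 : Set _) {mk (∑ i, F i)} := by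
  let E : Set (WithTop (Σ i, (c i).1.Vertex)) := (node m c).2
  have htop : ⊤ ∈ E := hm
  exact ((IsForest.sigma h).congr (sigmaSubtypeIso (WithTop.some ⁻¹' E))).withTop.congr
    (withTopPreimageCoeIso htop)

theorem isForest_node_of_not_marked {d : ℕ} {m : Prop} (hm : ¬ m) {c : Fin d → MarkedTree}
    {F : Fin d → Multiset TreeClass} (h : ∀ i, IsForest ((c i).2 : Set _) (F i)) :
    IsForest ((node m c).2 : Set _) (∑ i, F i) := by
  let E : Set (WithTop (Σ i, (c i).1.Vertex)) := (node m c).2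
  have htop : ⊤ ∉ E := hm
  exact ((IsForest.sigma h).congr (sigmaSubtypeIso (WithTop.some ⁻¹' E))).congr
    (preimageCoeIso htop)

theorem exists_isForest (x : MarkedTree) : ∃ F, IsForest (x.2 : Set _) F := by
  induction x using MarkedTree.induction with
  | h d m c ih =>
    choose F hF using ih
    by_cases hm : m
    · exact ⟨_, isForest_node_of_marked hm hF⟩
    · exact ⟨_, isForest_node_of_not_marked hm hF⟩

/-- The multiset of trees formed by the marked vertices. -/
noncomputable def forest (x : MarkedTree) : Multiset TreeClass := (exists_isForest x).choose

theorem isForest_forest (x : MarkedTree) : IsForest (x.2 : Set _) x.forest :=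
  (exists_isForest x).choose_spec

open Classical in
theorem forest_node {d : ℕ} (m : Prop) (c : Fin d → MarkedTree) :
    (node m c).forest = if m then {mk (∑ i, (c i).forest)} else ∑ i, (c i).forest := by
  apply (isForest_forest _).unique
  split_ifs with hm
  · exact isForest_node_of_marked hm fun i => isForest_forest _
  · exact isForest_node_of_not_marked hm fun i => isForest_forest _

theorem Iso.forest_eq {x y : MarkedTree} (h : x.Iso y) : x.forest = y.forest := by
  obtain ⟨f, hf⟩ := h
  refine ((isForest_forest x).congr ?_).unique (isForest_forest y)
  exact
    { toEquiv := f.toEquiv.subtypeEquiv hf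
      map_rel_iff' := fun {a b} => f.le_iff_le (x := a.1) (y := b.1) }

theorem Iso.root_mem_iff {x y : MarkedTree} (h : x.Iso y) : x.1.root ∈ x.2 ↔ y.1.root ∈ y.2 := by
  obtain ⟨f, hf⟩ := h
  rw [hf, map_root]

theorem node_pair_iso_iff {m m' : Prop} {x y x' y' : MarkedTree} :
    (node m ![x, y]).Iso (node m' ![x', y']) ↔
      (m ↔ m') ∧ (x.Iso x' ∧ y.Iso y' ∨ x.Iso y' ∧ y.Iso x') := by
  have perm_eq (σ : Equiv.Perm (Fin 2)) : σ = Equiv.refl _ ∨ σ = Equiv.swap 0 1 := by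
    decide +revert
  rw [node_iso_iff]
  refine and_congr_right fun _ => ⟨?_, ?_⟩
  · rintro ⟨σ, h⟩
    obtain rfl | rfl := perm_eq σ
    · exact Or.inl ⟨h 0, h 1⟩
    · exact Or.inr ⟨h 0, h 1⟩
  · rintro (⟨h₀, h₁⟩ | ⟨h₀, h₁⟩)
    · exact ⟨Equiv.refl _, Fin.forall_fin_two.2 ⟨h₀, h₁⟩⟩
    · exact ⟨Equiv.swap 0 1, Fin.forall_fin_two.2 ⟨h₀, h₁⟩⟩

end MarkedTree

theorem RTree.IsBinary.size_add_one {T : RTree} (h : T.IsBinary) : T.size + 1 = 2 * T.leaves := by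
  induction T with
  | node d c ih =>
    obtain ⟨rfl | rfl, hc⟩ := h
    · simp [RTree.size, RTree.leaves]
    · have hleft := ih 0 (hc 0)
      have hright := ih 1 (hc 1)
      simp only [RTree.size, RTree.leaves, Fin.sum_univ_two]
      rw [if_neg two_ne_zero]
      omega

/-- Binary trees with marked vertices. -/
abbrev BinaryMarkedTree : Type := {x : MarkedTree // x.1.IsBinary}

/-- The isomorphism relation on binary trees with marked vertices. -/
def binaryMarkedSetoid : Setoid BinaryMarkedTree :=
  ⟨fun x y => x.1.Iso y.1, fun x => .refl x.1, .symm, .trans⟩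

/-- Non-plane binary trees with marked vertices. Pairs of a binary tree `T ∈ 𝒱ₙ` and an embedding
of `S` into `T` correspond to the marked trees whose marked vertices form a copy of `S`. -/
def MarkedClass : Type := Quotient binaryMarkedSetoid

namespace MarkedClass

open TreeClass

/-- The isomorphism class of a binary tree with marked vertices. -/
def of (x : BinaryMarkedTree) : MarkedClass := Quotient.mk binaryMarkedSetoid x

theorem of_eq_iff {x y : BinaryMarkedTree} : of x = of y ↔ x.1.Iso y.1 :=
  Quotient.eq (r := binaryMarkedSetoid)

theorem exists_eq_of (q : MarkedClass) : ∃ x, q = of x := by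
  obtain ⟨x, rfl⟩ := Quotient.exists_rep q
  exact ⟨x, rfl⟩

/-- The number of vertices. -/
def size : MarkedClass → ℕ :=
  Quotient.lift (fun x => x.1.1.size) fun _ _ ⟨f, _⟩ => RTree.Iso.size_eq ⟨f⟩

/-- The number of leaves. -/
def leaves : MarkedClass → ℕ :=
  Quotient.lift (fun x => x.1.1.leaves) fun _ _ ⟨f, _⟩ => RTree.Iso.leaves_eq ⟨f⟩

/-- The multiset of trees formed by the marked vertices. -/
noncomputable def forest : MarkedClass → Multiset TreeClass :=
  Quotient.lift (fun x => x.1.forest) fun _ _ h => MarkedTree.Iso.forest_eq h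

/-- The root is marked. -/
def IsGood : MarkedClass → Prop :=
  Quotient.lift (fun x => x.1.1.root ∈ x.1.2) fun _ _ h =>
    propext (MarkedTree.Iso.root_mem_iff h)

/-- The single vertex, which is marked iff `m`. -/
def leaf (m : Prop) : MarkedClass :=
  of ⟨MarkedTree.node (d := 0) m Fin.elim0, Or.inl rfl, fun i => i.elim0⟩

/-- The binary tree with two given subtrees at the root, which is marked iff `m`. -/
def pair (m : Prop) (x y : BinaryMarkedTree) : BinaryMarkedTree :=
  ⟨MarkedTree.node m ![x.1, y.1], Or.inr rfl, Fin.forall_fin_two.2 ⟨x.2, y.2⟩⟩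

theorem of_pair_eq_iff {m m' : Prop} {x y x' y' : BinaryMarkedTree} :
    of (pair m x y) = of (pair m' x' y') ↔
      m = m' ∧ (of x = of x' ∧ of y = of y' ∨ of x = of y' ∧ of y = of x') := by
  simp only [of_eq_iff, pair, MarkedTree.node_pair_iso_iff, eq_iff_iff]

/-- The non-plane tree with a given unordered pair of subtrees at the root, which is marked
iff `m`. -/
def node (m : Prop) : Sym2 MarkedClass → MarkedClass :=
  Sym2.lift ⟨Quotient.lift₂ (fun x y => of (pair m x y)) fun _ _ _ _ h h' =>
      of_pair_eq_iff.2 ⟨rfl, Or.inl ⟨of_eq_iff.2 h, of_eq_iff.2 h'⟩⟩, fun a b => by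
    obtain ⟨x, rfl⟩ := a.exists_eq_of
    obtain ⟨y, rfl⟩ := b.exists_eq_of
    exact of_pair_eq_iff.2 ⟨rfl, Or.inr ⟨rfl, rfl⟩⟩⟩

theorem node_of_of (m : Prop) (x y : BinaryMarkedTree) :
    node m s(of x, of y) = of (pair m x y) := rfl

theorem node_eq_node_iff {m m' : Prop} {p p' : Sym2 MarkedClass} :
    node m p = node m' p' ↔ m = m' ∧ p = p' := by
  induction p with | _ a b
  induction p' with | _ a' b'
  obtain ⟨x, rfl⟩ := a.exists_eq_of
  obtain ⟨y, rfl⟩ := b.exists_eq_of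
  obtain ⟨x', rfl⟩ := a'.exists_eq_of
  obtain ⟨y', rfl⟩ := b'.exists_eq_of
  rw [node_of_of, node_of_of, of_pair_eq_iff, Sym2.eq_iff]

theorem eq_leaf_or_eq_node (q : MarkedClass) : (∃ m, q = leaf m) ∨ ∃ m p, q = node m p := by
  obtain ⟨⟨x, hx⟩, rfl⟩ := q.exists_eq_of
  induction x using MarkedTree.induction with
  | h d m c _ =>
    obtain ⟨rfl | rfl, hc⟩ := hx
    · refine Or.inl ⟨m, of_eq_iff.2 ?_⟩
      exact MarkedTree.node_iso_iff.2 ⟨Iff.rfl, Equiv.refl _, fun i => i.elim0⟩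
    · refine Or.inr ⟨m, s(of ⟨c 0, hc 0⟩, of ⟨c 1, hc 1⟩), of_eq_iff.2 ?_⟩
      exact MarkedTree.node_iso_iff.2
        ⟨Iff.rfl, Equiv.refl _, Fin.forall_fin_two.2 ⟨.refl _, .refl _⟩⟩

theorem leaf_ne_node (m m' : Prop) (p : Sym2 MarkedClass) : leaf m ≠ node m' p := by
  induction p with | _ a b
  obtain ⟨x, rfl⟩ := a.exists_eq_of
  obtain ⟨y, rfl⟩ := b.exists_eq_of
  intro h
  obtain ⟨-, σ, -⟩ := MarkedTree.node_iso_iff.1 (of_eq_iff.1 h)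
  exact (σ.symm 0).elim0

open Classical in
theorem forest_leaf (m : Prop) : (leaf m).forest = if m then {mk 0} else 0 := by
  change MarkedTree.forest _ = _
  rw [MarkedTree.forest_node, Fin.sum_univ_zero]

open Classical in
theorem forest_node (m : Prop) (a b : MarkedClass) :
    (node m s(a, b)).forest = if m then {mk (a.forest + b.forest)} else a.forest + b.forest := by
  obtain ⟨x, rfl⟩ := a.exists_eq_of
  obtain ⟨y, rfl⟩ := b.exists_eq_of
  change MarkedTree.forest _ = _
  rw [pair, MarkedTree.forest_node]
  simp only [Fin.sum_univ_two]
  rfl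

theorem isGood_leaf (m : Prop) : (leaf m).IsGood ↔ m := Iff.rfl

theorem isGood_node (m : Prop) (p : Sym2 MarkedClass) : (node m p).IsGood ↔ m := by
  induction p with | _ a b
  obtain ⟨x, rfl⟩ := a.exists_eq_of
  obtain ⟨y, rfl⟩ := b.exists_eq_of
  exact Iff.rfl

theorem leaves_leaf (m : Prop) : (leaf m).leaves = 1 := rfl

theorem leaves_node (m : Prop) (a b : MarkedClass) :
    (node m s(a, b)).leaves = a.leaves + b.leaves := by
  obtain ⟨x, rfl⟩ := a.exists_eq_of
  obtain ⟨y, rfl⟩ := b.exists_eq_of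
  change RTree.leaves _ = RTree.leaves _ + RTree.leaves _
  simp only [pair, MarkedTree.node, RTree.leaves, Fin.sum_univ_two]
  rfl

theorem size_add_one (q : MarkedClass) : q.size + 1 = 2 * q.leaves := by
  obtain ⟨x, rfl⟩ := q.exists_eq_of
  exact x.2.size_add_one

theorem finite_leaves_eq (k : ℕ) : {q : MarkedClass | q.leaves = k}.Finite := by
  have finite_marked : {x : MarkedTree | x.1.size ≤ 2 * k}.Finite := by
    have finite_fiber (T : RTree) : (Set.range fun E => (⟨T, E⟩ : MarkedTree)).Finite := by
      have := T.finite_vertex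
      exact Set.finite_range _
    refine ((RTree.finite_size_le (2 * k)).biUnion fun T _ => finite_fiber T).subset ?_
    rintro ⟨T, E⟩ hT
    exact Set.mem_biUnion hT ⟨E, rfl⟩
  refine ((finite_marked.preimage Subtype.val_injective.injOn).image of).subset ?_
  intro q hq
  have hsize : q.size ≤ 2 * k := by
    have hq' : q.leaves = k := hq
    have := q.size_add_one
    omega
  obtain ⟨x, rfl⟩ := q.exists_eq_of
  exact ⟨x, hsize, rfl⟩

end MarkedClass
/-! ### Generating functions of binary trees with marked vertices -/

namespace MarkedClass

open TreeClass PowerSeries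
open Finset.HasAntidiagonal (antidiagonal)

/-- The number of leaves together with the forest of marked vertices; it is additive over the
subtrees of an unmarked root. -/
noncomputable def deg (q : MarkedClass) : ℕ × Multiset TreeClass := (q.leaves, q.forest)

open Classical in
theorem deg_leaf (m : Prop) : (leaf m).deg = (1, if m then {mk 0} else 0) := by
  rw [deg, leaves_leaf, forest_leaf]

open Classical in
theorem deg_node (m : Prop) (p : Sym2 MarkedClass) :
    (node m p).deg =
      ((p.map deg).add.1, if m then {mk (p.map deg).add.2} else (p.map deg).add.2) := by
  induction p with | _ a b
  rw [deg, leaves_node, forest_node, Sym2.map_mk, Sym2.add_mk]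
  rfl

theorem finite_deg_eq (γ : ℕ × Multiset TreeClass) : {q : MarkedClass | q.deg = γ}.Finite :=
  (finite_leaves_eq γ.1).subset fun _ h => congrArg Prod.fst h

/-- The generating function, by the number of leaves, of the binary trees whose marked vertices
form `F`. -/
noncomputable def allSeries (F : Multiset TreeClass) : ℝ⟦X⟧ :=
  PowerSeries.mk fun k => ({q : MarkedClass | q.deg = (k, F)}.ncard : ℝ)

/-- The generating function, by the number of leaves, of the binary trees with marked root whose
marked vertices form the tree `S`. -/
noncomputable def goodSeries (S : TreeClass) : ℝ⟦X⟧ :=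
  PowerSeries.mk fun k => ({q : MarkedClass | q.deg = (k, {S}) ∧ q.IsGood}.ncard : ℝ)

/-- The generating function, by the total number of leaves, of the unordered pairs of binary trees
whose marked vertices together form `F`. -/
noncomputable def pairSeries (F : Multiset TreeClass) : ℝ⟦X⟧ :=
  PowerSeries.mk fun k => ({p : Sym2 MarkedClass | (p.map deg).add = (k, F)}.ncard : ℝ)

/-- The part of `pairSeries F` that comes from pairs of equal trees. -/
noncomputable def doubleSeries (F : Multiset TreeClass) : ℝ⟦X⟧ :=
  PowerSeries.mk fun k => ({q : MarkedClass | q.deg + q.deg = (k, F)}.ncard : ℝ)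

theorem two_mul_pairSeries (F : Multiset TreeClass) :
    2 * pairSeries F = ∑ d ∈ antidiagonal F, allSeries d.1 * allSeries d.2 + doubleSeries F := by
  ext k
  rw [show (2 : ℝ⟦X⟧) = C (2 : ℝ) by rw [map_ofNat], coeff_C_mul, map_add, map_sum]
  simp only [pairSeries, allSeries, doubleSeries, coeff_mk, coeff_mul]
  rw [← Nat.cast_two, ← Nat.cast_mul, two_mul_ncard_sym2_deg_eq finite_deg_eq, Nat.cast_add]
  congr 1
  change ((∑ d ∈ ((antidiagonal k ×ˢ antidiagonal F).map _), _ : ℕ) : ℝ) = _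
  rw [Finset.sum_map, Finset.sum_product_right]
  push_cast
  rfl

theorem doubleSeries_add_self (H : Multiset TreeClass) :
    doubleSeries (H + H) = expand 2 two_ne_zero (allSeries H) := by
  have add_self_inj (G : Multiset TreeClass) : G + G = H + H ↔ G = H := by
    rw [← two_nsmul, ← two_nsmul, nsmul_right_inj two_ne_zero]
  ext k
  rw [coeff_expand, doubleSeries, coeff_mk, allSeries]
  split_ifs with hk
  · obtain ⟨j, rfl⟩ := hk
    rw [coeff_mk, Nat.mul_div_cancel_left j two_pos]
    congr 2
    ext q
    simp only [deg, Prod.mk_add_mk, Prod.mk.injEq, add_self_inj, Set.mem_ofPred_eq]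
    exact and_congr_left fun _ => by omega
  · have hempty : {q : MarkedClass | q.deg + q.deg = (k, H + H)} = ∅ := by
      refine Set.eq_empty_iff_forall_notMem.2 fun q hq => hk ⟨q.leaves, ?_⟩
      have hleaves : q.leaves + q.leaves = k := congrArg Prod.fst hq
      omega
    rw [hempty, Set.ncard_empty, Nat.cast_zero]

theorem doubleSeries_eq_zero {F : Multiset TreeClass} (hF : ∀ H, F ≠ H + H) :
    doubleSeries F = 0 := by
  ext k
  have hempty : {q : MarkedClass | q.deg + q.deg = (k, F)} = ∅ :=
    Set.eq_empty_iff_forall_notMem.2 fun q hq => hF q.forest (congrArg Prod.snd hq).symm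
  rw [doubleSeries, coeff_mk, hempty, Set.ncard_empty, Nat.cast_zero, map_zero]

theorem leaf_injective : Function.Injective leaf := fun m m' h =>
  propext (by rw [← isGood_leaf m, h, isGood_leaf])

theorem finite_pair_deg_eq (γ : ℕ × Multiset TreeClass) :
    {p : Sym2 MarkedClass | (p.map deg).add = γ}.Finite :=
  finite_sym2_deg_eq finite_deg_eq γ

open Classical in
theorem ncard_eq_of_leaf_node {Q : Set MarkedClass} {m : Prop} {k : ℕ} {F : Multiset TreeClass}
    (hleaf : ∀ m', leaf m' ∈ Q ↔ m' = m ∧ k = 1 ∧ F = 0)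
    (hnode : ∀ m' p, node m' p ∈ Q ↔ m' = m ∧ (p.map deg).add = (k, F)) :
    Q.ncard = (if k = 1 ∧ F = 0 then 1 else 0) +
      {p : Sym2 MarkedClass | (p.map deg).add = (k, F)}.ncard := by
  have hQ : Q = (if k = 1 ∧ F = 0 then {leaf m} else ∅) ∪
      node m '' {p | (p.map deg).add = (k, F)} := by
    ext q
    obtain ⟨m', rfl⟩ | ⟨m', p, rfl⟩ := q.eq_leaf_or_eq_node
    · have hne (p : Sym2 MarkedClass) : node m p ≠ leaf m' := (leaf_ne_node m' m p).symm
      split_ifs with h <;> simp [hleaf, h, hne, leaf_injective.eq_iff]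
    · have hne : node m' p ≠ leaf m := (leaf_ne_node m m' p).symm
      have hmem : node m' p ∈ node m '' {p | (p.map deg).add = (k, F)} ↔ node m' p ∈ Q := by
        simp only [Set.mem_image, Set.mem_ofPred_eq, node_eq_node_iff, hnode]
        grind
      rw [← hmem]
      split_ifs <;> simp [hne]
  rw [hQ, Set.ncard_union_eq ?_ (by split_ifs <;> simp) ((finite_pair_deg_eq _).image _),
    Set.ncard_image_of_injective _ fun p p' h => (node_eq_node_iff.1 h).2]
  · congr 1
    split_ifs <;> simp
  · rw [Set.disjoint_right]
    rintro _ ⟨p, -, rfl⟩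
    split_ifs <;> simp [(leaf_ne_node m m p).symm]

open Classical in
theorem ncard_not_good (k : ℕ) (F : Multiset TreeClass) :
    {q : MarkedClass | q.deg = (k, F) ∧ ¬ q.IsGood}.ncard = (if k = 1 ∧ F = 0 then 1 else 0) +
      {p : Sym2 MarkedClass | (p.map deg).add = (k, F)}.ncard := by
  refine ncard_eq_of_leaf_node (m := False) (fun m => ?_) fun m p => ?_ <;>
    by_cases hm : m <;>
    simp [deg_leaf, deg_node, isGood_leaf, isGood_node, hm, eq_comm]

open Classical in
theorem ncard_good (k : ℕ) (F : Multiset TreeClass) :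
    {q : MarkedClass | q.deg = (k, {TreeClass.mk F}) ∧ q.IsGood}.ncard =
      (if k = 1 ∧ F = 0 then 1 else 0) +
      {p : Sym2 MarkedClass | (p.map deg).add = (k, F)}.ncard := by
  refine ncard_eq_of_leaf_node (m := True) (fun m => ?_) fun m p => ?_ <;>
    by_cases hm : m <;>
    simp [deg_leaf, deg_node, isGood_leaf, isGood_node, hm, mk_injective.eq_iff, Prod.ext_iff,
      eq_comm]

theorem exists_forest_eq_of_isGood {q : MarkedClass} (h : q.IsGood) :
    ∃ F, q.forest = {TreeClass.mk F} := by
  obtain ⟨m, rfl⟩ | ⟨m, p, rfl⟩ := q.eq_leaf_or_eq_node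
  · rw [isGood_leaf] at h
    exact ⟨0, by rw [forest_leaf, if_pos h]⟩
  · rw [isGood_node] at h
    induction p with | _ a b
    exact ⟨_, by rw [forest_node, if_pos h]⟩

theorem ncard_deg_eq (γ : ℕ × Multiset TreeClass) :
    {q : MarkedClass | q.deg = γ}.ncard = {q : MarkedClass | q.deg = γ ∧ q.IsGood}.ncard +
      {q : MarkedClass | q.deg = γ ∧ ¬ q.IsGood}.ncard :=
  (Set.ncard_inter_add_ncard_sdiff_eq_ncard {q : MarkedClass | q.deg = γ} {q | q.IsGood}
    (finite_deg_eq γ)).symm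

open Classical in
theorem goodSeries_mk (F : Multiset TreeClass) :
    goodSeries (TreeClass.mk F) = (if F = 0 then X else 0) + pairSeries F := by
  ext k
  rw [goodSeries, coeff_mk, ncard_good, map_add, pairSeries, coeff_mk]
  split_ifs <;> simp_all [coeff_X]

theorem allSeries_singleton (S : TreeClass) : allSeries {S} = goodSeries S + pairSeries {S} := by
  ext k
  rw [allSeries, coeff_mk, ncard_deg_eq, ncard_not_good, map_add, goodSeries,
    pairSeries, coeff_mk, coeff_mk]
  simp

open Classical in
theorem allSeries_of_card_ne_one {F : Multiset TreeClass} (hF : F.card ≠ 1) :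
    allSeries F = (if F = 0 then X else 0) + pairSeries F := by
  have no_good (k : ℕ) : {q : MarkedClass | q.deg = (k, F) ∧ q.IsGood} = ∅ := by
    rw [Set.eq_empty_iff_forall_notMem]
    rintro q ⟨hdeg, hq⟩
    obtain ⟨G, hG⟩ := exists_forest_eq_of_isGood hq
    have hforest : q.forest = F := congrArg Prod.snd hdeg
    rw [← hforest, hG] at hF
    exact hF (Multiset.card_singleton _)
  ext k
  rw [allSeries, coeff_mk, ncard_deg_eq, no_good, ncard_not_good, map_add, pairSeries, coeff_mk]
  split_ifs <;> simp_all [coeff_X]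

end MarkedClass

/-! ### Embeddings into binary trees -/

namespace RTree

open MarkedClass

/-- The class of the binary tree `T` whose marked vertices are those of an embedding into `T`. -/
def Embedding.toMarkedClass {S T : RTree} (hT : T.IsBinary) : Embedding S T → MarkedClass :=
  Quotient.lift (fun E => of ⟨⟨T, E.1⟩, hT⟩) fun E F ⟨f, hf⟩ => of_eq_iff.2
    ⟨f, fun v => by rw [← hf, f.injective.mem_set_image]⟩

theorem Embedding.toMarkedClass_injective {S T : RTree} (hT : T.IsBinary) :
    Function.Injective (Embedding.toMarkedClass (S := S) hT) := by
  intro e e' h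
  induction e using Quotient.inductionOn with | h E
  induction e' using Quotient.inductionOn with | h E'
  obtain ⟨f, hf⟩ := of_eq_iff.1 h
  refine Quotient.sound ⟨f, ?_⟩
  ext v
  obtain ⟨w, rfl⟩ := f.surjective v
  rw [f.injective.mem_set_image]
  exact hf w

theorem Embedding.iso_of_toMarkedClass_eq {S T T' : RTree} {hT : T.IsBinary} {hT' : T'.IsBinary}
    {e : Embedding S T} {e' : Embedding S T'} (h : e.toMarkedClass hT = e'.toMarkedClass hT') :
    T.Iso T' := by
  induction e using Quotient.inductionOn with | h E
  induction e' using Quotient.inductionOn with | h E'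
  obtain ⟨f, -⟩ := of_eq_iff.1 h
  exact ⟨f⟩

theorem Embedding.size_toMarkedClass {S T : RTree} (hT : T.IsBinary) (e : Embedding S T) :
    (e.toMarkedClass hT).size = T.size := by
  induction e using Quotient.inductionOn with | h E
  rfl

theorem Embedding.isGood_toMarkedClass {S T : RTree} (hT : T.IsBinary) (e : Embedding S T) :
    (e.toMarkedClass hT).IsGood ↔ e.IsGood := by
  induction e using Quotient.inductionOn with | h E
  exact Iff.rfl

theorem Embedding.forest_toMarkedClass {S T : RTree} (hT : T.IsBinary) (e : Embedding S T) :
    (e.toMarkedClass hT).forest = {S.cls} := by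
  induction e using Quotient.inductionOn with | h E
  exact (MarkedTree.isForest_forest ⟨T, E.1⟩).unique ((IsForest.singleton_iff S).2 E.2)

theorem Embedding.exists_toMarkedClass_eq {S T T' : RTree} (hT : T.IsBinary) (hT' : T'.IsBinary)
    (hTT' : T'.Iso T) {E : Set T.Vertex} (hE : (of ⟨⟨T, E⟩, hT⟩).forest = {S.cls}) :
    ∃ e : Embedding S T', e.toMarkedClass hT' = of ⟨⟨T, E⟩, hT⟩ := by
  obtain ⟨f⟩ := hTT'
  have copy : Nonempty (S.Vertex ≃o E) := by
    rw [← IsForest.singleton_iff, ← hE]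
    exact MarkedTree.isForest_forest ⟨T, E⟩
  refine ⟨Quotient.mk (copySetoid _ _) (copyCongr S f.symm ⟨E, copy⟩), of_eq_iff.2 ⟨f, fun v => ?_⟩⟩
  change v ∈ f.symm '' E ↔ f v ∈ E
  obtain ⟨w, rfl⟩ := f.symm.surjective v
  rw [f.symm.injective.mem_set_image, f.apply_symm_apply]

instance finite_embedding (S T : RTree) : Finite (Embedding S T) := by
  have := finite_vertex T
  have : Finite (Copy S T) := Subtype.finite
  exact Quotient.finite _

/-- A representative of a non-plane binary tree. -/
noncomputable def NonPlaneBinary.out {n : ℕ} (T : NonPlaneBinary n) :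
    {T : RTree // T.IsBinary ∧ T.size = n} :=
  Quotient.out (s := binarySetoid n) T

theorem NonPlaneBinary.mk_out {n : ℕ} (T : NonPlaneBinary n) :
    Quotient.mk (binarySetoid n) T.out = T := Quotient.out_eq (s := binarySetoid n) T

theorem sum_card_embedding (n : ℕ) (S : RTree) (p : MarkedClass → Prop) :
    ∑ T : NonPlaneBinary n,
        Nat.card {e : Embedding S T.out.1 // p (e.toMarkedClass T.out.2.1)} =
      {q : MarkedClass | (q.size = n ∧ q.forest = {S.cls}) ∧ p q}.ncard := by
  have (T : NonPlaneBinary n) :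
      Finite {e : Embedding S T.out.1 // p (e.toMarkedClass T.out.2.1)} := Subtype.finite
  rw [← Nat.card_sigma, ← Nat.card_coe_set_eq]
  refine Nat.card_eq_of_bijective
    (fun x => ⟨x.2.1.toMarkedClass x.1.out.2.1, ⟨(x.2.1.size_toMarkedClass _).trans x.1.out.2.2,
      x.2.1.forest_toMarkedClass _⟩, x.2.2⟩) ⟨?_, ?_⟩
  · rintro ⟨T, e, he⟩ ⟨T', e', he'⟩ heq
    have hclass : e.toMarkedClass T.out.2.1 = e'.toMarkedClass T'.out.2.1 :=
      congrArg Subtype.val heq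
    obtain rfl : T = T' := by
      rw [← T.mk_out, ← T'.mk_out]
      exact Quotient.sound (s := binarySetoid n) (Embedding.iso_of_toMarkedClass_eq hclass)
    obtain rfl := Embedding.toMarkedClass_injective _ hclass
    rfl
  · rintro ⟨q, ⟨hsize, hforest⟩, hp⟩
    obtain ⟨⟨⟨T, E⟩, hT⟩, rfl⟩ := q.exists_eq_of
    let T' : NonPlaneBinary n := Quotient.mk (binarySetoid n) ⟨T, hT, hsize⟩
    obtain ⟨e, he⟩ := Embedding.exists_toMarkedClass_eq hT T'.out.2.1
      (Quotient.exact (s := binarySetoid n) T'.mk_out) hforest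
    exact ⟨⟨T', e, by rwa [he]⟩, Subtype.ext he⟩

theorem totalEmb_eq_ncard (n : ℕ) (S : RTree) :
    totalEmb n S = {q : MarkedClass | q.size = n ∧ q.forest = {S.cls}}.ncard := by
  have hsum := sum_card_embedding n S fun _ => True
  simp only [and_true] at hsum
  rw [totalEmb, ← hsum]
  refine Finset.sum_congr rfl fun T _ => ?_
  conv_lhs => rw [← T.mk_out]
  exact (Nat.card_congr (Equiv.subtypeUnivEquiv fun _ => trivial)).symm

theorem totalGoodEmb_eq_ncard (n : ℕ) (S : RTree) :
    totalGoodEmb n S =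
      {q : MarkedClass | (q.size = n ∧ q.forest = {S.cls}) ∧ q.IsGood}.ncard := by
  rw [totalGoodEmb, ← sum_card_embedding n S IsGood]
  refine Finset.sum_congr rfl fun T _ => ?_
  conv_lhs => rw [← T.mk_out]
  exact Nat.card_congr (Equiv.subtypeEquivRight fun e => (e.isGood_toMarkedClass T.out.2.1).symm)

theorem numBinary_eq_ncard (n : ℕ) :
    numBinary n = {q : MarkedClass | q.size = n ∧ q.forest = 0}.ncard := by
  rw [numBinary, ← Nat.card_eq_fintype_card, ← Nat.card_coe_set_eq]
  refine Nat.card_eq_of_bijective (Quotient.lift (fun T => ⟨of ⟨⟨T.1, ∅⟩, T.2.1⟩, T.2.2, ?_⟩)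
    fun T T' ⟨f⟩ => Subtype.ext (of_eq_iff.2 ⟨f, by simp⟩)) ⟨?_, ?_⟩
  · exact (MarkedTree.isForest_forest ⟨T.1, ∅⟩).unique (IsForest.zero_iff.2 (by simp))
  · intro q q' h
    induction q using Quotient.inductionOn with | h T
    induction q' using Quotient.inductionOn with | h T'
    obtain ⟨f, -⟩ := of_eq_iff.1 (congrArg Subtype.val h)
    exact Quotient.sound (s := binarySetoid n) ⟨f⟩
  · rintro ⟨q, hsize, hforest⟩
    obtain ⟨⟨⟨T, E⟩, hT⟩, rfl⟩ := q.exists_eq_of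
    have hE : IsEmpty E := by
      rw [← IsForest.zero_iff, ← hforest]
      exact MarkedTree.isForest_forest ⟨T, E⟩
    obtain rfl := Set.isEmpty_coe_sort.1 hE
    exact ⟨Quotient.mk (binarySetoid n) ⟨T, hT, hsize⟩, rfl⟩

theorem setOf_size_eq {n : ℕ} (hn : Odd n) (p : MarkedClass → Prop) :
    {q : MarkedClass | q.size = n ∧ p q} = {q | q.leaves = (n + 1) / 2 ∧ p q} := by
  ext q
  have := q.size_add_one
  obtain ⟨j, rfl⟩ := hn
  exact and_congr_left fun _ => by omega

theorem totalEmb_eq_coeff {n : ℕ} (hn : Odd n) (S : RTree) :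
    (totalEmb n S : ℝ) = (allSeries {S.cls}).coeff ((n + 1) / 2) := by
  rw [totalEmb_eq_ncard, setOf_size_eq hn, allSeries, PowerSeries.coeff_mk]
  simp only [deg, Prod.mk.injEq]

theorem totalGoodEmb_eq_coeff {n : ℕ} (hn : Odd n) (S : RTree) :
    (totalGoodEmb n S : ℝ) = (goodSeries S.cls).coeff ((n + 1) / 2) := by
  simp only [totalGoodEmb_eq_ncard, and_assoc]
  rw [setOf_size_eq hn, goodSeries, PowerSeries.coeff_mk]
  simp only [deg, Prod.mk.injEq, and_assoc]

theorem numBinary_eq_coeff {n : ℕ} (hn : Odd n) :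
    (numBinary n : ℝ) = (allSeries 0).coeff ((n + 1) / 2) := by
  rw [numBinary_eq_ncard, setOf_size_eq hn, allSeries, PowerSeries.coeff_mk]
  simp only [deg, Prod.mk.injEq]

theorem setOf_size_eq_empty {n : ℕ} (hn : Even n) (p : MarkedClass → Prop) :
    {q : MarkedClass | q.size = n ∧ p q} = ∅ := by
  refine Set.eq_empty_iff_forall_notMem.2 fun q ⟨hsize, _⟩ => ?_
  have := q.size_add_one
  obtain ⟨j, rfl⟩ := hn
  omega

theorem totalEmb_of_even {n : ℕ} (hn : Even n) (S : RTree) : totalEmb n S = 0 := by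
  rw [totalEmb_eq_ncard, setOf_size_eq_empty hn, Set.ncard_empty]

theorem totalGoodEmb_of_even {n : ℕ} (hn : Even n) (S : RTree) : totalGoodEmb n S = 0 := by
  simp only [totalGoodEmb_eq_ncard, and_assoc]
  rw [setOf_size_eq_empty hn, Set.ncard_empty]

theorem numBinary_of_even {n : ℕ} (hn : Even n) : numBinary n = 0 := by
  rw [numBinary_eq_ncard, setOf_size_eq_empty hn, Set.ncard_empty]

end RTree
/-! ### Replacements and the constant `C_S` -/

theorem exists_add_eq_of_two_le_card {α : Type*} {F : Multiset α} (hF : 2 ≤ F.card) :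
    ∃ G H, G ≠ 0 ∧ H ≠ 0 ∧ G + H = F := by
  obtain ⟨a, ha⟩ := Multiset.card_pos_iff_exists_mem.1 (by omega : 0 < F.card)
  obtain ⟨G, rfl⟩ := Multiset.exists_cons_of_mem ha
  refine ⟨{a}, G, Multiset.singleton_ne_zero a, ?_, Multiset.singleton_add a G⟩
  rintro rfl
  simp at hF

namespace TreeClass

theorem size_pos (t : TreeClass) : 0 < t.size := by
  obtain ⟨F, rfl⟩ := t.exists_eq_mk
  rw [size_mk]
  omega

theorem eq_singleton_of_card_lt_two {F : Multiset TreeClass} (hF : F ≠ 0) (hcard : F.card < 2) :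
    ∃ G, F = {mk G} := by
  have hpos := Multiset.card_pos.2 hF
  obtain ⟨t, rfl⟩ := Multiset.card_eq_one.1 (by omega : F.card = 1)
  obtain ⟨G, rfl⟩ := t.exists_eq_mk
  exact ⟨G, rfl⟩

/-- The induction removes the root of a single tree and splits a forest with several trees. -/
theorem forest_induction {p : Multiset TreeClass → Prop} (leaf : p {mk 0})
    (root : ∀ F, F ≠ 0 → p F → p {mk F})
    (split : ∀ F, 2 ≤ F.card → (∀ G H, G ≠ 0 → H ≠ 0 → G + H = F → p G) → p F)
    {F : Multiset TreeClass} (hF : F ≠ 0) : p F := by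
  induction hn : (F.map size).sum using Nat.strong_induction_on generalizing F with
  | _ n ih =>
    rcases lt_or_ge F.card 2 with hcard | hcard
    · obtain ⟨G, rfl⟩ := eq_singleton_of_card_lt_two hF hcard
      by_cases hG : G = 0
      · rwa [hG]
      · refine root G hG (ih _ ?_ hG rfl)
        rw [← hn, Multiset.map_singleton, Multiset.sum_singleton, size_mk]
        omega
    · refine split F hcard fun G H hG hH hGH => ih _ ?_ hG rfl
      obtain ⟨t, ht⟩ := Multiset.exists_mem_of_ne_zero hH
      have hle : t.size ≤ (H.map size).sum :=
        Multiset.single_le_sum (fun _ _ => Nat.zero_le _) _ (Multiset.mem_map_of_mem _ ht)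
      have hpos := t.size_pos
      rw [← hn, ← hGH, Multiset.map_add, Multiset.sum_add]
      omega

end TreeClass

namespace UBTree

open RTree TreeClass

/-- The forest obtained by contracting or deleting the auxiliary vertices, as in `Refines`, but
defined for every unary-binary tree. -/
noncomputable def forest : UBTree → Multiset TreeClass
  | leaf => {mk 0}
  | unary t => {mk (forest t)}
  | binary aux l r => bif aux then forest l + forest r else {mk (forest l + forest r)}

/-- Below every unary vertex there is a single tree; the valid trees are those that refine some
forest. -/
def Valid : UBTree → Prop
  | leaf => True
  | unary t => Valid t ∧ (forest t).card = 1
  | binary _ l r => Valid l ∧ Valid r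

theorem Iso.forest_eq {s t : UBTree} (h : Iso s t) : s.forest = t.forest := by
  induction h with
  | leaf => rfl
  | unary _ ih => simp only [forest, ih]
  | binary _ _ ihl ihr => simp only [forest, ihl, ihr]
  | swap _ _ ihl ihr => simp only [forest, ihl, ihr, add_comm]

theorem Iso.valid_iff {s t : UBTree} (h : Iso s t) : s.Valid ↔ t.Valid := by
  induction h with
  | leaf => rfl
  | unary h ih => simp only [Valid, ih, h.forest_eq]
  | binary _ _ ihl ihr => simp only [Valid, ihl, ihr]
  | swap _ _ ihl ihr => simp only [Valid, ihl, ihr, and_comm]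

theorem Refines.forest_eq {t : UBTree} {F : List RTree} (h : Refines t F) :
    t.forest = (F.map cls : Multiset TreeClass) := by
  induction h with
  | leaf => simp [forest, cls_ofList]
  | unary _ ih => simp [forest, cls_ofList, ih]
  | binary _ _ ihl ihr => simp [forest, cls_ofList, ihl, ihr]
  | aux _ _ ihl ihr => simp [forest, ihl, ihr]

theorem Refines.valid {t : UBTree} {F : List RTree} (h : Refines t F) : t.Valid := by
  induction h with
  | leaf => trivial
  | unary h ih => exact ⟨ih, by simp [h.forest_eq]⟩
  | binary _ _ ihl ihr => exact ⟨ihl, ihr⟩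
  | aux _ _ ihl ihr => exact ⟨ihl, ihr⟩

theorem Refines.exists_eq_singleton {t : UBTree} {F : List RTree} (h : Refines t F)
    (hcard : t.forest.card = 1) : ∃ S, F = [S] := by
  rwa [h.forest_eq, Multiset.coe_card, List.length_map, List.length_eq_one_iff] at hcard

theorem Valid.exists_refines {t : UBTree} (h : t.Valid) : ∃ F, Refines t F := by
  induction t with
  | leaf => exact ⟨_, .leaf⟩
  | unary t ih =>
    obtain ⟨F, hF⟩ := ih h.1
    obtain ⟨S, rfl⟩ := hF.exists_eq_singleton h.2
    exact ⟨_, .unary hF⟩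
  | binary aux l r ihl ihr =>
    obtain ⟨F, hF⟩ := ihl h.1
    obtain ⟨G, hG⟩ := ihr h.2
    cases aux
    · exact ⟨_, .binary hF hG⟩
    · exact ⟨_, .aux hF hG⟩

theorem isReplacement_iff {S : RTree} {t : UBTree} :
    IsReplacement S t ↔ t.Valid ∧ t.forest = {S.cls} := by
  constructor
  · rintro ⟨S', hS, h⟩
    refine ⟨h.valid, ?_⟩
    rw [h.forest_eq, List.map_singleton, Multiset.coe_singleton, cls_eq_iff.2 hS]
  · rintro ⟨h, hS⟩
    obtain ⟨F, hF⟩ := h.exists_refines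
    obtain ⟨S', rfl⟩ := hF.exists_eq_singleton (by rw [hS, Multiset.card_singleton])
    rw [hF.forest_eq, List.map_singleton, Multiset.coe_singleton, Multiset.singleton_inj,
      cls_eq_iff] at hS
    exact ⟨S', hS, hF⟩

theorem size_add_one_le (t : UBTree) : t.size + 1 ≤ 2 * (t.forest.map TreeClass.size).sum := by
  induction t with
  | leaf => simp [size, forest, size_mk]
  | unary t ih =>
    simp only [size, forest, size_mk, Multiset.map_singleton, Multiset.sum_singleton]
    omega
  | binary aux l r ihl ihr =>
    cases aux <;> simp only [size, forest, size_mk, cond_true, cond_false, Multiset.map_singleton,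
      Multiset.sum_singleton, Multiset.map_add, Multiset.sum_add] <;> omega

theorem forest_ne_zero (t : UBTree) : t.forest ≠ 0 := by
  intro h
  have hsize := t.size_add_one_le
  simp [h] at hsize

theorem two_le_card_forest_add (l r : UBTree) : 2 ≤ (l.forest + r.forest).card := by
  have hl := Multiset.card_pos.2 l.forest_ne_zero
  have hr := Multiset.card_pos.2 r.forest_ne_zero
  rw [Multiset.card_add]
  omega

theorem eq_of_forest_eq_singleton {t : UBTree} {F : Multiset TreeClass} (h : t.forest = {mk F}) :
    (F = 0 ∧ t = leaf) ∨ (∃ s, s.forest = F ∧ t = unary s) ∨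
      ∃ l r, l.forest + r.forest = F ∧ t = binary false l r := by
  rcases t with _ | s | ⟨_ | _, l, r⟩
  · exact Or.inl ⟨(mk_injective (Multiset.singleton_inj.1 h)).symm, rfl⟩
  · exact Or.inr (Or.inl ⟨s, mk_injective (Multiset.singleton_inj.1 h), rfl⟩)
  · exact Or.inr (Or.inr ⟨l, r, mk_injective (Multiset.singleton_inj.1 h), rfl⟩)
  · change l.forest + r.forest = _ at h
    have hcard := two_le_card_forest_add l r
    rw [h, Multiset.card_singleton] at hcard
    omega

theorem eq_of_two_le_card_forest {t : UBTree} (h : 2 ≤ t.forest.card) :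
    ∃ l r, t = binary true l r := by
  rcases t with _ | s | ⟨_ | _, l, r⟩
  · simp [forest] at h
  · simp [forest] at h
  · simp [forest] at h
  · exact ⟨l, r, rfl⟩

/-- Isomorphism of unary-binary trees with auxiliary vertices. -/
def isoSetoid : Setoid UBTree := ⟨Iso, Iso.refl, Iso.symm, Iso.trans⟩

end UBTree

/-- Isomorphism classes of unary-binary trees with auxiliary vertices. -/
def UBClass : Type := Quotient UBTree.isoSetoid

namespace UBClass

open TreeClass
open Finset.HasAntidiagonal (antidiagonal)

/-- The isomorphism class of a unary-binary tree. -/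
def of (t : UBTree) : UBClass := Quotient.mk UBTree.isoSetoid t

theorem of_eq_iff {s t : UBTree} : of s = of t ↔ s.Iso t := Quotient.eq (r := UBTree.isoSetoid)

theorem exists_eq_of (q : UBClass) : ∃ t, q = of t := by
  obtain ⟨t, rfl⟩ := Quotient.exists_rep q
  exact ⟨t, rfl⟩

/-- The forest obtained by contracting or deleting the auxiliary vertices. -/
noncomputable def forest : UBClass → Multiset TreeClass :=
  Quotient.lift UBTree.forest fun _ _ h => UBTree.Iso.forest_eq h

open Classical in
/-- The weight `(1/2) ^ s` of a class with `s` symmetry vertices; it is zero for the trees that do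
not refine any forest. -/
noncomputable def weight : UBClass → ℝ :=
  Quotient.lift (fun t => if t.Valid then (1 / 2 : ℝ) ^ t.sym else 0) fun s t h => by
    simp only [UBTree.Iso.valid_iff h, UBTree.sym_congr h]

theorem weight_of_valid {t : UBTree} (h : t.Valid) : (of t).weight = (1 / 2 : ℝ) ^ t.sym :=
  if_pos h

theorem weight_of_not_valid {t : UBTree} (h : ¬ t.Valid) : (of t).weight = 0 := if_neg h

theorem weight_nonneg (q : UBClass) : 0 ≤ q.weight := by
  obtain ⟨t, rfl⟩ := q.exists_eq_of
  by_cases h : t.Valid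
  · rw [weight_of_valid h]
    positivity
  · rw [weight_of_not_valid h]

theorem finite_forest_eq (F : Multiset TreeClass) : {q : UBClass | q.forest = F}.Finite := by
  refine ((UBTree.finite_size_le (2 * (F.map TreeClass.size).sum)).image of).subset ?_
  rintro q rfl
  obtain ⟨t, rfl⟩ := q.exists_eq_of
  exact ⟨t, (Nat.le_succ _).trans t.size_add_one_le, rfl⟩

/-- The class of a tree whose root has a single child. -/
def unary : UBClass → UBClass :=
  Quotient.lift (fun t => of (.unary t)) fun _ _ h => of_eq_iff.2 (.unary h)

theorem unary_injective : Function.Injective unary := by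
  intro q q' h
  obtain ⟨t, rfl⟩ := q.exists_eq_of
  obtain ⟨t', rfl⟩ := q'.exists_eq_of
  rcases of_eq_iff.1 h with _ | h
  exact of_eq_iff.2 h

theorem forest_unary (q : UBClass) : (unary q).forest = {mk q.forest} := by
  obtain ⟨t, rfl⟩ := q.exists_eq_of
  rfl

theorem weight_unary {q : UBClass} (hq : q.forest.card = 1) : (unary q).weight = q.weight := by
  obtain ⟨t, rfl⟩ := q.exists_eq_of
  change (of (.unary t)).weight = _
  by_cases h : t.Valid
  · rw [weight_of_valid h, weight_of_valid (t := .unary t) ⟨h, hq⟩]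
    rfl
  · rw [weight_of_not_valid h, weight_of_not_valid (t := .unary t) fun h' => h h'.1]

theorem weight_unary_eq_zero {q : UBClass} (hq : q.forest.card ≠ 1) : (unary q).weight = 0 := by
  obtain ⟨t, rfl⟩ := q.exists_eq_of
  exact weight_of_not_valid (t := .unary t) fun h => hq h.2

/-- The class of a tree whose root has an unordered pair of subtrees. -/
def binary (aux : Bool) : Sym2 UBClass → UBClass :=
  Sym2.lift ⟨Quotient.lift₂ (fun l r => of (.binary aux l r)) fun _ _ _ _ h h' =>
    of_eq_iff.2 (.binary h h'), fun a b => by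
      obtain ⟨l, rfl⟩ := a.exists_eq_of
      obtain ⟨r, rfl⟩ := b.exists_eq_of
      exact of_eq_iff.2 (.swap (.refl _) (.refl _))⟩

theorem binary_mk (aux : Bool) (l r : UBTree) :
    binary aux s(of l, of r) = of (.binary aux l r) := rfl

theorem binary_injective (aux : Bool) : Function.Injective (binary aux) := by
  intro p p' h
  induction p with | _ a b
  induction p' with | _ a' b'
  obtain ⟨l, rfl⟩ := a.exists_eq_of
  obtain ⟨r, rfl⟩ := b.exists_eq_of
  obtain ⟨l', rfl⟩ := a'.exists_eq_of
  obtain ⟨r', rfl⟩ := b'.exists_eq_of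
  rw [binary_mk, binary_mk, of_eq_iff] at h
  rw [Sym2.eq_iff]
  cases h with
  | binary h h' => exact Or.inl ⟨of_eq_iff.2 h, of_eq_iff.2 h'⟩
  | swap h h' => exact Or.inr ⟨of_eq_iff.2 h, of_eq_iff.2 h'⟩

open Classical in
theorem weight_binary (aux : Bool) (p : Sym2 UBClass) :
    weight (binary aux p) = (p.map weight).mul * (if p.IsDiag then 1 else 2) / 2 := by
  induction p with | _ a b
  obtain ⟨l, rfl⟩ := a.exists_eq_of
  obtain ⟨r, rfl⟩ := b.exists_eq_of
  rw [binary_mk]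
  simp only [Sym2.mk_isDiag_iff, of_eq_iff, Sym2.map_mk, Sym2.mul_mk]
  by_cases h : l.Valid ∧ r.Valid
  · rw [weight_of_valid h.1, weight_of_valid h.2, weight_of_valid (t := .binary aux l r) h]
    simp only [UBTree.sym]
    split_ifs <;> ring
  · rw [weight_of_not_valid (t := .binary aux l r) h]
    rcases not_and_or.1 h with h | h <;> simp [weight_of_not_valid h]

theorem forest_binary_true (p : Sym2 UBClass) : (binary true p).forest = (p.map forest).add := by
  induction p with | _ a b
  obtain ⟨l, rfl⟩ := a.exists_eq_of
  obtain ⟨r, rfl⟩ := b.exists_eq_of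
  rfl

theorem forest_binary_false (p : Sym2 UBClass) :
    (binary false p).forest = {mk (p.map forest).add} := by
  induction p with | _ a b
  obtain ⟨l, rfl⟩ := a.exists_eq_of
  obtain ⟨r, rfl⟩ := b.exists_eq_of
  rfl

/-- The sum of the weights of the unary-binary trees that refine the forest `F`. -/
noncomputable def constant (F : Multiset TreeClass) : ℝ :=
  ∑ q ∈ (finite_forest_eq F).toFinset, q.weight

theorem constant_nonneg (F : Multiset TreeClass) : 0 ≤ constant F :=
  Finset.sum_nonneg fun q _ => q.weight_nonneg

theorem constant_zero : constant 0 = 0 := by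
  refine Finset.sum_eq_zero fun q hq => ?_
  obtain ⟨t, rfl⟩ := q.exists_eq_of
  exact absurd ((finite_forest_eq 0).mem_toFinset.1 hq) t.forest_ne_zero

theorem constant_mk_zero : constant {mk 0} = 1 := by
  have hleaf : (finite_forest_eq {mk 0}).toFinset = {of .leaf} := by
    ext q
    rw [Set.Finite.mem_toFinset, Finset.mem_singleton, Set.mem_ofPred_eq]
    refine ⟨fun hq => ?_, fun hq => hq ▸ rfl⟩
    obtain ⟨t, rfl⟩ := q.exists_eq_of
    obtain ⟨-, rfl⟩ | ⟨s, hs, rfl⟩ | ⟨l, r, hlr, rfl⟩ := UBTree.eq_of_forest_eq_singleton hq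
    · rfl
    · exact absurd hs s.forest_ne_zero
    · exact absurd (add_eq_zero.1 hlr).1 l.forest_ne_zero
  rw [constant, hleaf, Finset.sum_singleton, weight_of_valid (t := .leaf) trivial, UBTree.sym,
    pow_zero]

theorem sum_weight_binary (aux : Bool) (F : Multiset TreeClass) :
    ∑ p ∈ (finite_sym2_deg_eq finite_forest_eq F).toFinset, weight (binary aux p) =
      (∑ d ∈ antidiagonal F, constant d.1 * constant d.2) / 2 := by
  classical
  simp only [constant]
  rw [← sum_sym2_deg_eq finite_forest_eq F weight, Finset.sum_div]
  exact Finset.sum_congr rfl fun p _ => weight_binary aux p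

theorem constant_of_two_le {F : Multiset TreeClass} (hF : 2 ≤ F.card) :
    constant F = (∑ d ∈ antidiagonal F, constant d.1 * constant d.2) / 2 := by
  rw [← sum_weight_binary true, constant]
  symm
  refine Finset.sum_of_injOn (binary true) (binary_injective _).injOn ?_ ?_ fun _ _ => rfl
  · intro p hp
    rw [Finset.mem_coe, Set.Finite.mem_toFinset] at hp ⊢
    exact (forest_binary_true p).trans hp
  · intro q hq hq'
    rw [Set.Finite.mem_toFinset] at hq
    obtain ⟨t, rfl⟩ := q.exists_eq_of
    obtain ⟨l, r, rfl⟩ := UBTree.eq_of_two_le_card_forest (hF.trans_eq (congrArg _ hq.symm))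
    exact absurd ⟨s(of l, of r), (Set.Finite.mem_toFinset _).2 hq, rfl⟩ hq'

theorem constant_mk_of_card_eq_one {F : Multiset TreeClass} (hF : F.card = 1) :
    constant {mk F} = constant F := by
  symm
  refine Finset.sum_of_injOn unary unary_injective.injOn ?_ ?_ ?_
  · intro q hq
    rw [Finset.mem_coe, Set.Finite.mem_toFinset] at hq ⊢
    exact (forest_unary q).trans (congrArg _ (congrArg _ hq))
  · intro q hq hq'
    rw [Set.Finite.mem_toFinset] at hq
    obtain ⟨t, rfl⟩ := q.exists_eq_of
    obtain ⟨rfl, -⟩ | ⟨s, hs, rfl⟩ | ⟨l, r, rfl, -⟩ := UBTree.eq_of_forest_eq_singleton hq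
    · simp at hF
    · exact absurd ⟨of s, (Set.Finite.mem_toFinset _).2 hs, rfl⟩ hq'
    · have hcard := UBTree.two_le_card_forest_add l r
      omega
  · intro q hq
    rw [Set.Finite.mem_toFinset] at hq
    exact (weight_unary ((congrArg _ hq).trans hF)).symm

theorem constant_mk_of_two_le {F : Multiset TreeClass} (hF : 2 ≤ F.card) :
    constant {mk F} = constant F := by
  rw [constant_of_two_le hF, ← sum_weight_binary false, constant]
  symm
  refine Finset.sum_of_injOn (binary false) (binary_injective _).injOn ?_ ?_ fun _ _ => rfl
  · intro p hp
    rw [Finset.mem_coe, Set.Finite.mem_toFinset] at hp ⊢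
    exact (forest_binary_false p).trans (congrArg _ (congrArg _ hp))
  · intro q hq hq'
    rw [Set.Finite.mem_toFinset] at hq
    obtain ⟨t, rfl⟩ := q.exists_eq_of
    obtain ⟨rfl, -⟩ | ⟨s, hs, rfl⟩ | ⟨l, r, hlr, rfl⟩ := UBTree.eq_of_forest_eq_singleton hq
    · simp at hF
    · refine weight_unary_eq_zero (q := of s) fun hcard => ?_
      rw [show (of s).forest = F from hs] at hcard
      omega
    · exact absurd ⟨s(of l, of r), (Set.Finite.mem_toFinset _).2 hlr, rfl⟩ hq'

theorem constant_mk {F : Multiset TreeClass} (hF : F ≠ 0) : constant {mk F} = constant F := by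
  rcases lt_or_ge F.card 2 with hcard | hcard
  · have hpos := Multiset.card_pos.2 hF
    exact constant_mk_of_card_eq_one (by omega)
  · exact constant_mk_of_two_le hcard

theorem symmetryConstant_eq (S : RTree) : S.symmetryConstant = constant {S.cls} := by
  refine Finset.sum_of_injOn (Quotient.lift (fun t => of t.1) fun _ _ h => of_eq_iff.2 h)
    ?_ ?_ ?_ ?_
  · intro q _ q' _ h
    induction q using Quotient.inductionOn with | h t
    induction q' using Quotient.inductionOn with | h t'
    exact Quotient.sound (s := UBTree.replacementSetoid S) (of_eq_iff.1 h)
  · intro q _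
    induction q using Quotient.inductionOn with | h t
    rw [Finset.mem_coe, Set.Finite.mem_toFinset]
    exact (UBTree.isReplacement_iff.1 t.2).2
  · intro q hq hq'
    rw [Set.Finite.mem_toFinset] at hq
    obtain ⟨t, rfl⟩ := q.exists_eq_of
    refine weight_of_not_valid fun ht => hq' ?_
    exact ⟨Quotient.mk (UBTree.replacementSetoid S) ⟨t, UBTree.isReplacement_iff.2 ⟨ht, hq⟩⟩,
      Finset.mem_coe.2 (Finset.mem_univ _), rfl⟩
  · intro q _
    induction q using Quotient.inductionOn with | h t
    exact (weight_of_valid (UBTree.isReplacement_iff.1 t.2).1).symm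

theorem constant_pos {F : Multiset TreeClass} (hF : F ≠ 0) : 0 < constant F := by
  refine forest_induction (p := fun F => 0 < constant F) ?_ (fun F hF h => ?_)
    (fun F hF ih => ?_) hF
  · rw [constant_mk_zero]
    exact one_pos
  · rwa [constant_mk hF]
  · rw [constant_of_two_le hF]
    obtain ⟨G, H, hG, hH, hsum⟩ := exists_add_eq_of_two_le_card hF
    refine half_pos (Finset.sum_pos' (fun d _ =>
      mul_nonneg (constant_nonneg _) (constant_nonneg _)) ⟨(G, H), ?_, ?_⟩)
    · exact Finset.HasAntidiagonal.mem_antidiagonal.2 hsum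
    · exact mul_pos (ih G H hG hH hsum) (ih H G hH hG ((add_comm _ _).trans hsum))

end UBClass
/-! ### The generating function of binary trees -/

section leafSeries

open PowerSeries
open Finset.HasAntidiagonal (antidiagonal mem_antidiagonal antidiagonal_zero)

/-- The generating function of the binary trees by the number of leaves. -/
noncomputable def leafSeries : ℝ⟦X⟧ := MarkedClass.allSeries 0

namespace leafSeries

theorem two_mul_eq :
    2 * leafSeries = 2 * X + leafSeries * leafSeries + expand 2 two_ne_zero leafSeries := by
  have hpair := MarkedClass.two_mul_pairSeries 0
  have hdouble := MarkedClass.doubleSeries_add_self 0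
  rw [add_zero] at hdouble
  rw [antidiagonal_zero, Finset.sum_singleton, hdouble] at hpair
  have hall := MarkedClass.allSeries_of_card_ne_one (F := 0) (by simp)
  rw [if_pos rfl] at hall
  rw [leafSeries]
  conv_lhs => rw [hall, mul_add, hpair, ← add_assoc]

theorem coeff_nonneg (n : ℕ) : 0 ≤ coeff n leafSeries := by
  rw [leafSeries, MarkedClass.allSeries, coeff_mk]
  positivity

theorem coeff_zero : coeff 0 leafSeries = 0 := by
  rw [leafSeries, MarkedClass.allSeries, coeff_mk, Nat.cast_eq_zero,
    Set.ncard_eq_zero (MarkedClass.finite_deg_eq _), Set.eq_empty_iff_forall_notMem]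
  intro q hq
  have hsize := q.size_add_one
  have hleaves : q.leaves = 0 := congrArg Prod.fst hq
  omega

theorem constantCoeff_eq_zero : constantCoeff leafSeries = 0 := by
  rw [← coeff_zero_eq_constantCoeff_apply, coeff_zero]

theorem two_mul_coeff (n : ℕ) :
    2 * coeff n leafSeries = (if n = 1 then 2 else 0) +
      ∑ p ∈ antidiagonal n, coeff p.1 leafSeries * coeff p.2 leafSeries +
        if 2 ∣ n then coeff (n / 2) leafSeries else 0 := by
  have h := congrArg (coeff n) two_mul_eq
  rw [show (2 : ℝ⟦X⟧) = C (2 : ℝ) from (map_ofNat C 2).symm, coeff_C_mul, map_add, map_add,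
    coeff_C_mul, coeff_X, coeff_mul, coeff_expand, mul_ite, mul_one, mul_zero] at h
  exact h

theorem coeff_eq_natCast {a : ℕ → ℕ} (ha₀ : a 0 = 0) {N : ℕ}
    (ha : ∀ n < N, 2 * a n = (if n = 1 then 2 else 0) + ∑ p ∈ antidiagonal n, a p.1 * a p.2 +
      if 2 ∣ n then a (n / 2) else 0) {n : ℕ} (hn : n < N) : coeff n leafSeries = a n := by
  induction n using Nat.strong_induction_on with
  | _ n ih =>
  rcases n.eq_zero_or_pos with rfl | hpos
  · rw [coeff_zero, ha₀, Nat.cast_zero]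
  have hprod : ∀ p ∈ antidiagonal n,
      coeff p.1 leafSeries * coeff p.2 leafSeries = (a p.1 : ℝ) * a p.2 := by
    rintro ⟨i, j⟩ hij
    rw [mem_antidiagonal] at hij
    rcases i.eq_zero_or_pos with rfl | hi
    · rw [coeff_zero, ha₀, Nat.cast_zero, zero_mul, zero_mul]
    rcases j.eq_zero_or_pos with rfl | hj
    · rw [coeff_zero, ha₀, Nat.cast_zero, mul_zero, mul_zero]
    rw [ih i (by omega) (by omega), ih j (by omega) (by omega)]
  have hrec := two_mul_coeff n
  have harec := congrArg (Nat.cast : ℕ → ℝ) (ha n hn)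
  push_cast at harec
  rw [Finset.sum_congr rfl hprod, ih (n / 2) (by omega) (by omega), ← harec] at hrec
  exact mul_left_cancel₀ two_ne_zero hrec

/-- The Wedderburn-Etherington numbers. -/
theorem coeff_eq_getD {n : ℕ} (hn : n < 16) : coeff n leafSeries =
    ([0, 1, 1, 1, 2, 3, 6, 11, 23, 46, 98, 207, 451, 983, 2179, 4850].getD n 0 : ℕ) :=
  coeff_eq_natCast (a := fun n =>
    [0, 1, 1, 1, 2, 3, 6, 11, 23, 46, 98, 207, 451, 983, 2179, 4850].getD n 0) rfl (by decide) hn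

theorem coeff_one : coeff 1 leafSeries = 1 := by
  rw [coeff_eq_getD (by norm_num)]
  norm_num

theorem coeff_two : coeff 2 leafSeries = 1 := by
  rw [coeff_eq_getD (by norm_num)]
  norm_num

/-- The partial sums of the series, up to and including the exponent `N`. -/
noncomputable def partialSum (N : ℕ) (x : ℝ) : ℝ :=
  ∑ n ∈ Finset.range (N + 1), coeff n leafSeries * x ^ n

theorem partialSum_nonneg (N : ℕ) {x : ℝ} (hx : 0 ≤ x) : 0 ≤ partialSum N x :=
  Finset.sum_nonneg fun n _ => mul_nonneg (coeff_nonneg n) (pow_nonneg hx n)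

theorem sum_mul_self_le (N : ℕ) {x : ℝ} (hx : 0 ≤ x) :
    ∑ n ∈ Finset.range (N + 2),
        (∑ p ∈ antidiagonal n, coeff p.1 leafSeries * coeff p.2 leafSeries) * x ^ n ≤
      partialSum N x ^ 2 := by
  have term_nonneg (n : ℕ) : 0 ≤ coeff n leafSeries * x ^ n :=
    mul_nonneg (coeff_nonneg n) (pow_nonneg hx n)
  have pos_of_ne_zero (n : ℕ) (hn : coeff n leafSeries * x ^ n ≠ 0) : 0 < n :=
    Nat.pos_of_ne_zero fun h => hn (by rw [h, coeff_zero, zero_mul])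
  rw [partialSum, sq]
  refine le_of_eq_of_le (Finset.sum_congr rfl fun n _ => ?_)
    (sum_range_antidiagonal_le term_nonneg term_nonneg (M := N + 2) fun i j hij hi hj => ?_)
  · rw [Finset.sum_mul]
    refine Finset.sum_congr rfl fun p hp => ?_
    rw [← mem_antidiagonal.1 hp, pow_add]
    ring
  · have := pos_of_ne_zero i hi
    have := pos_of_ne_zero j hj
    omega

theorem sum_expand_le (N : ℕ) (x : ℝ) :
    ∑ n ∈ Finset.range (N + 2), (if 2 ∣ n then coeff (n / 2) leafSeries else 0) * x ^ n ≤
      partialSum N (x ^ 2) := by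
  have hinj : Set.InjOn (fun n => n / 2) ((Finset.range (N + 2)).filter (2 ∣ ·) : Set ℕ) := by
    intro a ha b hb hab
    simp only [Finset.coe_filter, Set.mem_ofPred_eq] at ha hb hab
    omega
  calc ∑ n ∈ Finset.range (N + 2), (if 2 ∣ n then coeff (n / 2) leafSeries else 0) * x ^ n
    _ = ∑ n ∈ Finset.range (N + 2) with 2 ∣ n, coeff (n / 2) leafSeries * (x ^ 2) ^ (n / 2) := by
      rw [Finset.sum_filter]
      refine Finset.sum_congr rfl fun n _ => ?_
      split_ifs with h
      · rw [← pow_mul, Nat.mul_div_cancel' h]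
      · rw [zero_mul]
    _ = ∑ m ∈ ((Finset.range (N + 2)).filter (2 ∣ ·)).image fun n => n / 2,
          coeff m leafSeries * (x ^ 2) ^ m :=
      (Finset.sum_image (f := fun m => coeff m leafSeries * (x ^ 2) ^ m) hinj).symm
    _ ≤ partialSum N (x ^ 2) := by
      refine Finset.sum_le_sum_of_subset_of_nonneg (fun m hm => ?_) fun n _ _ =>
        mul_nonneg (coeff_nonneg n) (by positivity)
      simp only [Finset.mem_image, Finset.mem_filter, Finset.mem_range] at hm ⊢
      omega

theorem two_mul_partialSum_succ_le (N : ℕ) {x : ℝ} (hx : 0 ≤ x) :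
    2 * partialSum (N + 1) x ≤ 2 * x + partialSum N x ^ 2 + partialSum N (x ^ 2) := by
  have hlinear : ∑ n ∈ Finset.range (N + 2), (if n = 1 then 2 else 0) * x ^ n = 2 * x := by
    rw [Finset.sum_eq_single 1 (fun n _ h => by simp [h]) (fun h => by simp at h)]
    simp
  rw [partialSum, Finset.mul_sum]
  simp_rw [← mul_assoc, two_mul_coeff, add_mul]
  rw [Finset.sum_add_distrib, Finset.sum_add_distrib, hlinear]
  gcongr
  · exact sum_mul_self_le N hx
  · exact sum_expand_le N x

theorem partialSum_le {x β : ℝ} (hx : 0 ≤ x) (hβ : 0 ≤ β)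
    (h : ∀ N, partialSum N x ≤ β → 2 * x + β ^ 2 + partialSum N (x ^ 2) ≤ 2 * β) (N : ℕ) :
    partialSum N x ≤ β := by
  induction N with
  | zero => simpa [partialSum, coeff_zero] using hβ
  | succ N ih =>
    have hsq : partialSum N x ^ 2 ≤ β ^ 2 := pow_le_pow_left₀ (partialSum_nonneg N hx) ih 2
    linarith [two_mul_partialSum_succ_le N hx, h N ih]

theorem absConv_of_partialSum_le {x β : ℝ} (hx : 0 ≤ x) (h : ∀ N, partialSum N x ≤ β) :
    AbsConv x leafSeries := by
  refine summable_of_sum_range_le (c := β) (fun n => by positivity) fun N => ?_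
  simp_rw [Real.norm_of_nonneg (coeff_nonneg _)]
  refine le_trans ?_ (h N)
  exact Finset.sum_le_sum_of_subset_of_nonneg (Finset.range_subset_range.2 N.le_succ)
    fun n _ _ => mul_nonneg (coeff_nonneg n) (pow_nonneg hx n)

theorem partialSum_le_evalAt {r x : ℝ} (hr : AbsConv r leafSeries) (hx : 0 ≤ x) (hxr : x ≤ r)
    (N : ℕ) : partialSum N x ≤ evalAt x leafSeries :=
  sum_le_hasSum _ (fun n _ => mul_nonneg (coeff_nonneg n) (pow_nonneg hx n))
    (hr.hasSum ((Real.norm_of_nonneg hx).trans_le hxr))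

theorem partialSum_mul_le {x y : ℝ} (hx : 0 ≤ x) (hy₀ : 0 ≤ y) (hy₁ : y ≤ 1) (N : ℕ) :
    partialSum N (y * x) ≤ y * partialSum N x := by
  rw [partialSum, partialSum, Finset.mul_sum]
  refine Finset.sum_le_sum fun n _ => ?_
  rcases n with _ | n
  · simp [coeff_zero]
  · calc coeff (n + 1) leafSeries * (y * x) ^ (n + 1)
      _ = y ^ (n + 1) * (coeff (n + 1) leafSeries * x ^ (n + 1)) := by ring
      _ ≤ y * (coeff (n + 1) leafSeries * x ^ (n + 1)) :=
        mul_le_mul_of_nonneg_right (pow_le_of_le_one hy₀ hy₁ n.succ_ne_zero)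
          (mul_nonneg (coeff_nonneg _) (pow_nonneg hx _))

theorem absConv_quarter : AbsConv (1 / 4) leafSeries := by
  refine absConv_of_partialSum_le (β := 1 / 2) (by norm_num) fun N =>
    partialSum_le (by norm_num) (by norm_num) (fun N hN => ?_) N
  have hsq := partialSum_mul_le (x := 1 / 4) (y := 1 / 4) (by norm_num) (by norm_num)
    (by norm_num) N
  rw [← sq] at hsq
  linarith

theorem evalAt_le_evalAt {r x y : ℝ} (hr : AbsConv r leafSeries) (hx : 0 ≤ x) (hxy : x ≤ y)
    (hy : y ≤ r) : evalAt x leafSeries ≤ evalAt y leafSeries := by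
  refine hasSum_le (fun n => ?_) (hr.hasSum ((Real.norm_of_nonneg hx).trans_le (hxy.trans hy)))
    (hr.hasSum ((Real.norm_of_nonneg (hx.trans hxy)).trans_le hy))
  exact mul_le_mul_of_nonneg_left (pow_le_pow_left₀ hx hxy n) (coeff_nonneg n)

/-- The discriminant `1 - 2x - T(x²)` of the quadratic equation `2T = 2x + T² + T(x²)` that
`T = leafSeries` satisfies. -/
noncomputable def discr (x : ℝ) : ℝ := 1 - 2 * x - evalAt (x ^ 2) leafSeries

theorem discr_strictAntiOn : StrictAntiOn discr (Set.Icc 0 (1 / 2)) := by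
  intro x hx y hy hxy
  have := evalAt_le_evalAt absConv_quarter (sq_nonneg x) (pow_le_pow_left₀ hx.1 hxy.le 2)
    (by nlinarith [hx.1, hy.2])
  rw [discr, discr]
  linarith

theorem continuousOn_evalAt : ContinuousOn (fun x : ℝ => evalAt x leafSeries)
    (Set.Icc 0 (1 / 4)) := by
  refine continuousOn_tsum (u := fun n => ‖coeff n leafSeries‖ * (1 / 4) ^ n)
    (fun n => by fun_prop) absConv_quarter fun n x hx => ?_
  rw [norm_mul, norm_pow, Real.norm_of_nonneg hx.1]
  exact mul_le_mul_of_nonneg_left (pow_le_pow_left₀ hx.1 hx.2 n) (norm_nonneg _)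

theorem continuousOn_discr : ContinuousOn discr (Set.Icc 0 (1 / 2)) := by
  have : ContinuousOn (fun x : ℝ => evalAt (x ^ 2) leafSeries) (Set.Icc 0 (1 / 2)) :=
    continuousOn_evalAt.comp (f := fun x : ℝ => x ^ 2) (by fun_prop) fun x hx =>
      ⟨sq_nonneg x, by nlinarith [hx.1, hx.2]⟩
  unfold discr
  fun_prop

theorem sq_one_sub_evalAt {x : ℝ} (hx : 0 ≤ x) (h : AbsConv x leafSeries) (hx' : x ≤ 1 / 2) :
    (1 - evalAt x leafSeries) ^ 2 = discr x := by
  have hn : ‖x‖ ≤ x := (Real.norm_of_nonneg hx).le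
  have hX : AbsConv x (C (2 : ℝ) * X : ℝ⟦X⟧) := (AbsConv.const 2).mul hx .var
  have hexp : AbsConv x (expand 2 two_ne_zero leafSeries) :=
    (absConv_quarter.mono (sq_nonneg x) (by nlinarith)).expand _
  have hev := congrArg (evalAt x) two_mul_eq
  rw [show (2 : ℝ⟦X⟧) = C (2 : ℝ) from (map_ofNat C 2).symm, evalAt_mul (.const 2) h hn,
    evalAt_add (hX.add hx (h.mul hx h)) hexp hn, evalAt_add hX (h.mul hx h) hn,
    evalAt_mul (.const 2) .var hn, evalAt_mul h h hn, evalAt_expand, evalAt_X, evalAt_C] at hev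
  rw [discr]
  linarith

theorem exists_discr_eq_zero : ∃ α : ℝ, 0 < α ∧ α < 1 / 2 ∧ discr α = 0 := by
  have discr_zero : discr 0 = 1 := by
    rw [discr, zero_pow two_ne_zero, evalAt_zero, constantCoeff_eq_zero]
    norm_num
  have discr_half : discr (1 / 2) < 0 := by
    have hle := partialSum_le_evalAt absConv_quarter (x := (1 / 2) ^ 2) (by norm_num)
      (by norm_num) 1
    have hpart : partialSum 1 ((1 / 2) ^ 2) = 1 / 4 := by
      norm_num [partialSum, Finset.sum_range_succ, coeff_zero, coeff_one]
    rw [discr]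
    linarith
  obtain ⟨α, hα, h⟩ := intermediate_value_Ioo' (by norm_num) continuousOn_discr
    (show (0 : ℝ) ∈ Set.Ioo (discr (1 / 2)) (discr 0) from ⟨discr_half, by simp [discr_zero]⟩)
  exact ⟨α, hα.1, hα.2, h⟩

theorem absConv_of_discr_eq_zero {α : ℝ} (h₀ : 0 ≤ α) (h₁ : α ≤ 1 / 2) (h : discr α = 0) :
    AbsConv α leafSeries := by
  refine absConv_of_partialSum_le h₀ (partialSum_le h₀ zero_le_one fun N _ => ?_)
  have := partialSum_le_evalAt absConv_quarter (sq_nonneg α) (by nlinarith) N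
  rw [discr] at h
  linarith

/-- The radius of convergence of `leafSeries`, encoded as the zero of its discriminant in
`(0, 1 / 2)`. -/
noncomputable def radius : ℝ := exists_discr_eq_zero.choose

theorem radius_pos : 0 < radius := exists_discr_eq_zero.choose_spec.1

theorem radius_lt_half : radius < 1 / 2 := exists_discr_eq_zero.choose_spec.2.1

theorem discr_radius : discr radius = 0 := exists_discr_eq_zero.choose_spec.2.2

theorem absConv_radius : AbsConv radius leafSeries :=
  absConv_of_discr_eq_zero radius_pos.le radius_lt_half.le discr_radius

theorem evalAt_radius : evalAt radius leafSeries = 1 := by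
  have := sq_one_sub_evalAt radius_pos.le absConv_radius radius_lt_half.le
  rw [discr_radius, sq_eq_zero_iff] at this
  linarith

theorem not_absConv {x : ℝ} (hx : radius < x) : ¬AbsConv x leafSeries := by
  intro h
  have hmin : radius < min x (1 / 2) := lt_min hx radius_lt_half
  have hsq := sq_one_sub_evalAt (radius_pos.trans hmin).le
    (h.mono (radius_pos.trans hmin).le (min_le_left _ _)) (min_le_right _ _)
  have hlt := discr_strictAntiOn ⟨radius_pos.le, radius_lt_half.le⟩
    ⟨(radius_pos.trans hmin).le, min_le_right _ _⟩ hmin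
  rw [discr_radius, ← hsq] at hlt
  exact hlt.not_ge (sq_nonneg _)

theorem one_sub_evalAt_eq_sqrt {x : ℝ} (h₀ : 0 ≤ x) (hx : x ≤ radius) :
    1 - evalAt x leafSeries = √(discr x) := by
  have hle := evalAt_le_evalAt absConv_radius h₀ hx le_rfl
  rw [evalAt_radius] at hle
  rw [← sq_one_sub_evalAt h₀ (absConv_radius.mono h₀ hx) (hx.trans radius_lt_half.le),
    Real.sqrt_sq (by linarith)]

theorem evalAt_lt_one {x : ℝ} (h₀ : 0 ≤ x) (hx : x < radius) : evalAt x leafSeries < 1 := by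
  have hpos : 0 < discr x := discr_radius ▸ discr_strictAntiOn
    ⟨h₀, (hx.trans radius_lt_half).le⟩ ⟨radius_pos.le, radius_lt_half.le⟩ hx
  linarith [one_sub_evalAt_eq_sqrt h₀ hx.le, Real.sqrt_pos.2 hpos]

end leafSeries

/-- The series `1 - leafSeries`, whose square is the discriminant of the quadratic equation for
`leafSeries`. -/
noncomputable def sqrtSeries : ℝ⟦X⟧ := 1 - leafSeries

namespace sqrtSeries

open leafSeries

theorem sq_eq : sqrtSeries ^ 2 = 1 - 2 * X - expand 2 two_ne_zero leafSeries := by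
  rw [sqrtSeries]
  linear_combination -leafSeries.two_mul_eq

theorem constantCoeff_eq_one : constantCoeff sqrtSeries = 1 := by
  rw [sqrtSeries, map_sub, map_one, constantCoeff_eq_zero, sub_zero]

theorem mul_inv : sqrtSeries * sqrtSeries⁻¹ = 1 :=
  PowerSeries.mul_inv_cancel _ (by rw [constantCoeff_eq_one]; exact one_ne_zero)

theorem absConv_radius : AbsConv radius sqrtSeries := by
  rw [sqrtSeries]
  exact AbsConv.one.sub radius_pos.le leafSeries.absConv_radius

theorem absConv_inv {r : ℝ} (h₀ : 0 ≤ r) (hr : r < radius) : AbsConv r sqrtSeries⁻¹ := by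
  refine (leafSeries.absConv_radius.mono h₀ hr.le).inv_one_sub h₀ constantCoeff_eq_zero ?_
  simpa only [evalAt, Real.norm_of_nonneg (coeff_nonneg _)] using evalAt_lt_one h₀ hr

/-- The subring of the series whose radius of convergence exceeds that of `leafSeries`. -/
noncomputable abbrev regular : Subring ℝ⟦X⟧ := overconvergent ℝ radius_pos.le

theorem expand_mem_regular {f : ℝ⟦X⟧} (hf : ∀ r, 0 ≤ r → r < radius → AbsConv r f) :
    expand 2 two_ne_zero f ∈ regular :=
  expand_mem_overconvergent one_lt_two radius_pos (radius_lt_half.trans one_half_lt_one) hf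

theorem sq_mem_regular : sqrtSeries ^ 2 ∈ regular := by
  rw [sq_eq, show (2 : ℝ⟦X⟧) = C (2 : ℝ) from (map_ofNat C 2).symm]
  exact sub_mem (sub_mem (one_mem _) (mul_mem (C_mem_overconvergent _) X_mem_overconvergent))
    (expand_mem_regular fun r h₀ hr => leafSeries.absConv_radius.mono h₀ hr.le)

/-- The subring of the series `p + q * sqrtSeries` with `p` and `q` analytic beyond the
singularity of `leafSeries`. -/
noncomputable def sqrtRing : Subring ℝ⟦X⟧ := adjoinSqrt regular sq_mem_regular

theorem mem_sqrtRing : sqrtSeries ∈ sqrtRing := self_mem_adjoinSqrt _ _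

theorem regular_le_sqrtRing : regular ≤ sqrtRing := le_adjoinSqrt _ _

theorem C_mem_sqrtRing (c : ℝ) : C c ∈ sqrtRing := regular_le_sqrtRing (C_mem_overconvergent c)

theorem absConv_of_mem_sqrtRing {f : ℝ⟦X⟧} (hf : f ∈ sqrtRing) : AbsConv radius f := by
  obtain ⟨p, hp, q, hq, rfl⟩ := hf
  exact (absConv_of_mem_overconvergent hp).add radius_pos.le
    ((absConv_of_mem_overconvergent hq).mul radius_pos.le absConv_radius)

end sqrtSeries

end leafSeries
section expansion

open PowerSeries sqrtSeries
open Finset.HasAntidiagonal (antidiagonal mem_antidiagonal)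

/-- `f` has the form `c * sqrtSeries ^ (-k) + O(sqrtSeries ^ (1 - k))` at the singularity of
`leafSeries`, with a coefficient function that is of square-root type there. -/
def HasLeadingTerm (f : ℝ⟦X⟧) (c : ℝ) (k : ℕ) : Prop :=
  ∃ e ∈ sqrtRing, f * sqrtSeries ^ k = C c + sqrtSeries * e

namespace HasLeadingTerm

variable {f g : ℝ⟦X⟧} {c d : ℝ} {k l : ℕ}

theorem of_mem_sqrtRing (hf : f ∈ sqrtRing) : HasLeadingTerm f 0 (k + 1) :=
  ⟨f * sqrtSeries ^ k, mul_mem hf (pow_mem mem_sqrtRing k), by rw [map_zero]; ring⟩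

theorem add (hf : HasLeadingTerm f c k) (hg : HasLeadingTerm g d k) :
    HasLeadingTerm (f + g) (c + d) k := by
  obtain ⟨e, he, hf⟩ := hf
  obtain ⟨e', he', hg⟩ := hg
  exact ⟨e + e', add_mem he he', by rw [map_add]; linear_combination hf + hg⟩

theorem mul (hf : HasLeadingTerm f c k) (hg : HasLeadingTerm g d l) :
    HasLeadingTerm (f * g) (c * d) (k + l) := by
  obtain ⟨e, he, hf⟩ := hf
  obtain ⟨e', he', hg⟩ := hg
  refine ⟨C c * e' + C d * e + sqrtSeries * (e * e'), ?_, ?_⟩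
  · exact add_mem (add_mem (mul_mem (C_mem_sqrtRing c) he') (mul_mem (C_mem_sqrtRing d) he))
      (mul_mem mem_sqrtRing (mul_mem he he'))
  · rw [map_mul, pow_add]
    linear_combination g * sqrtSeries ^ l * hf + (C c + sqrtSeries * e) * hg

theorem const (c : ℝ) : HasLeadingTerm (C c) c 0 := ⟨0, zero_mem _, by ring⟩

theorem sum {ι : Type*} {s : Finset ι} {f : ι → ℝ⟦X⟧} {c : ι → ℝ}
    (h : ∀ i ∈ s, HasLeadingTerm (f i) (c i) k) :
    HasLeadingTerm (∑ i ∈ s, f i) (∑ i ∈ s, c i) k := by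
  classical
  induction s using Finset.induction_on with
  | empty => exact ⟨0, zero_mem _, by simp only [Finset.sum_empty, map_zero]; ring⟩
  | insert i s hi ih =>
    rw [Finset.sum_insert hi, Finset.sum_insert hi]
    exact (h i (Finset.mem_insert_self i s)).add
      (ih fun j hj => h j (Finset.mem_insert_of_mem hj))

theorem sqrtSeries_mul_iff :
    HasLeadingTerm (sqrtSeries * f) c k ↔ HasLeadingTerm f c (k + 1) := by
  rw [HasLeadingTerm, HasLeadingTerm, pow_succ', ← mul_assoc, mul_comm f]

theorem one_sub_sqrtSeries : HasLeadingTerm (1 - sqrtSeries) 1 0 :=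
  ⟨-1, neg_mem (one_mem _), by rw [map_one]; ring⟩

theorem absConv (hf : HasLeadingTerm f c k) {r : ℝ} (h₀ : 0 ≤ r) (hr : r < leafSeries.radius) :
    AbsConv r f := by
  obtain ⟨e, he, hf⟩ := hf
  have hf_eq : f = (C c + sqrtSeries * e) * sqrtSeries⁻¹ ^ k := by
    rw [← hf, mul_assoc, ← mul_pow, mul_inv, one_pow, mul_one]
  have hinv (n : ℕ) : AbsConv r (sqrtSeries⁻¹ ^ n) := by
    induction n with
    | zero => rw [pow_zero]; exact AbsConv.one
    | succ n ih => rw [pow_succ]; exact ih.mul h₀ (absConv_inv h₀ hr)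
  rw [hf_eq]
  exact ((absConv_of_mem_sqrtRing (add_mem (C_mem_sqrtRing _) (mul_mem mem_sqrtRing he))).mono
    h₀ hr.le).mul h₀ (hinv k)

end HasLeadingTerm

namespace TreeClass

open MarkedClass UBClass

/-- The number of vertices plus the number of leaves of a forest. -/
def sizeAddLeaves (F : Multiset TreeClass) : ℕ := (F.map fun t => t.size + t.leaves).sum

theorem sizeAddLeaves_add (F G : Multiset TreeClass) :
    sizeAddLeaves (F + G) = sizeAddLeaves F + sizeAddLeaves G := by
  rw [sizeAddLeaves, Multiset.map_add, Multiset.sum_add, sizeAddLeaves, sizeAddLeaves]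

theorem sizeAddLeaves_mk_zero : sizeAddLeaves {mk 0} = 2 := by
  simp [sizeAddLeaves, size_mk, leaves_mk_zero]

theorem sizeAddLeaves_mk {F : Multiset TreeClass} (hF : F ≠ 0) :
    sizeAddLeaves {mk F} = sizeAddLeaves F + 1 := by
  simp only [sizeAddLeaves, Multiset.map_singleton, Multiset.sum_singleton, size_mk, leaves_mk hF,
    Multiset.sum_map_add]
  ring

theorem two_le_sizeAddLeaves {F : Multiset TreeClass} (hF : F ≠ 0) : 2 ≤ sizeAddLeaves F := by
  refine forest_induction (p := fun F => 2 ≤ sizeAddLeaves F) ?_ (fun F hF h => ?_)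
    (fun F hF ih => ?_) hF
  · rw [sizeAddLeaves_mk_zero]
  · rw [sizeAddLeaves_mk hF]
    omega
  · obtain ⟨G, H, hG, hH, rfl⟩ := exists_add_eq_of_two_le_card hF
    rw [sizeAddLeaves_add]
    exact (ih G H hG hH rfl).trans (Nat.le_add_right _ _)

open Classical in
/-- The ways to split a forest into two non-empty forests, in order. -/
noncomputable def properSplittings (F : Multiset TreeClass) :
    Finset (Multiset TreeClass × Multiset TreeClass) :=
  (antidiagonal F).filter fun d => d.1 ≠ 0 ∧ d.2 ≠ 0

theorem mem_properSplittings {F : Multiset TreeClass}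
    {d : Multiset TreeClass × Multiset TreeClass} :
    d ∈ properSplittings F ↔ d.1 + d.2 = F ∧ d.1 ≠ 0 ∧ d.2 ≠ 0 := by
  simp only [properSplittings, Finset.mem_filter, mem_antidiagonal]

theorem properSplittings_singleton (S : TreeClass) : properSplittings {S} = ∅ := by
  refine Finset.eq_empty_of_forall_notMem fun d hd => ?_
  obtain ⟨hsum, h₁, h₂⟩ := mem_properSplittings.1 hd
  have hcard := congrArg Multiset.card hsum
  rw [Multiset.card_add, Multiset.card_singleton] at hcard
  have := Multiset.card_pos.2 h₁
  have := Multiset.card_pos.2 h₂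
  omega

theorem sum_antidiagonal_eq_add_sum_properSplittings {M : Type*} [AddCommMonoid M]
    {F : Multiset TreeClass} (hF : F ≠ 0)
    (f : Multiset TreeClass × Multiset TreeClass → M) :
    ∑ d ∈ antidiagonal F, f d = f (0, F) + f (F, 0) + ∑ d ∈ properSplittings F, f d := by
  classical
  have himproper : {d ∈ antidiagonal F | ¬(d.1 ≠ 0 ∧ d.2 ≠ 0)} = {(0, F), (F, 0)} := by
    ext ⟨G, H⟩
    simp only [Finset.mem_filter, mem_antidiagonal, Finset.mem_insert, Finset.mem_singleton,
      Prod.mk.injEq, not_and_or, not_not]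
    constructor
    · rintro ⟨rfl, rfl | rfl⟩ <;> simp
    · rintro (⟨rfl, rfl⟩ | ⟨rfl, rfl⟩) <;> simp
  rw [← Finset.sum_filter_not_add_sum_filter (antidiagonal F)
      (fun d : Multiset TreeClass × Multiset TreeClass => d.1 ≠ 0 ∧ d.2 ≠ 0) f, himproper,
    Finset.sum_pair (by simp [hF.symm]), properSplittings]

theorem two_mul_pairSeries_of_ne_zero {F : Multiset TreeClass} (hF : F ≠ 0) :
    2 * pairSeries F = 2 * (leafSeries * allSeries F) +
      ∑ d ∈ properSplittings F, allSeries d.1 * allSeries d.2 + doubleSeries F := by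
  rw [two_mul_pairSeries, sum_antidiagonal_eq_add_sum_properSplittings hF, leafSeries]
  ring

theorem pairSeries_singleton (S : TreeClass) : pairSeries {S} = leafSeries * allSeries {S} := by
  have hdouble : doubleSeries {S} = 0 := doubleSeries_eq_zero fun H hH => by
    have := congrArg Multiset.card hH
    rw [Multiset.card_singleton, Multiset.card_add] at this
    omega
  have h := two_mul_pairSeries_of_ne_zero (Multiset.singleton_ne_zero S)
  rw [properSplittings_singleton, Finset.sum_empty, hdouble, add_zero, add_zero] at h
  have := algebraRat.charZero ℝ⟦X⟧
  exact mul_left_cancel₀ two_ne_zero h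

theorem sqrtSeries_mul_allSeries_singleton (S : TreeClass) :
    sqrtSeries * allSeries {S} = goodSeries S := by
  rw [sqrtSeries]
  linear_combination allSeries_singleton S + pairSeries_singleton S

theorem goodSeries_mk_zero : goodSeries (mk 0) = 1 - sqrtSeries := by
  have hall := allSeries_of_card_ne_one (F := 0) (by simp)
  rw [goodSeries_mk, ← hall, sqrtSeries, leafSeries, sub_sub_cancel]

theorem goodSeries_mk_of_card_eq_one {F : Multiset TreeClass} (hF : F.card = 1) :
    goodSeries (mk F) = (1 - sqrtSeries) * allSeries F := by
  obtain ⟨S, rfl⟩ := Multiset.card_eq_one.1 hF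
  rw [goodSeries_mk, if_neg (Multiset.singleton_ne_zero S), pairSeries_singleton, sqrtSeries]
  ring

theorem goodSeries_mk_of_two_le {F : Multiset TreeClass} (hF : 2 ≤ F.card) :
    goodSeries (mk F) = allSeries F := by
  rw [goodSeries_mk, allSeries_of_card_ne_one (by omega)]

theorem two_mul_sqrtSeries_mul_allSeries {F : Multiset TreeClass} (hF : 2 ≤ F.card) :
    2 * (sqrtSeries * allSeries F) =
      ∑ d ∈ properSplittings F, allSeries d.1 * allSeries d.2 + doubleSeries F := by
  have hF₀ : F ≠ 0 := Multiset.card_pos.1 (by omega)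
  have hall := allSeries_of_card_ne_one (by omega : F.card ≠ 1)
  rw [if_neg hF₀, zero_add] at hall
  rw [sqrtSeries]
  linear_combination 2 * hall + two_mul_pairSeries_of_ne_zero hF₀

theorem constant_eq_sum_properSplittings {F : Multiset TreeClass} (hF : 2 ≤ F.card) :
    constant F = (∑ d ∈ properSplittings F, constant d.1 * constant d.2) / 2 := by
  rw [constant_of_two_le hF,
    sum_antidiagonal_eq_add_sum_properSplittings (Multiset.card_pos.1 (by omega))]
  simp only [constant_zero, zero_mul, mul_zero, zero_add]

theorem doubleSeries_mem_sqrtRing {F : Multiset TreeClass}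
    (h : ∀ H, H + H = F → ∀ r, 0 ≤ r → r < leafSeries.radius → AbsConv r (allSeries H)) :
    doubleSeries F ∈ sqrtRing := by
  by_cases hF : ∃ H, F = H + H
  · obtain ⟨H, rfl⟩ := hF
    rw [doubleSeries_add_self]
    exact regular_le_sqrtRing (expand_mem_regular (h H rfl))
  · rw [doubleSeries_eq_zero (not_exists.1 hF)]
    exact zero_mem _

theorem hasLeadingTerm_goodSeries_mk {F : Multiset TreeClass} (hF : F ≠ 0) {k : ℕ}
    (h : HasLeadingTerm (allSeries F) (constant F) k) :
    HasLeadingTerm (goodSeries (mk F)) (constant {mk F}) k := by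
  rw [constant_mk hF]
  rcases lt_or_ge F.card 2 with hcard | hcard
  · have := Multiset.card_pos.2 hF
    rw [goodSeries_mk_of_card_eq_one (by omega)]
    simpa only [one_mul, zero_add] using HasLeadingTerm.one_sub_sqrtSeries.mul h
  · rwa [goodSeries_mk_of_two_le hcard]

theorem hasLeadingTerm_of_splittings {F : Multiset TreeClass} (hF : 2 ≤ F.card)
    (ih : ∀ G H, G ≠ 0 → H ≠ 0 → G + H = F →
      HasLeadingTerm (allSeries G) (constant G) (sizeAddLeaves G - 1)) :
    HasLeadingTerm (allSeries F) (constant F) (sizeAddLeaves F - 1) := by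
  obtain ⟨G, H, hG, hH, hGH⟩ := exists_add_eq_of_two_le_card hF
  have := two_le_sizeAddLeaves hG
  have := two_le_sizeAddLeaves hH
  obtain ⟨k, hk⟩ : ∃ k, sizeAddLeaves F = k + 3 :=
    Nat.exists_eq_add_of_le' (by rw [← hGH, sizeAddLeaves_add]; omega)
  have hprod (d) (hd : d ∈ properSplittings F) :
      HasLeadingTerm (allSeries d.1 * allSeries d.2) (constant d.1 * constant d.2) (k + 1) := by
    obtain ⟨hsum, h₁, h₂⟩ := mem_properSplittings.1 hd
    have horder : sizeAddLeaves d.1 - 1 + (sizeAddLeaves d.2 - 1) = k + 1 := by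
      have := two_le_sizeAddLeaves h₁
      have := two_le_sizeAddLeaves h₂
      have hadd := sizeAddLeaves_add d.1 d.2
      rw [hsum, hk] at hadd
      omega
    exact horder ▸ (ih d.1 d.2 h₁ h₂ hsum).mul (ih d.2 d.1 h₂ h₁ ((add_comm _ _).trans hsum))
  have hdouble : doubleSeries F ∈ sqrtRing := by
    refine doubleSeries_mem_sqrtRing fun H hH r h₀ hr => ?_
    have hH₀ : H ≠ 0 := by
      rintro rfl
      rw [← hH] at hF
      simp at hF
    exact (ih H H hH₀ hH₀ hH).absConv h₀ hr
  have hhalf := (HasLeadingTerm.const 2⁻¹).mul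
    ((HasLeadingTerm.sum hprod).add (.of_mem_sqrtRing hdouble))
  have hseries : C (2⁻¹ : ℝ) * (∑ d ∈ properSplittings F, allSeries d.1 * allSeries d.2 +
      doubleSeries F) = sqrtSeries * allSeries F := by
    rw [← two_mul_sqrtSeries_mul_allSeries hF, ← mul_assoc, ← map_ofNat (C : ℝ →+* ℝ⟦X⟧) 2,
      ← map_mul, inv_mul_cancel₀ two_ne_zero, map_one, one_mul]
  rw [hseries, zero_add, add_zero, inv_mul_eq_div, ← constant_eq_sum_properSplittings hF,
    HasLeadingTerm.sqrtSeries_mul_iff] at hhalf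
  rwa [hk]

/-- Every vertex and every leaf of the forest contributes a factor `sqrtSeries⁻¹`, except for one
such factor. -/
theorem hasLeadingTerm_allSeries {F : Multiset TreeClass} (hF : F ≠ 0) :
    HasLeadingTerm (allSeries F) (constant F) (sizeAddLeaves F - 1) := by
  refine forest_induction
    (p := fun F => HasLeadingTerm (allSeries F) (constant F) (sizeAddLeaves F - 1))
    ?_ (fun F hF ih => ?_) (fun F hF ih => hasLeadingTerm_of_splittings hF ih) hF
  · rw [sizeAddLeaves_mk_zero, ← HasLeadingTerm.sqrtSeries_mul_iff,
      sqrtSeries_mul_allSeries_singleton, goodSeries_mk_zero, constant_mk_zero]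
    exact .one_sub_sqrtSeries
  · have := two_le_sizeAddLeaves hF
    rw [sizeAddLeaves_mk hF,
      show sizeAddLeaves F + 1 - 1 = sizeAddLeaves F - 1 + 1 by omega,
      ← HasLeadingTerm.sqrtSeries_mul_iff, sqrtSeries_mul_allSeries_singleton]
    exact hasLeadingTerm_goodSeries_mk hF ih

theorem hasLeadingTerm_goodSeries (S : TreeClass) :
    HasLeadingTerm (goodSeries S) (constant {S}) (sizeAddLeaves {S} - 2) := by
  have := two_le_sizeAddLeaves (Multiset.singleton_ne_zero S)
  rw [← sqrtSeries_mul_allSeries_singleton, HasLeadingTerm.sqrtSeries_mul_iff,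
    show sizeAddLeaves {S} - 2 + 1 = sizeAddLeaves {S} - 1 by omega]
  exact hasLeadingTerm_allSeries (Multiset.singleton_ne_zero S)

end TreeClass

end expansion

/-! ### The dominant singularity -/

section singularity

open PowerSeries

theorem norm_one_add_lt {r : ℝ} {x : ℂ} (hx : ‖x‖ ≤ r) (hne : x ≠ r) : ‖1 + x‖ < 1 + r := by
  by_contra! hle
  have htri : ‖1 + x‖ ≤ 1 + ‖x‖ := by simpa only [norm_one] using norm_add_le 1 x
  have hnorm : ‖x‖ = r := by linarith
  have hray : SameRay ℝ 1 x := sameRay_iff_norm_add.2 (by rw [norm_one]; linarith)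
  have hx_eq := sameRay_iff_norm_smul_eq.1 hray
  rw [norm_one, one_smul, hnorm, Complex.real_smul, mul_one] at hx_eq
  exact hne hx_eq

namespace leafSeries

theorem norm_evalAt_lt_one {x : ℂ} (hx : ‖x‖ ≤ radius) (hne : x ≠ radius) :
    ‖evalAt x (toComplex leafSeries)‖ < 1 := by
  set tail := leafSeries - X * (1 + X) with htail
  have tail_nonneg (n : ℕ) : 0 ≤ coeff n tail := by
    match n with
    | 0 => simp [htail, constantCoeff_eq_zero]
    | 1 => simp [htail, coeff_one, coeff_succ_X_mul]
    | 2 => simp [htail, coeff_two, coeff_succ_X_mul]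
    | n + 3 =>
      simpa [htail, coeff_succ_X_mul, PowerSeries.coeff_one, coeff_X] using coeff_nonneg _
  have hsmall : AbsConv radius (X * (1 + X) : ℝ⟦X⟧) :=
    .mul radius_pos.le .var (.add radius_pos.le .one .var)
  have tail_absConv : AbsConv radius tail := absConv_radius.sub radius_pos.le hsmall
  have hn : ‖radius‖ ≤ radius := (Real.norm_of_nonneg radius_pos.le).le
  have hradius_eval : evalAt radius leafSeries = radius * (1 + radius) + evalAt radius tail := by
    rw [← sub_add_cancel leafSeries (X * (1 + X)), ← htail, add_comm tail,
      evalAt_add hsmall tail_absConv hn, evalAt_mul .var (.add radius_pos.le .one .var) hn,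
      evalAt_add .one .var hn, evalAt_X, evalAt_one]
  have hx_eval : evalAt x (toComplex leafSeries) =
      x * (1 + x) + evalAt x (toComplex tail) := by
    rw [← sub_add_cancel leafSeries (X * (1 + X)), ← htail, add_comm tail, map_add, map_mul,
      map_add, map_one, map_X, evalAt_add (.mul radius_pos.le .var (.add radius_pos.le .one .var))
        (absConv_toComplex.2 tail_absConv) hx,
      evalAt_mul .var (.add radius_pos.le .one .var) hx, evalAt_add .one .var hx, evalAt_X,
      evalAt_one]
  calc ‖evalAt x (toComplex leafSeries)‖
    _ ≤ ‖x‖ * ‖1 + x‖ + ‖evalAt x (toComplex tail)‖ := by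
      rw [hx_eval, ← norm_mul]
      exact norm_add_le _ _
    _ < radius * (1 + radius) + evalAt radius tail := by
      refine add_lt_add_of_lt_of_le ?_ (norm_evalAt_toComplex_le tail_absConv tail_nonneg hx)
      exact mul_lt_mul' hx (norm_one_add_lt hx hne) (norm_nonneg _) radius_pos
    _ = 1 := by rw [← hradius_eval, evalAt_radius]

/-- Minus the derivative of `discr` at `radius`. -/
noncomputable def slope : ℝ := 2 + 2 * radius * evalAt (radius ^ 2) (derivative ℝ leafSeries)

theorem slope_pos : 0 < slope := by
  have hderiv : 0 ≤ evalAt (radius ^ 2) (derivative ℝ leafSeries) := tsum_nonneg fun n => by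
    rw [coeff_derivative]
    have := coeff_nonneg (n + 1)
    positivity
  have := radius_pos
  rw [slope]
  positivity

theorem sq_radius_lt_quarter : radius ^ 2 < 1 / 4 := by
  nlinarith [radius_pos, radius_lt_half]

theorem hasDerivAt_discr : HasDerivAt discr (-slope) radius := by
  have hleaf : HasDerivAt (fun x => evalAt x leafSeries)
      (evalAt (radius ^ 2) (derivative ℝ leafSeries)) (radius ^ 2) :=
    hasDerivAt_evalAt absConv_quarter
      ((Real.norm_of_nonneg (sq_nonneg _)).trans_lt sq_radius_lt_quarter)
  have hcomp : HasDerivAt (fun x => evalAt (x ^ 2) leafSeries) _ radius :=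
    hleaf.comp (h := fun x : ℝ => x ^ 2) radius (hasDerivAt_pow 2 radius)
  have := (((hasDerivAt_id radius).const_mul 2).const_sub 1).sub hcomp
  refine this.congr_deriv ?_
  rw [slope]
  push_cast
  ring

theorem discr_eq_evalAt {x : ℝ} (hx : ‖x‖ ≤ 1 / 2) : discr x = evalAt x (sqrtSeries ^ 2) := by
  have hexp : AbsConv (1 / 2) (expand 2 two_ne_zero leafSeries) :=
    AbsConv.expand _ (by norm_num; exact absConv_quarter)
  rw [sqrtSeries.sq_eq, show (2 : ℝ⟦X⟧) = C (2 : ℝ) from (map_ofNat C 2).symm,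
    evalAt_sub (.one_sub_C_mul_X (by norm_num) 2) hexp hx, evalAt_one_sub_C_mul_X, evalAt_expand,
    discr]

end leafSeries

namespace sqrtSeries

open leafSeries

/-- The quotient of `sqrtSeries` by its singular part `√(1 - x / radius)`. -/
noncomputable def unitFactor : ℝ⟦X⟧ := sqrtSeries * oneSubPow radius (-(1 / 2))

theorem eq_mul_unitFactor : sqrtSeries = oneSubPow radius (1 / 2) * unitFactor := by
  rw [unitFactor, mul_left_comm, ← oneSubPow_add, add_neg_cancel, oneSubPow_zero, mul_one]

theorem sq_eq_mul_unitFactor_sq :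
    sqrtSeries ^ 2 = (1 - C radius⁻¹ * X) * unitFactor ^ 2 := by
  conv_lhs => rw [eq_mul_unitFactor, mul_pow, sq, ← oneSubPow_add, add_halves, oneSubPow_one]

theorem evalAt_radius_sq : evalAt radius (sqrtSeries ^ 2) = 0 := by
  rw [← discr_eq_evalAt ((Real.norm_of_nonneg radius_pos.le).trans_le radius_lt_half.le),
    discr_radius]

theorem unitFactor_sq_mem_regular : unitFactor ^ 2 ∈ regular := by
  rw [← toComplex_mem_overconvergent]
  refine mem_overconvergent_of_one_sub_mul (a := (radius : ℂ))
    (Complex.ofReal_ne_zero.2 radius_pos.ne') (Complex.norm_of_nonneg radius_pos.le).le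
    (toComplex_mem_overconvergent.2 sq_mem_regular) ?_ ?_
  · rw [evalAt_toComplex, evalAt_radius_sq, Complex.ofReal_zero]
  · rw [sq_eq_mul_unitFactor_sq, map_mul]
    simp

theorem evalAt_radius_unitFactor_sq : evalAt radius (unitFactor ^ 2) = radius * slope := by
  obtain ⟨r, hr, hconv⟩ := unitFactor_sq_mem_regular
  have hr₀ : 0 ≤ r := radius_pos.le.trans hr.le
  have hprod : HasDerivAt (fun x => (1 - radius⁻¹ * x) * evalAt x (unitFactor ^ 2))
      (-(radius⁻¹ * evalAt radius (unitFactor ^ 2))) radius := by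
    have := (((hasDerivAt_id radius).const_mul radius⁻¹).const_sub 1).mul
      (hasDerivAt_evalAt hconv ((Real.norm_of_nonneg radius_pos.le).trans_lt hr))
    refine this.congr_deriv ?_
    simp only [id_eq, inv_mul_cancel₀ radius_pos.ne']
    ring
  have hdiscr : discr =ᶠ[𝓝 radius] fun x => (1 - radius⁻¹ * x) * evalAt x (unitFactor ^ 2) := by
    filter_upwards [Ioo_mem_nhds radius_pos (lt_min hr radius_lt_half)] with x hx
    have hxn : ‖x‖ ≤ min r (1 / 2) := (Real.norm_of_nonneg hx.1.le).trans_le hx.2.le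
    rw [discr_eq_evalAt (hxn.trans (min_le_right _ _)), sq_eq_mul_unitFactor_sq,
      evalAt_mul (.one_sub_C_mul_X hr₀ _) hconv
        (hxn.trans (min_le_left _ _)), evalAt_one_sub_C_mul_X]
  have hslope := neg_inj.1 ((hprod.congr_of_eventuallyEq hdiscr).unique hasDerivAt_discr)
  rw [← hslope, mul_inv_cancel_left₀ radius_pos.ne']

theorem evalAt_unitFactor_sq_ne_zero {x : ℂ} (hx : ‖x‖ ≤ radius) :
    evalAt x (toComplex (unitFactor ^ 2)) ≠ 0 := by
  rcases eq_or_ne x radius with rfl | hne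
  · rw [evalAt_toComplex, evalAt_radius_unitFactor_sq]
    exact Complex.ofReal_ne_zero.2 (mul_pos radius_pos slope_pos).ne'
  · have hsqrt : AbsConv radius (toComplex sqrtSeries) := absConv_toComplex.2 absConv_radius
    have hunit : AbsConv radius (toComplex (unitFactor ^ 2)) :=
      absConv_toComplex.2 (absConv_of_mem_overconvergent unitFactor_sq_mem_regular)
    intro hzero
    have hsq : evalAt x (toComplex sqrtSeries) ^ 2 = 0 := by
      rw [← evalAt_pow hsqrt hx, ← map_pow, sq_eq_mul_unitFactor_sq, map_mul,
        evalAt_mul _ hunit hx, hzero, mul_zero]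
      exact absConv_toComplex.2 (.one_sub_C_mul_X radius_pos.le _)
    have hlt := norm_evalAt_lt_one hx hne
    rw [sq_eq_zero_iff, sqrtSeries, map_sub, map_one,
      evalAt_sub .one (absConv_toComplex.2 leafSeries.absConv_radius) hx, evalAt_one,
      sub_eq_zero] at hsq
    rw [← hsq, norm_one] at hlt
    exact hlt.false

theorem unitFactor_mem_regular : unitFactor ∈ regular :=
  (mem_overconvergent_of_sq unitFactor_sq_mem_regular fun _ => evalAt_unitFactor_sq_ne_zero).1

theorem unitFactor_inv_mem_regular : unitFactor⁻¹ ∈ regular :=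
  (mem_overconvergent_of_sq unitFactor_sq_mem_regular fun _ => evalAt_unitFactor_sq_ne_zero).2

theorem sq_evalAt_radius_unitFactor : evalAt radius unitFactor ^ 2 = radius * slope := by
  rw [← evalAt_radius_unitFactor_sq,
    evalAt_pow (absConv_of_mem_overconvergent unitFactor_mem_regular)
      (Real.norm_of_nonneg radius_pos.le).le]

end sqrtSeries

end singularity

/-! ### Asymptotics of the coefficients -/

section coefficients

open PowerSeries leafSeries

namespace sqrtSeries

theorem tendsto_coeff_leafSeries :
    Tendsto (fun n : ℕ => coeff n leafSeries * radius ^ n * ((n : ℝ) + 1) ^ (3 / 2 : ℝ)) atTop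
      (𝓝 (evalAt radius unitFactor / (2 * √Real.pi))) := by
  have hGamma : Real.Gamma (-(1 / 2)) = -(2 * √Real.pi) := by
    have := Real.Gamma_add_one (s := -(1 / 2)) (by norm_num)
    rw [show -(1 / 2 : ℝ) + 1 = 1 / 2 by norm_num, Real.Gamma_one_half_eq] at this
    linarith
  have hlim := (tendsto_coeff_oneSubPow_mul (s := -(1 / 2)) radius_pos unitFactor_mem_regular).neg
  have hvalue : -((Real.Gamma (-(1 / 2)))⁻¹ * evalAt radius unitFactor) =
      evalAt radius unitFactor / (2 * √Real.pi) := by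
    rw [hGamma, inv_neg]
    ring
  rw [hvalue, neg_neg, ← eq_mul_unitFactor] at hlim
  refine hlim.congr' ?_
  filter_upwards [eventually_gt_atTop 0] with n hn
  rw [sqrtSeries, map_sub, PowerSeries.coeff_one, if_neg hn.ne']
  norm_num

theorem evalAt_radius_unitFactor_pos : 0 < evalAt radius unitFactor := by
  have hnonneg : 0 ≤ evalAt radius unitFactor / (2 * √Real.pi) :=
    ge_of_tendsto' tendsto_coeff_leafSeries fun n => by
      have := coeff_nonneg n
      have := radius_pos
      positivity
  have hpos : 0 < 2 * √Real.pi := mul_pos two_pos (Real.sqrt_pos.2 Real.pi_pos)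
  refine lt_of_le_of_ne ?_ fun hzero => ?_
  · rwa [le_div_iff₀ hpos, zero_mul] at hnonneg
  · have hsq := sq_evalAt_radius_unitFactor
    rw [← hzero, zero_pow two_ne_zero] at hsq
    exact (mul_pos radius_pos slope_pos).ne hsq

theorem evalAt_radius_unitFactor : evalAt radius unitFactor = √(radius * slope) := by
  rw [← sq_evalAt_radius_unitFactor, Real.sqrt_sq evalAt_radius_unitFactor_pos.le]

theorem evalAt_radius_unitFactor_pow (j : ℕ) : evalAt radius unitFactor ^ j =
    √radius ^ j * √(2 * slope) ^ j * 2 ^ (-(j / 2) : ℝ) := by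
  have hfactor : evalAt radius unitFactor = √radius * √(2 * slope) * 2 ^ (-(1 / 2) : ℝ) := by
    rw [evalAt_radius_unitFactor, Real.sqrt_mul radius_pos.le, Real.sqrt_mul two_pos.le,
      Real.rpow_neg two_pos.le, ← Real.sqrt_eq_rpow]
    field_simp
  rw [hfactor, mul_pow, mul_pow, ← Real.rpow_mul_natCast two_pos.le]
  congr 2
  ring

theorem unitFactor_mul_inv : unitFactor * unitFactor⁻¹ = 1 := by
  refine PowerSeries.mul_inv_cancel _ fun h => ?_
  have := congrArg constantCoeff eq_mul_unitFactor
  rw [map_mul, h, mul_zero, constantCoeff_eq_one] at this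
  exact one_ne_zero this

theorem evalAt_radius_C_mul_unitFactor_inv_pow (c : ℝ) (j : ℕ) :
    evalAt radius (C c * unitFactor⁻¹ ^ j) = c / evalAt radius unitFactor ^ j := by
  have hn : ‖radius‖ ≤ radius := (Real.norm_of_nonneg radius_pos.le).le
  have hinv := absConv_of_mem_overconvergent unitFactor_inv_mem_regular
  have heval : evalAt radius unitFactor * evalAt radius unitFactor⁻¹ = 1 := by
    rw [← evalAt_mul (absConv_of_mem_overconvergent unitFactor_mem_regular) hinv hn,
      unitFactor_mul_inv, evalAt_one]
  rw [evalAt_mul (.const c) (hinv.pow radius_pos.le j) hn, evalAt_pow hinv hn, evalAt_C,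
    eq_inv_of_mul_eq_one_right heval, inv_pow, div_eq_mul_inv]

/-- Substituting `sqrtSeries = oneSubPow radius (1 / 2) * unitFactor` sorts `f` by half-integer
powers of `1 - x / radius`. -/
theorem eq_sum_oneSubPow_mul {f p q : ℝ⟦X⟧} {c : ℝ} {j : ℕ}
    (h : f * sqrtSeries ^ j = C c + sqrtSeries * (p + q * sqrtSeries)) :
    f = oneSubPow radius (-(j / 2)) * (C c * unitFactor⁻¹ ^ j) +
      oneSubPow radius (-((j - 1) / 2)) * (unitFactor * p * unitFactor⁻¹ ^ j) +
      oneSubPow radius (-((j - 2) / 2)) * (unitFactor ^ 2 * q * unitFactor⁻¹ ^ j) := by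
  set Q := oneSubPow radius (1 / 2) with hQ
  set P := oneSubPow radius (-(j / 2)) with hP
  have hPQ : P * Q ^ j = 1 := by
    rw [hP, hQ, ← oneSubPow_natCast_mul, ← oneSubPow_add, mul_one_div, neg_add_cancel,
      oneSubPow_zero]
  have hPQ₁ : oneSubPow radius (-((j - 1) / 2)) = P * Q := by
    rw [← oneSubPow_add]
    congr 1
    ring
  have hPQ₂ : oneSubPow radius (-((j - 2) / 2)) = P * Q * Q := by
    rw [← oneSubPow_add, ← oneSubPow_add]
    congr 1
    ring
  have hunit : unitFactor ^ j * unitFactor⁻¹ ^ j = 1 := by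
    rw [← mul_pow, unitFactor_mul_inv, one_pow]
  rw [eq_mul_unitFactor, mul_pow] at h
  rw [hPQ₁, hPQ₂]
  linear_combination (P * unitFactor⁻¹ ^ j) * h - f * hPQ - f * P * Q ^ j * hunit

end sqrtSeries

open sqrtSeries

theorem HasLeadingTerm.tendsto_coeff {f : ℝ⟦X⟧} {c : ℝ} {j : ℕ} (hf : HasLeadingTerm f c j) :
    Tendsto (fun n : ℕ => coeff n f * radius ^ n * ((n : ℝ) + 1) ^ (1 - (j : ℝ) / 2)) atTop
      (𝓝 (c / (evalAt radius unitFactor ^ j * Real.Gamma (j / 2)))) := by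
  obtain ⟨_, ⟨p, hp, q, hq, rfl⟩, h⟩ := hf
  have hunit := unitFactor_mem_regular
  have hinv : unitFactor⁻¹ ^ j ∈ regular := pow_mem unitFactor_inv_mem_regular j
  have hlead := tendsto_coeff_oneSubPow_mul (s := j / 2) radius_pos
    (mul_mem (C_mem_overconvergent c) hinv)
  have hnext := tendsto_coeff_oneSubPow_mul_zero (s := (j - 1) / 2) (t := j / 2) radius_pos
    (by linarith) (mul_mem (mul_mem hunit hp) hinv)
  have hlast := tendsto_coeff_oneSubPow_mul_zero (s := (j - 2) / 2) (t := j / 2) radius_pos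
    (by linarith) (mul_mem (mul_mem (pow_mem hunit 2) hq) hinv)
  have hsum := (hlead.add hnext).add hlast
  rw [evalAt_radius_C_mul_unitFactor_inv_pow, inv_mul_eq_div, div_div, add_zero, add_zero] at hsum
  refine hsum.congr fun n => ?_
  conv_rhs => rw [eq_sum_oneSubPow_mul h, map_add, map_add, add_mul, add_mul, add_mul, add_mul]

theorem HasLeadingTerm.isEquivalent_odd {F : ℝ⟦X⟧} {c : ℝ} {j : ℕ} (hF : HasLeadingTerm F c j)
    (hc : c ≠ 0) (hj : 0 < j) {f : ℕ → ℝ} (hf : ∀ n, Odd n → f n = coeff ((n + 1) / 2) F) :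
    f ~[atTop ⊓ 𝓟 {n | Odd n}] fun n : ℕ =>
      2 * c * √(2 * slope) ^ (-(j : ℤ)) * √radius ^ (-(j : ℤ) - 1) / Real.Gamma (j / 2) *
        √radius ^ (-(n : ℤ)) * (n : ℝ) ^ ((j : ℝ) / 2 - 1) := by
  have hρ : 0 < √radius := Real.sqrt_pos.2 radius_pos
  have hb : 0 < √(2 * slope) := Real.sqrt_pos.2 (mul_pos two_pos slope_pos)
  have : (0 : ℝ) < j := Nat.cast_pos.2 hj
  have hlim := hF.tendsto_coeff
  nth_rewrite 1 [← Real.sq_sqrt radius_pos.le] at hlim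
  have hconst : c / (evalAt radius unitFactor ^ j * Real.Gamma (j / 2)) * (√radius)⁻¹ *
        2 ^ (1 - (j : ℝ) / 2) =
      2 * c * √(2 * slope) ^ (-(j : ℤ)) * √radius ^ (-(j : ℤ) - 1) / Real.Gamma (j / 2) := by
    rw [evalAt_radius_unitFactor_pow, sub_eq_add_neg 1 ((j : ℝ) / 2), Real.rpow_add two_pos,
      Real.rpow_one, ← neg_add', zpow_neg, zpow_neg, ← Nat.cast_succ, zpow_natCast, zpow_natCast]
    field_simp
    exact pow_succ _ j
  have hunit := pow_pos evalAt_radius_unitFactor_pos j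
  simpa only [hconst, neg_sub] using isEquivalent_odd_of_tendsto hρ (by positivity) hlim hf

end coefficients

/-! ### Numerical values -/

section numerics

open PowerSeries

theorem antitone_natCast_add_one_mul_pow {x : ℝ} (hx : 0 ≤ x) (hx' : x ≤ 1 / 2) :
    Antitone fun n : ℕ => ((n : ℝ) + 1) * x ^ n := by
  refine antitone_nat_of_succ_le fun n => ?_
  have hratio : ((n + 1 : ℕ) + 1 : ℝ) * x ≤ n + 1 := by
    push_cast
    nlinarith [n.cast_nonneg (α := ℝ)]
  calc ((n + 1 : ℕ) + 1 : ℝ) * x ^ (n + 1)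
    _ = (((n + 1 : ℕ) + 1 : ℝ) * x) * x ^ n := by ring
    _ ≤ (n + 1) * x ^ n := mul_le_mul_of_nonneg_right hratio (pow_nonneg hx n)

namespace leafSeries

theorem partialSum_fifteen (x : ℝ) : partialSum 15 x =
    x + x ^ 2 + x ^ 3 + 2 * x ^ 4 + 3 * x ^ 5 + 6 * x ^ 6 + 11 * x ^ 7 + 23 * x ^ 8 + 46 * x ^ 9 +
      98 * x ^ 10 + 207 * x ^ 11 + 451 * x ^ 12 + 983 * x ^ 13 + 2179 * x ^ 14 + 4850 * x ^ 15 := by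
  rw [partialSum, Finset.sum_congr rfl fun n hn => by rw [coeff_eq_getD (Finset.mem_range.1 hn)]]
  simp [Finset.sum_range_succ]

theorem partialSum_mono (N : ℕ) {x y : ℝ} (hx : 0 ≤ x) (hxy : x ≤ y) :
    partialSum N x ≤ partialSum N y :=
  Finset.sum_le_sum fun n _ =>
    mul_le_mul_of_nonneg_left (pow_le_pow_left₀ hx hxy n) (coeff_nonneg n)

theorem radius_lt : radius < 0.4027 := by
  by_contra! hle
  have hdiscr := discr_radius
  have hpart := partialSum_le_evalAt absConv_quarter (sq_nonneg radius) sq_radius_lt_quarter.le 15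
  have hmono := partialSum_mono 15 (sq_nonneg (0.4027 : ℝ)) (pow_le_pow_left₀ (by norm_num) hle 2)
  have hvalue : (1 : ℝ) - 2 * 0.4027 < partialSum 15 (0.4027 ^ 2) := by
    rw [partialSum_fifteen]
    norm_num
  rw [discr] at hdiscr
  linarith

theorem tsum_coeff_add_mul_le {w : ℕ → ℝ} {N : ℕ} {K : ℝ} (hw : ∀ n, 0 ≤ w n)
    (hwK : ∀ n, w n ≤ K * radius ^ (n + N)) : ∑' n, coeff (n + N) leafSeries * w n ≤ K := by
  have hK : 0 ≤ K := nonneg_of_mul_nonneg_left ((hw 0).trans (hwK 0)) (pow_pos radius_pos _)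
  have hsum : HasSum (fun n => coeff n leafSeries * radius ^ n) 1 :=
    evalAt_radius ▸ absConv_radius.hasSum (Real.norm_of_nonneg radius_pos.le).le
  have htail : Summable fun n => coeff (n + N) leafSeries * radius ^ (n + N) :=
    (summable_nat_add_iff N).2 hsum.summable
  have hle (n : ℕ) :
      coeff (n + N) leafSeries * w n ≤ K * (coeff (n + N) leafSeries * radius ^ (n + N)) :=
    (mul_le_mul_of_nonneg_left (hwK n) (coeff_nonneg _)).trans_eq (mul_left_comm _ _ _)
  have hhead : 0 ≤ ∑ n ∈ Finset.range N, coeff n leafSeries * radius ^ n :=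
    Finset.sum_nonneg fun n _ => mul_nonneg (coeff_nonneg n) (pow_nonneg radius_pos.le n)
  have hsplit := hsum.summable.sum_add_tsum_nat_add N
  rw [hsum.tsum_eq] at hsplit
  calc ∑' n, coeff (n + N) leafSeries * w n
    _ ≤ ∑' n, K * (coeff (n + N) leafSeries * radius ^ (n + N)) :=
      (Summable.of_nonneg_of_le (fun n => mul_nonneg (coeff_nonneg _) (hw n)) hle
        (htail.mul_left K)).tsum_le_tsum hle (htail.mul_left K)
    _ = K * ∑' n, coeff (n + N) leafSeries * radius ^ (n + N) := tsum_mul_left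
    _ ≤ K := mul_le_of_le_one_right hK (by linarith)

theorem evalAt_sq_radius_le (N : ℕ) :
    evalAt (radius ^ 2) leafSeries ≤ partialSum N (radius ^ 2) + radius ^ (N + 1) := by
  have hsum := absConv_quarter.hasSum
    ((Real.norm_of_nonneg (sq_nonneg radius)).trans_le sq_radius_lt_quarter.le)
  rw [evalAt, ← hsum.summable.sum_add_tsum_nat_add (N + 1), partialSum]
  gcongr
  refine tsum_coeff_add_mul_le (fun n => by positivity) fun n => ?_
  rw [← pow_mul, ← pow_add]
  exact pow_le_pow_of_le_one radius_pos.le (radius_lt_half.le.trans one_half_lt_one.le) (by omega)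

theorem lt_radius : 0.402697 < radius := by
  by_contra! hle
  have h₀ := radius_pos.le
  have hdiscr := discr_radius
  have hmono := partialSum_mono 15 (sq_nonneg radius) (pow_le_pow_left₀ h₀ hle 2)
  have hpow := pow_le_pow_left₀ h₀ hle 16
  have hvalue : partialSum 15 (0.402697 ^ 2) + 0.402697 ^ 16 < (1 : ℝ) - 2 * 0.402697 := by
    rw [partialSum_fifteen]
    norm_num
  have hupper : evalAt (radius ^ 2) leafSeries ≤ partialSum 15 (radius ^ 2) + radius ^ 16 :=
    evalAt_sq_radius_le 15
  rw [discr] at hdiscr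
  linarith

/-- The partial sums of the derivative of the series, up to and including the exponent `N`. -/
noncomputable def derivPartialSum (N : ℕ) (x : ℝ) : ℝ :=
  ∑ n ∈ Finset.range (N + 1), coeff (n + 1) leafSeries * ((n + 1) * x ^ n)

theorem derivPartialSum_fourteen (x : ℝ) : derivPartialSum 14 x =
    1 + 2 * x + 3 * x ^ 2 + 8 * x ^ 3 + 15 * x ^ 4 + 36 * x ^ 5 + 77 * x ^ 6 + 184 * x ^ 7 +
      414 * x ^ 8 + 980 * x ^ 9 + 2277 * x ^ 10 + 5412 * x ^ 11 + 12779 * x ^ 12 +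
      30506 * x ^ 13 + 72750 * x ^ 14 := by
  rw [derivPartialSum, Finset.sum_congr rfl fun n hn => by
    rw [coeff_eq_getD (Nat.succ_lt_succ (Finset.mem_range.1 hn))]]
  norm_num [Finset.sum_range_succ]
  ring

theorem derivPartialSum_mono (N : ℕ) {x y : ℝ} (hx : 0 ≤ x) (hxy : x ≤ y) :
    derivPartialSum N x ≤ derivPartialSum N y :=
  Finset.sum_le_sum fun n _ => mul_le_mul_of_nonneg_left (by gcongr) (coeff_nonneg _)

theorem hasSum_evalAt_derivative :
    HasSum (fun n : ℕ => coeff (n + 1) leafSeries * ((n + 1) * (radius ^ 2) ^ n))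
      (evalAt (radius ^ 2) (derivative ℝ leafSeries)) := by
  refine ((absConv_quarter.derivative (sq_nonneg _) sq_radius_lt_quarter).hasSum
    (Real.norm_of_nonneg (sq_nonneg radius)).le).congr_fun fun n => ?_
  rw [coeff_derivative, mul_assoc]

theorem derivPartialSum_nonneg (N : ℕ) {x : ℝ} (hx : 0 ≤ x) : 0 ≤ derivPartialSum N x :=
  Finset.sum_nonneg fun n _ => mul_nonneg (coeff_nonneg _) (by positivity)

theorem derivPartialSum_le (N : ℕ) :
    derivPartialSum N (radius ^ 2) ≤ evalAt (radius ^ 2) (derivative ℝ leafSeries) :=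
  sum_le_hasSum _ (fun n _ => mul_nonneg (coeff_nonneg _) (by positivity)) hasSum_evalAt_derivative

theorem evalAt_derivative_le (N : ℕ) : evalAt (radius ^ 2) (derivative ℝ leafSeries) ≤
    derivPartialSum N (radius ^ 2) + (N + 2) * radius ^ N := by
  have hsum := hasSum_evalAt_derivative
  rw [← hsum.tsum_eq, ← hsum.summable.sum_add_tsum_nat_add (N + 1), derivPartialSum]
  gcongr
  refine tsum_coeff_add_mul_le (N := N + 2) (fun n => by positivity) fun n => ?_
  have hanti : ((n + (N + 1) : ℕ) + 1 : ℝ) * radius ^ (n + (N + 1)) ≤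
      ((N + 1 : ℕ) + 1) * radius ^ (N + 1) :=
    antitone_natCast_add_one_mul_pow radius_pos.le radius_lt_half.le (Nat.le_add_left _ _)
  calc ((n + (N + 1) : ℕ) + 1 : ℝ) * (radius ^ 2) ^ (n + (N + 1))
    _ = ((n + (N + 1) : ℕ) + 1) * radius ^ (n + (N + 1)) * radius ^ (n + (N + 1)) := by ring
    _ ≤ ((N + 1 : ℕ) + 1) * radius ^ (N + 1) * radius ^ (n + (N + 1)) :=
      mul_le_mul_of_nonneg_right hanti (pow_nonneg radius_pos.le _)
    _ = (N + 2) * radius ^ N * radius ^ (n + (N + 2)) := by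
      push_cast
      ring

theorem lt_slope : 3.171044 < slope := by
  have hpart := derivPartialSum_le 14
  have hmono := derivPartialSum_mono 14 (sq_nonneg (0.402697 : ℝ))
    (pow_le_pow_left₀ (by norm_num) lt_radius.le 2)
  calc (3.171044 : ℝ)
    _ < 2 + 2 * 0.402697 * derivPartialSum 14 (0.402697 ^ 2) := by
      rw [derivPartialSum_fourteen]
      norm_num
    _ ≤ slope := by
      have := lt_radius.le
      rw [slope]
      gcongr
      exacts [derivPartialSum_nonneg 14 (sq_nonneg _), hmono.trans hpart]

theorem slope_lt : slope < 3.17129 := by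
  have hradius := radius_lt.le
  have h₀ := radius_pos.le
  have hmono := derivPartialSum_mono 14 (sq_nonneg radius) (pow_le_pow_left₀ h₀ hradius 2)
  have hpow := pow_le_pow_left₀ h₀ hradius 14
  calc slope
    _ ≤ 2 + 2 * 0.4027 * (derivPartialSum 14 (0.4027 ^ 2) + 16 * 0.4027 ^ 14) := by
      have hle := evalAt_derivative_le 14
      have hnonneg := (derivPartialSum_nonneg 14 (sq_nonneg radius)).trans (derivPartialSum_le 14)
      rw [slope]
      gcongr
      push_cast at hle
      linarith
    _ < 3.17129 := by
      rw [derivPartialSum_fourteen]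
      norm_num

theorem abs_sqrt_radius_sub_lt : |√radius - 0.6346| < 0.00005 := by
  have hlower : 0.63455 < √radius := Real.lt_sqrt_of_sq_lt (by linarith [lt_radius])
  have hupper : √radius < 0.63465 := (Real.sqrt_lt' (by norm_num)).2 (by linarith [radius_lt])
  rw [abs_lt]
  constructor <;> linarith

theorem abs_sqrt_two_mul_slope_sub_lt : |√(2 * slope) - 2.5184| < 0.00005 := by
  have hlower : 2.51835 < √(2 * slope) := Real.lt_sqrt_of_sq_lt (by linarith [lt_slope])
  have hupper : √(2 * slope) < 2.51845 :=
    (Real.sqrt_lt' (by norm_num)).2 (by linarith [slope_lt])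
  rw [abs_lt]
  constructor <;> linarith

end leafSeries

end numerics

/-! ### Asymptotics of the tree counts -/

section asymptotics

open PowerSeries leafSeries sqrtSeries

namespace RTree

theorem numBinary_two_mul_add_one (k : ℕ) :
    (numBinary (2 * k + 1) : ℝ) = coeff (k + 1) leafSeries := by
  rw [numBinary_eq_coeff ⟨k, rfl⟩, leafSeries]
  congr 2
  omega

theorem injective_two_mul_add_one : Function.Injective fun k : ℕ => 2 * k + 1 :=
  fun a b h => by simpa using h

theorem numBinary_eq_zero {n : ℕ} (hn : n ∉ Set.range fun k : ℕ => 2 * k + 1) :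
    numBinary n = 0 :=
  numBinary_of_even (Nat.not_odd_iff_even.1 fun ⟨k, hk⟩ => hn ⟨k, hk.symm⟩)

theorem summable_numBinary_iff {r : ℝ} (hr : 0 < r) :
    (Summable fun n => (numBinary n : ℝ) * r ^ n) ↔ AbsConv (r ^ 2) leafSeries := by
  rw [← injective_two_mul_add_one.summable_iff fun n hn => by
      rw [numBinary_eq_zero hn, Nat.cast_zero, zero_mul],
    AbsConv, ← summable_nat_add_iff (f := fun n => ‖coeff n leafSeries‖ * (r ^ 2) ^ n) 1,
    ← summable_mul_left_iff hr.ne']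
  refine summable_congr fun k => ?_
  rw [Function.comp_apply, numBinary_two_mul_add_one, Real.norm_of_nonneg (coeff_nonneg _)]
  ring

theorem norm_binarySeries (n : ℕ) : ‖binarySeries n‖ = numBinary n := by
  rw [binarySeries, FormalMultilinearSeries.ofScalars_norm, Real.norm_of_nonneg (Nat.cast_nonneg _)]

theorem radius_binarySeries : binarySeries.radius = ENNReal.ofReal √leafSeries.radius := by
  have hρ : 0 < √leafSeries.radius := Real.sqrt_pos.2 radius_pos
  apply le_antisymm
  · by_contra! hlt
    obtain ⟨r, hr, hr'⟩ := ENNReal.lt_iff_exists_nnreal_btwn.1 hlt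
    have hρr : √leafSeries.radius < r := by
      rwa [← ENNReal.ofReal_coe_nnreal, ENNReal.ofReal_lt_ofReal_iff_of_nonneg hρ.le] at hr
    have hsum := binarySeries.summable_norm_mul_pow hr'
    simp_rw [norm_binarySeries] at hsum
    exact not_absConv (Real.lt_sq_of_sqrt_lt hρr)
      ((summable_numBinary_iff (hρ.trans hρr)).1 hsum)
  · refine binarySeries.le_radius_of_summable ?_
    simp_rw [norm_binarySeries]
    rw [Real.coe_toNNReal _ hρ.le, summable_numBinary_iff hρ, Real.sq_sqrt radius_pos.le]
    exact absConv_radius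

theorem sum_binarySeries_eq_tsum (z : ℝ) :
    binarySeries.sum z = ∑' n, (numBinary n : ℝ) * z ^ n := by
  simp only [FormalMultilinearSeries.sum, binarySeries, FormalMultilinearSeries.ofScalars_apply_eq,
    smul_eq_mul]

theorem mul_sum_binarySeries (z : ℝ) : z * binarySeries.sum z = evalAt (z ^ 2) leafSeries := by
  have hodd : (Function.support fun n => (numBinary n : ℝ) * z ^ n) ⊆
      Set.range fun k : ℕ => 2 * k + 1 := fun n hn => by
    by_contra h
    simp [numBinary_eq_zero h] at hn
  have hsucc : (Function.support fun n => coeff n leafSeries * (z ^ 2) ^ n) ⊆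
      Set.range Nat.succ := fun n hn => by
    rw [Nat.range_succ]
    refine Nat.pos_of_ne_zero fun h => hn ?_
    simp only [h, leafSeries.coeff_zero, zero_mul]
  rw [sum_binarySeries_eq_tsum, ← injective_two_mul_add_one.tsum_eq hodd, ← tsum_mul_left, evalAt,
    ← Nat.succ_injective.tsum_eq hsucc]
  refine tsum_congr fun k => ?_
  rw [numBinary_two_mul_add_one, Nat.succ_eq_add_one]
  ring

theorem sum_binarySeries {z : ℝ} (h₀ : 0 < z) (hz : z < √leafSeries.radius) :
    binarySeries.sum z = (1 - √(discr (z ^ 2))) / z := by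
  have hle : z ^ 2 ≤ leafSeries.radius := ((Real.lt_sqrt h₀.le).1 hz).le
  rw [eq_div_iff h₀.ne', mul_comm, mul_sum_binarySeries,
    ← one_sub_evalAt_eq_sqrt (sq_nonneg z) hle, sub_sub_cancel]

theorem tendsto_discr_div :
    Tendsto (fun z : ℝ => discr (z ^ 2) / (1 - z / √leafSeries.radius)) (𝓝[<] √leafSeries.radius)
      (𝓝 (2 * leafSeries.radius * leafSeries.slope)) := by
  have hρ : 0 < √leafSeries.radius := Real.sqrt_pos.2 radius_pos
  have hsq : √leafSeries.radius ^ 2 = leafSeries.radius := Real.sq_sqrt radius_pos.le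
  have hderiv : HasDerivAt (fun z : ℝ => discr (z ^ 2))
      (-leafSeries.slope * (2 * √leafSeries.radius)) √leafSeries.radius := by
    simpa only [Function.comp_def, Nat.cast_ofNat, Nat.add_one_sub_one, pow_one] using
      HasDerivAt.comp_of_eq (h := fun z : ℝ => z ^ 2) (√leafSeries.radius) hasDerivAt_discr
        (hasDerivAt_pow 2 (√leafSeries.radius)) hsq.symm
  have hlim := ((hasDerivAt_iff_tendsto_slope.1 hderiv).mono_left (nhdsWithin_mono _
    fun z (hz : z < √leafSeries.radius) => hz.ne)).const_mul (-√leafSeries.radius)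
  have hvalue : -√leafSeries.radius * (-leafSeries.slope * (2 * √leafSeries.radius)) =
      2 * leafSeries.radius * leafSeries.slope := by
    linear_combination (2 * leafSeries.slope) * hsq
  rw [hvalue] at hlim
  refine hlim.congr' ?_
  filter_upwards [self_mem_nhdsWithin] with z hz
  have hne : z - √leafSeries.radius ≠ 0 := sub_ne_zero.2 (ne_of_lt hz)
  have hne' : √leafSeries.radius - z ≠ 0 := sub_ne_zero.2 (ne_of_gt hz)
  rw [slope_def_field, hsq, discr_radius]
  field_simp
  ring

theorem one_sub_sqrt_div_sub_div {ρ b z d : ℝ} (hz : 0 < z) (hzρ : z < ρ) :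
    ((1 - √d) / z - (1 / ρ - b * √(1 - z / ρ))) / √(1 - z / ρ) =
      √(1 - z / ρ) / z - √(d / (1 - z / ρ)) / z + b := by
  have hρ := hz.trans hzρ
  have hpos : 0 < 1 - z / ρ := sub_pos.2 ((div_lt_one hρ).2 hzρ)
  have hsqrt := Real.sqrt_pos.2 hpos
  have hdiv : √(1 - z / ρ) / z = (1 / z - 1 / ρ) / √(1 - z / ρ) := by
    rw [div_eq_div_iff hz.ne' hsqrt.ne', Real.mul_self_sqrt hpos.le]
    field_simp
  rw [hdiv, Real.sqrt_div' _ hpos.le]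
  generalize √(1 - z / ρ) = w at hsqrt
  field_simp
  ring

theorem sum_binarySeries_isLittleO :
    (fun z : ℝ => binarySeries.sum z - (1 / √leafSeries.radius -
      √(2 * leafSeries.slope) * √(1 - z / √leafSeries.radius))) =o[𝓝[<] √leafSeries.radius]
      fun z : ℝ => √(1 - z / √leafSeries.radius) := by
  have hρ : 0 < √leafSeries.radius := Real.sqrt_pos.2 radius_pos
  have hmem : ∀ᶠ z in 𝓝[<] √leafSeries.radius, 0 < z ∧ z < √leafSeries.radius :=
    Ioo_mem_nhdsLT hρ
  refine isLittleO_of_tendsto' ?_ ?_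
  · filter_upwards [hmem] with z hz h
    exact absurd h (Real.sqrt_pos.2 (sub_pos.2 ((div_lt_one hρ).2 hz.2))).ne'
  · have hid : Tendsto (fun z : ℝ => z) (𝓝[<] √leafSeries.radius) (𝓝 √leafSeries.radius) :=
      tendsto_nhdsWithin_of_tendsto_nhds tendsto_id
    have hvanish := ((hid.div_const √leafSeries.radius).const_sub 1).sqrt.div hid hρ.ne'
    rw [div_self hρ.ne', sub_self, Real.sqrt_zero, zero_div] at hvanish
    have hslope := tendsto_discr_div.sqrt.div hid hρ.ne'
    rw [mul_right_comm, Real.sqrt_mul' _ radius_pos.le, mul_div_cancel_right₀ _ hρ.ne'] at hslope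
    have hlim := (hvanish.sub hslope).add_const √(2 * leafSeries.slope)
    rw [zero_sub, neg_add_cancel] at hlim
    refine hlim.congr' ?_
    filter_upwards [hmem] with z hz
    rw [sum_binarySeries hz.1 hz.2, one_sub_sqrt_div_sub_div hz.1 hz.2]
    rfl

theorem sizeAddLeaves_cls (S : RTree) : TreeClass.sizeAddLeaves {S.cls} = S.size + S.leaves := by
  simp [TreeClass.sizeAddLeaves]

theorem cls_eq_mk_zero {S : RTree} (h : S.size + S.leaves = 2) : S.cls = TreeClass.mk 0 := by
  obtain ⟨F, hF⟩ := TreeClass.exists_eq_mk S.cls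
  rw [← sizeAddLeaves_cls, hF] at h
  by_cases hzero : F = 0
  · rw [hF, hzero]
  · rw [TreeClass.sizeAddLeaves_mk hzero] at h
    have := TreeClass.two_le_sizeAddLeaves hzero
    omega

theorem symmetryConstant_pos (S : RTree) : 0 < S.symmetryConstant := by
  rw [UBClass.symmetryConstant_eq]
  exact UBClass.constant_pos (Multiset.singleton_ne_zero _)

theorem totalEmb_isEquivalent (S : RTree) :
    (fun n : ℕ => (totalEmb n S : ℝ)) ~[atTop ⊓ 𝓟 {n | Odd n}] fun n : ℕ =>
      2 * S.symmetryConstant * √(2 * leafSeries.slope) ^ (-(S.size : ℤ) - S.leaves + 1) *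
        √leafSeries.radius ^ (-(S.size : ℤ) - S.leaves) /
        Real.Gamma (((S.size : ℝ) + S.leaves - 1) / 2) * √leafSeries.radius ^ (-(n : ℤ)) *
        (n : ℝ) ^ (((S.size : ℝ) + S.leaves - 3) / 2) := by
  have hS := Multiset.singleton_ne_zero S.cls
  have hle := TreeClass.two_le_sizeAddLeaves hS
  have hlead := TreeClass.hasLeadingTerm_allSeries hS
  rw [sizeAddLeaves_cls] at hle hlead
  obtain ⟨j, hj⟩ := Nat.exists_eq_add_of_le' (one_le_two.trans hle)
  rw [hj, Nat.add_sub_cancel, ← UBClass.symmetryConstant_eq] at hlead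
  have hsize : (S.size : ℝ) = j + 1 - S.leaves := eq_sub_of_add_eq (by exact_mod_cast hj)
  have hb : -(S.size : ℤ) - S.leaves + 1 = -(j : ℤ) := by omega
  have hρ : -(S.size : ℤ) - S.leaves = -(j : ℤ) - 1 := by omega
  have hGamma : ((S.size : ℝ) + S.leaves - 1) / 2 = j / 2 := by rw [hsize]; ring
  have hpow : ((S.size : ℝ) + S.leaves - 3) / 2 = j / 2 - 1 := by rw [hsize]; ring
  rw [hb, hρ, hGamma, hpow]
  exact hlead.isEquivalent_odd S.symmetryConstant_pos.ne' (by omega) fun n hn =>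
    totalEmb_eq_coeff hn S

theorem totalGoodEmb_isEquivalent {S : RTree} (h : 2 < S.size + S.leaves) :
    (fun n : ℕ => (totalGoodEmb n S : ℝ)) ~[atTop ⊓ 𝓟 {n | Odd n}] fun n : ℕ =>
      2 * S.symmetryConstant * √(2 * leafSeries.slope) ^ (-(S.size : ℤ) - S.leaves + 2) *
        √leafSeries.radius ^ (-(S.size : ℤ) - S.leaves + 1) /
        Real.Gamma (((S.size : ℝ) + S.leaves - 2) / 2) * √leafSeries.radius ^ (-(n : ℤ)) *
        (n : ℝ) ^ (((S.size : ℝ) + S.leaves - 4) / 2) := by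
  have hlead := TreeClass.hasLeadingTerm_goodSeries S.cls
  rw [sizeAddLeaves_cls] at hlead
  obtain ⟨j, hj⟩ := Nat.exists_eq_add_of_le' h.le
  rw [hj, Nat.add_sub_cancel, ← UBClass.symmetryConstant_eq] at hlead
  have hsize : (S.size : ℝ) = j + 2 - S.leaves := eq_sub_of_add_eq (by exact_mod_cast hj)
  have hb : -(S.size : ℤ) - S.leaves + 2 = -(j : ℤ) := by omega
  have hρ : -(S.size : ℤ) - S.leaves + 1 = -(j : ℤ) - 1 := by omega
  have hGamma : ((S.size : ℝ) + S.leaves - 2) / 2 = j / 2 := by rw [hsize]; ring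
  have hpow : ((S.size : ℝ) + S.leaves - 4) / 2 = j / 2 - 1 := by rw [hsize]; ring
  rw [hb, hρ, hGamma, hpow]
  exact hlead.isEquivalent_odd S.symmetryConstant_pos.ne' (by omega) fun n hn =>
    totalGoodEmb_eq_coeff hn S

theorem totalGoodEmb_isEquivalent_of_eq_two {S : RTree} (h : S.size + S.leaves = 2) :
    (fun n : ℕ => (totalGoodEmb n S : ℝ)) ~[atTop ⊓ 𝓟 {n | Odd n}] fun n : ℕ =>
      √(2 * leafSeries.slope) / √Real.pi * √leafSeries.radius ^ (-(n : ℤ)) *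
        (n : ℝ) ^ (-(3 / 2) : ℝ) := by
  have hρ : 0 < √leafSeries.radius := Real.sqrt_pos.2 radius_pos
  have hunit := evalAt_radius_unitFactor_pos
  have hlim := tendsto_coeff_leafSeries
  nth_rewrite 1 [← Real.sq_sqrt radius_pos.le] at hlim
  have hcoeff (n : ℕ) (hn : Odd n) :
      (totalGoodEmb n S : ℝ) = coeff ((n + 1) / 2) leafSeries := by
    rw [totalGoodEmb_eq_coeff hn, cls_eq_mk_zero h, TreeClass.goodSeries_mk_zero, sqrtSeries,
      sub_sub_cancel]
  have hconst : evalAt leafSeries.radius unitFactor / (2 * √Real.pi) * (√leafSeries.radius)⁻¹ *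
      2 ^ (3 / 2 : ℝ) = √(2 * leafSeries.slope) / √Real.pi := by
    have hpow := evalAt_radius_unitFactor_pow 1
    have htwo : (2 : ℝ) ^ (-(1 / 2) : ℝ) * 2 ^ (3 / 2 : ℝ) = 2 := by
      rw [← Real.rpow_add two_pos]
      norm_num
    rw [pow_one, pow_one, pow_one, Nat.cast_one] at hpow
    rw [hpow]
    field_simp
    linear_combination √(2 * leafSeries.slope) * htwo
  simpa only [hconst] using isEquivalent_odd_of_tendsto hρ (by positivity) hlim hcoeff

end RTree

end asymptotics

theorem mainTheorem7 :
    ∃ ρ b : ℝ,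
      -- numerical values, correct to four decimals
      |ρ - 0.6346| < 0.00005 ∧ |b - 2.5184| < 0.00005 ∧
      -- `ρ` is the radius of convergence of `V`, and `b` is the constant of its expansion at `ρ`
      RTree.binarySeries.radius = ENNReal.ofReal ρ ∧
      (fun z : ℝ => RTree.binarySeries.sum z - (1 / ρ - b * √(1 - z / ρ)))
        =o[𝓝[<] ρ] (fun z : ℝ => √(1 - z / ρ)) ∧
      ∀ (S : RTree) (m l : ℕ), m = S.size → l = S.leaves →
        -- all embeddings
        ((fun n : ℕ => (RTree.totalEmb n S : ℝ)) ~[atTop ⊓ 𝓟 {n | Odd n}]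
          (fun n : ℕ => 2 * S.symmetryConstant * b ^ (-(m : ℤ) - l + 1) * ρ ^ (-(m : ℤ) - l) /
            Real.Gamma (((m : ℝ) + l - 1) / 2) * ρ ^ (-(n : ℤ)) *
            (n : ℝ) ^ (((m : ℝ) + l - 3) / 2))) ∧
        (∀ n : ℕ, Even n → RTree.totalEmb n S = 0) ∧
        -- good embeddings
        (0 < (m : ℤ) + l - 2 →
          (fun n : ℕ => (RTree.totalGoodEmb n S : ℝ)) ~[atTop ⊓ 𝓟 {n | Odd n}]
            (fun n : ℕ => 2 * S.symmetryConstant * b ^ (-(m : ℤ) - l + 2) *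
              ρ ^ (-(m : ℤ) - l + 1) / Real.Gamma (((m : ℝ) + l - 2) / 2) * ρ ^ (-(n : ℤ)) *
              (n : ℝ) ^ (((m : ℝ) + l - 4) / 2))) ∧
        ((m : ℤ) + l - 2 = 0 →
          (fun n : ℕ => (RTree.totalGoodEmb n S : ℝ)) ~[atTop ⊓ 𝓟 {n | Odd n}]
            (fun n : ℕ => b / √Real.pi * ρ ^ (-(n : ℤ)) * (n : ℝ) ^ (-(3 / 2) : ℝ))) ∧
        (∀ n : ℕ, Even n → RTree.totalGoodEmb n S = 0) := by
  refine ⟨√leafSeries.radius, √(2 * leafSeries.slope), leafSeries.abs_sqrt_radius_sub_lt,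
    leafSeries.abs_sqrt_two_mul_slope_sub_lt, RTree.radius_binarySeries,
    RTree.sum_binarySeries_isLittleO, ?_⟩
  rintro S m l rfl rfl
  exact ⟨S.totalEmb_isEquivalent, fun n hn => RTree.totalEmb_of_even hn S,
    fun h => RTree.totalGoodEmb_isEquivalent (by omega),
    fun h => RTree.totalGoodEmb_isEquivalent_of_eq_two (by omega),
    fun n hn => RTree.totalGoodEmb_of_even hn S⟩
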